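/- Let $d \ge 2$. For $1\le p\le\infty$ let $L^p_\sigma(\mathbb{R}^d)$ be the space of vector fields in $L^p(\mathbb{R}^d;\mathbb{R}^d)$ that are divergence free in the sense of distributions. *Frequency sparseness.* Let $\chi:\mathbb{R}^d\to[0,1]$ be a smooth radial function with $\chi=1$ for $|\xi|\le 3/4$ and $\chi=0$ for $|\xi|\ge 4/3$ (the low-frequency cut-off of a Littlewood–Paley decomposition with dyadic blocks $\dot\Delta_j=\varphi(2^{-j}D)$, $\varphi(\xi)=\chi(\xi/2)-\chi(\xi)$). For $J\in\mathbb{R}$ let $\Delta_{<J}=\chi(2^{-J}D)$, that is, convolution with the Schwartz function whose Fourier transform is $\chi(2^{-J}\xi)$; its symbol equals $\sum_{k\ge1}\varphi(2^{k-J}\xi)$ for $\xi\ne0$. For $\beta\in(0,1)$, a vector field $u_0\in L^p$ is $(\beta,J)$-sparse in frequency in $L^p$ if $\|\Delta_{<J}u_0\|_{L^p}\le\beta\|u_0\|_{L^p}$. *Strong solutions.* For $d<p\le\infty$, a strong $L^p$ solution on $\mathbb{R}^d\times(0,T)$ of the Navier–Stokes equations (with unit viscosity) with initial data $u_0\in L^p_\sigma(\mathbb{R}^d)$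 is a function $u\in C((0,T);L^p)$ with values in $L^p_\sigma$ that satisfies $\sup_{0<s\le t}\|u(s)\|_{L^p}<\infty$ for every $t<T$, satisfies $u(t)\to u_0$ in $L^p$ as $t\to0^+$ when $p<\infty$, and satisfies $$u(t)=e^{t\Delta}u_0-\int_0^te^{(t-s)\Delta}\mathbb{P}\nabla\cdot(u\otimes u)(s)\,ds\qquad(0<t<T),$$ where $\mathbb P$ is the Leray projection and the integral converges in $L^p$. **Proposition.** There are constants $C=C(d,p)>0$ and $K=K(d,\chi)>0$ such that the following holds. Let $d<p\le\infty$, $u_0\in L^p_\sigma(\mathbb{R}^d)$ and $\gamma\in(0,1)$. There exists $T>0$, which is given by $$\|u_0\|_{L^p}\,T^{\frac12\left(1-\frac dp\right)}=\frac{\gamma}{2C}$$ if $u_0\neq0$, with the following properties. There is a unique strong $L^p$ solution $u$ of the Navier–Stokes equations with initial data $u_0$ on $\mathbb{R}^d\times(0,T)$. Moreover, for every cut-off $\chi$ as above, every $t\in(0,T)$ and every $J\in\mathbb{R}$ with $2^J\ge K\gamma^{-1}t^{-1/2}$: if $u_0$ is $(\gamma/2,J)$-sparse in frequency in $L^p$,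 then $$\|u(t)\|_{L^p}\le\gamma\|u_0\|_{L^p}.$$ -/

import Mathlib

open MeasureTheory Set Filter Topology
open scoped FourierTransform ENNReal ContDiff

noncomputable section

/-- Euclidean space `ℝ^d`, serving both as physical space and as the space of values of vector
fields. -/
abbrev RSpace (d : ℕ) : Type := EuclideanSpace ℝ (Fin d)

/-- Vector fields on `ℝ^d` of class `L^p` (modulo equality almost everywhere; the pointwise length
is the Euclidean one). -/
abbrev LpField (d : ℕ) (p : ℝ≥0∞) : Type := Lp (RSpace d) p (volume : Measure (RSpace d))

/-- The vector field `v` is divergence free in the sense of distributions. -/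
def IsDivFree {d : ℕ} (v : RSpace d → RSpace d) : Prop :=
  ∀ φ : RSpace d → ℝ, ContDiff ℝ ∞ φ → HasCompactSupport φ →
    ∫ x, inner ℝ (v x) (gradient φ x) = 0

/-! ### Littlewood-Paley truncation -/

/-- The low frequency cut-off function `χ` of a Littlewood-Paley decomposition: smooth, radial, with
values in `[0,1]`, equal to `1` for `|ξ| ≤ 3/4` and supported in `|ξ| ≤ 4/3`. -/
structure LPCutoff (d : ℕ) where
  /-- the cut-off function -/
  toFun : RSpace d → ℝ
  smooth : ContDiff ℝ ∞ toFun
  radial : ∀ ξ η : RSpace d, ‖ξ‖ = ‖η‖ → toFun ξ = toFun η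
  nonneg : ∀ ξ, 0 ≤ toFun ξ
  le_one : ∀ ξ, toFun ξ ≤ 1
  eq_one : ∀ ξ, ‖ξ‖ ≤ 3 / 4 → toFun ξ = 1
  eq_zero : ∀ ξ, 4 / 3 ≤ ‖ξ‖ → toFun ξ = 0

/-- The function `φ(ξ) = χ(ξ/2) - χ(ξ)`, supported in the annulus `3/4 ≤ |ξ| ≤ 8/3`;
the dyadic block of index `j` is the Fourier multiplier with symbol `φ(2^{-j} ξ)`. -/
def LPCutoff.annulus {d : ℕ} (χ : LPCutoff d) (ξ : RSpace d) : ℝ :=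
  χ.toFun ((2 : ℝ)⁻¹ • ξ) - χ.toFun ξ

/-- Summing the symbols of all the dyadic blocks of negative index gives `χ` off the origin:
`∑_{j < 0} φ(2^{-j} η) = χ(η)` (here `j = -(k+1)`). Rescaling `η = 2^{-J} ξ`, the symbol of the sum
of the blocks below `J` is `χ(2^{-J} ξ)`. -/
theorem LPCutoff.hasSum_annulus {d : ℕ} (χ : LPCutoff d) (η : RSpace d) (hη : η ≠ 0) :
    HasSum (fun k : ℕ => χ.annulus ((2 : ℝ) ^ (k + 1) • η)) (χ.toFun η) := by
  have hpos : 0 < ‖η‖ := norm_pos_iff.mpr hη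
  obtain ⟨N, hN⟩ := pow_unbounded_of_one_lt (4 / 3 / ‖η‖) (one_lt_two : (1 : ℝ) < 2)
  have hz : ∀ n, N ≤ n → χ.toFun ((2 : ℝ) ^ n • η) = 0 := by
    intro n hn
    apply χ.eq_zero
    rw [norm_smul, norm_pow, Real.norm_ofNat]
    have h1 : (2 : ℝ) ^ N ≤ 2 ^ n := pow_le_pow_right₀ one_le_two hn
    exact ((div_lt_iff₀ hpos).mp (hN.trans_le h1)).le
  have hterm : ∀ k : ℕ, χ.annulus ((2 : ℝ) ^ (k + 1) • η)
      = χ.toFun ((2 : ℝ) ^ k • η) - χ.toFun ((2 : ℝ) ^ (k + 1) • η) := by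
    intro k
    unfold LPCutoff.annulus
    rw [smul_smul, pow_succ', inv_mul_cancel_left₀ two_ne_zero]
  have hs := hasSum_sum_of_ne_finset_zero (L := SummationFilter.unconditional ℕ) (f := fun k : ℕ => χ.annulus ((2 : ℝ) ^ (k + 1) • η))
    (s := Finset.range N) (by
      intro k hk
      have hk' : N ≤ k := by simpa using hk
      rw [hterm, hz k hk', hz (k + 1) (by omega), sub_zero])
  rw [Finset.sum_congr rfl (fun k _ => hterm k),
    Finset.sum_range_sub' (fun k => χ.toFun ((2 : ℝ) ^ k • η)), hz N le_rfl] at hs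
  simpa using hs

/-- The convolution kernel of the operator `Δ_{<J}`: the inverse Fourier transform of
`χ(2^{-J} ξ)`, with `ξ` the angular frequency (Mathlib's frequency variable times `2π`).
It is real since `χ` is radial. -/
def lowFreqKernel {d : ℕ} (χ : LPCutoff d) (J : ℝ) (x : RSpace d) : ℝ :=
  (𝓕⁻ (fun ξ : RSpace d => (χ.toFun (((2 : ℝ) ^ (-J) * (2 * Real.pi)) • ξ) : ℂ)) x).re

/-- The low frequency part `Δ_{<J} v` of a vector field, as a convolution with a Schwartz
function. -/
def lowFreq {d : ℕ} (χ : LPCutoff d) (J : ℝ) (v : RSpace d → RSpace d) (x : RSpace d) : RSpace d :=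
  ∫ y, lowFreqKernel χ J (x - y) • v y

/-- `(β, J)`-sparseness in frequency in `L^p`: `‖Δ_{<J} v‖_p ≤ β ‖v‖_p`. -/
def IsFreqSparse {d : ℕ} (χ : LPCutoff d) (p : ℝ≥0∞) (β J : ℝ) (v : RSpace d → RSpace d) : Prop :=
  eLpNorm (lowFreq χ J v) p volume ≤ ENNReal.ofReal β * eLpNorm v p volume

/-! ### The Navier-Stokes equations -/

/-- The Gauss kernel `(4πt)^{-d/2} exp(-|x|²/(4t))`. -/
def gaussKernel {d : ℕ} (t : ℝ) (x : RSpace d) : ℝ :=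
  (4 * Real.pi * t) ^ (-(d : ℝ) / 2) * Real.exp (-‖x‖ ^ 2 / (4 * t))

/-- The heat semigroup `e^{tΔ} v`, for `t > 0`. -/
def heatFlow {d : ℕ} (t : ℝ) (v : RSpace d → RSpace d) (x : RSpace d) : RSpace d :=
  ∫ y, gaussKernel t (x - y) • v y

/-- The Fourier symbol of the `(i; j, k)` component of the operator `e^{τΔ} ℙ ∇·`,
where `ℙ` is the Leray projection onto divergence free fields: the product of the symbols `2πi ξ_k`
of `∂_k`, `δ_{ij} - ξ_i ξ_j / |ξ|²` of `ℙ_{ij}` and `exp(-4π²τ|ξ|²)` of `e^{τΔ}`. -/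
def oseenSymbol {d : ℕ} (τ : ℝ) (i j k : Fin d) (ξ : RSpace d) : ℂ :=
  2 * Real.pi * Complex.I * (ξ k : ℂ)
    * (((if i = j then 1 else 0) - ξ i * ξ j / ‖ξ‖ ^ 2 : ℝ) : ℂ)
    * (Real.exp (-4 * Real.pi ^ 2 * τ * ‖ξ‖ ^ 2) : ℂ)

/-- The convolution kernel (the derivative `∂_k` of the `(i,j)` entry of the Oseen kernel) of the
`(i; j, k)` component of `e^{τΔ} ℙ ∇·`. It is real by the symmetry of its symbol. -/
def oseenKernel {d : ℕ} (τ : ℝ) (i j k : Fin d) (x : RSpace d) : ℝ :=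
  (𝓕⁻ (oseenSymbol τ i j k) x).re

/-- The vector field `e^{τΔ} ℙ ∇·(v ⊗ v)`, for `τ > 0`. -/
def oseenFlow {d : ℕ} (τ : ℝ) (v : RSpace d → RSpace d) (x : RSpace d) : RSpace d :=
  WithLp.toLp 2 fun i => ∑ j, ∑ k, ∫ y, oseenKernel τ i j k (x - y) * (v y j * v y k)

/-- `u` is a strong `L^p` solution on `ℝ^d × (0,T)` (a mild solution in `C((0,T); L^p)`, bounded
in `L^p` near the initial time) of the incompressible Navier-Stokes equations with unit viscosity
and initial data `u₀`. Only the values of `u` on `(0,T)` matter. -/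
structure IsStrongSolution {d : ℕ} {p : ℝ≥0∞} [Fact (1 ≤ p)] (T : ℝ) (u₀ : LpField d p)
    (u : ℝ → LpField d p) : Prop where
  continuousOn : ContinuousOn u (Ioo 0 T)
  bounded : ∀ t ∈ Ioo 0 T, ∃ M : ℝ, ∀ s ∈ Ioc 0 t, ‖u s‖ ≤ M
  initial : p ≠ ⊤ → Tendsto u (𝓝[>] 0) (𝓝 u₀)
  divFree : ∀ t ∈ Ioo 0 T, IsDivFree (u t)
  /-- Duhamel's formula `u(t) = e^{tΔ} u₀ - ∫₀ᵗ e^{(t-s)Δ} ℙ ∇·(u ⊗ u)(s) ds`, with a convergent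
  (Bochner) integral in `L^p`. -/
  duhamel : ∀ t ∈ Ioo 0 T, ∃ w : ℝ → LpField d p,
    (∀ s ∈ Ioo 0 t, w s =ᵐ[volume] oseenFlow (t - s) (u s)) ∧
    IntervalIntegrable w volume 0 t ∧
    (u t =ᵐ[volume] fun x => heatFlow t u₀ x - (∫ s in (0 : ℝ)..t, w s : LpField d p) x)

end

/-! The solution is the fixed point of `u(t) = e^{tΔ}u₀ - B(u)(t)`, where `B` is the Duhamel
integral, and the decay estimate compares `u(t)` with the heat flow. Both terms are small compared
with `‖u₀‖`, for separate reasons.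

The nonlinear term is small because the time is short. The map `v ↦ e^{τΔ}ℙ∇·(v ⊗ v)` is quadratic
on `L^p` with constant `κ τ^{-a}`, where `a = 1/2 + d/(2p)`, and `a < 1` because `p > d`. An
abstract Volterra equation with such a kernel (`SingularQuadratic`) has a solution on `(0,T)` by
contraction in the ball of radius `2‖u₀‖`, as soon as `4κ‖u₀‖T^{1-a}/(1-a) ≤ θ < 1`
(`exists_solution`). The same inequality bounds `B(u)(t)` by `θ‖u₀‖`, and `T` is chosen so that `θ =
γ/4`. Uniqueness (`unique`) requires no smallness: it marches in time with a step that depends only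
on a bound for the two solutions.

The linear term is small because the data are sparse. Split `e^{tΔ} = e^{tΔ}Δ_{<J} + e^{tΔ}(1 -
Δ_{<J})`. The heat semigroup contracts `L^p`, so the first piece is at most `(γ/2)‖u₀‖`. For the
second, let `k` be the kernel of `Δ_{<J}`; since `∫ k = χ(0) = 1`, the convolution kernel is `∫
k(y)(G_t(x) - G_t(x - y)) dy`, whose `L^1` norm is at most `C t^{-1/2} ∫ |y||k(y)| dy = O(t^{-1/2}
2^{-J})`. The assumption on `J` makes this at most `γ/4` (`eLpNorm_heatFlow_le_of_sparse`,
`frequencyConst_spec`), and `γ/2 + γ/4 + γ/4 = γ`.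

The kernel estimates avoid the singularity of the Leray projection at `ξ = 0`. The derivative `-∂_s`
of the symbol of `e^{sΔ}ℙ∇·` carries a factor `4π²|ξ|²` that cancels the denominator, so it is a
rescaled Schwartz function; integrating over `s > τ` writes the Oseen kernel as a superposition of
dilates of one Schwartz profile. Its `L^1` and `L^∞` norms, and its modulus of continuity in time,
can be read off (`exists_oseenKernel_bounds`). A Young inequality in which the `L^{p'}` norm of the
kernel is interpolated between `L^1` and `L^∞` gives the order `a`. -/

noncomputable section

/-! ### Quadratic Volterra equations with a singular kernel -/

section Volterra

variable {E : Type*} [NormedAddCommGroup E]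

/-- A family `Q r`, `r > 0`, of maps of quadratic growth, singular like `r ^ (-a)` at `r = 0`. -/
structure SingularQuadratic (Q : ℝ → E → E) (κ a : ℝ) : Prop where
  nonneg : 0 ≤ κ
  lt_one : a < 1
  zero : ∀ r, 0 < r → Q r 0 = 0
  lipschitz : ∀ r, 0 < r → ∀ v w,
    ‖Q r v - Q r w‖ ≤ κ * r ^ (-a) * ((‖v‖ + ‖w‖) * ‖v - w‖)
  continuousOn : ∀ v, ContinuousOn (fun r => Q r v) (Ioi 0)

/-- The integral term of the Volterra equation. -/
def volterraTerm [NormedSpace ℝ E] (Q : ℝ → E → E) (u : ℝ → E) (t : ℝ) : E := ∫ s in (0 : ℝ)..t, Q (t - s) (u s)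

namespace SingularQuadratic

variable {Q : ℝ → E → E} {κ a : ℝ}

theorem norm_le (hQ : SingularQuadratic Q κ a) {r : ℝ} (hr : 0 < r) (v : E) :
    ‖Q r v‖ ≤ κ * r ^ (-a) * ‖v‖ ^ 2 := by
  have := hQ.lipschitz r hr v 0
  simpa [hQ.zero r hr, sq] using this

/-- Separate continuity in `r` upgrades to joint continuity because the Lipschitz constant in `v` is
bounded locally in `(r, v)`. This supplies the measurability of every Duhamel integrand. -/
theorem continuousOn_prod (hQ : SingularQuadratic Q κ a) :
    ContinuousOn (fun z : ℝ × E => Q z.1 z.2) (Ioi 0 ×ˢ univ) := by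
  rintro ⟨r, v⟩ ⟨hr, -⟩
  have hr : 0 < r := hr
  apply ContinuousAt.continuousWithinAt
  have hc : ContinuousAt (fun r => Q r v) r := (hQ.continuousOn v).continuousAt (Ioi_mem_nhds hr)
  rw [ContinuousAt, tendsto_iff_norm_sub_tendsto_zero]
  have h1 : Tendsto (fun z : ℝ × E => κ * z.1 ^ (-a) * ((‖z.2‖ + ‖v‖) * ‖z.2 - v‖)
      + ‖Q z.1 v - Q r v‖) (𝓝 (r, v)) (𝓝 0) := by
    have : ContinuousAt (fun z : ℝ × E => κ * z.1 ^ (-a) * ((‖z.2‖ + ‖v‖) * ‖z.2 - v‖)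
      + ‖Q z.1 v - Q r v‖) (r, v) := by
      refine ContinuousAt.add (ContinuousAt.mul (ContinuousAt.mul continuousAt_const ?_) (by fun_prop)) ?_
      · exact ContinuousAt.rpow_const continuousAt_fst (Or.inl hr.ne')
      · refine ContinuousAt.norm (ContinuousAt.sub ?_ continuousAt_const)
        exact ContinuousAt.comp (f := Prod.fst) (x := (r, v)) (g := fun r => Q r v) hc continuousAt_fst
    simpa [ContinuousAt] using this
  refine squeeze_zero' (Eventually.of_forall fun _ => norm_nonneg _) ?_ h1
  have : ∀ᶠ z : ℝ × E in 𝓝 (r, v), 0 < z.1 :=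
    continuousAt_fst.eventually (Ioi_mem_nhds hr)
  filter_upwards [this] with z hz
  calc ‖Q z.1 z.2 - Q r v‖ ≤ ‖Q z.1 z.2 - Q z.1 v‖ + ‖Q z.1 v - Q r v‖ := norm_sub_le_norm_sub_add_norm_sub _ _ _
    _ ≤ _ := by gcongr; exact hQ.lipschitz _ hz _ _

theorem continuousOn_comp (hQ : SingularQuadratic Q κ a) {u : ℝ → E} {T t : ℝ}
    (hu : ContinuousOn u (Ioo 0 T)) (ht : t ≤ T) :
    ContinuousOn (fun s => Q (t - s) (u s)) (Ioo 0 t) := by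
  refine hQ.continuousOn_prod.comp (f := fun s => (t - s, u s)) (s := Ioo 0 t) ?_ ?_
  · exact (by fun_prop : ContinuousOn (fun s => t - s) _).prodMk
      (hu.mono (Ioo_subset_Ioo_right ht))
  · intro s hs
    exact ⟨sub_pos.2 hs.2, mem_univ _⟩

theorem intervalIntegrable_rpow_sub (ha : a < 1) (t : ℝ) :
    IntervalIntegrable (fun s => (t - s) ^ (-a)) volume 0 t := by
  have := (intervalIntegral.intervalIntegrable_rpow' (a := 0) (b := t) (r := -a)
    (by linarith)).comp_sub_left t
  simpa using this.symm

theorem integral_rpow_sub (ha : a < 1) {t : ℝ} :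
    ∫ s in (0 : ℝ)..t, (t - s) ^ (-a) = t ^ (1 - a) / (1 - a) := by
  rw [intervalIntegral.integral_comp_sub_left (fun r => r ^ (-a)) t]
  simp only [sub_self, sub_zero]
  rw [integral_rpow (Or.inl (by linarith))]
  rw [show -a + 1 = 1 - a by ring, Real.zero_rpow (by linarith), sub_zero]

theorem intervalIntegrable_of_bound {ha : a < 1} {t c : ℝ} (ht : 0 ≤ t) {f : ℝ → E}
    (hf : ContinuousOn f (Ioo 0 t)) (hb : ∀ s ∈ Ioo 0 t, ‖f s‖ ≤ c * (t - s) ^ (-a)) :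
    IntervalIntegrable f volume 0 t := by
  rw [intervalIntegrable_iff_integrableOn_Ioo_of_le ht]
  have h := (intervalIntegrable_rpow_sub ha t).const_mul c
  rw [intervalIntegrable_iff_integrableOn_Ioo_of_le ht] at h
  exact h.mono' (hf.aestronglyMeasurable measurableSet_Ioo)
    ((ae_restrict_iff' measurableSet_Ioo).2 (Eventually.of_forall hb))

theorem intervalIntegrable (hQ : SingularQuadratic Q κ a) {u : ℝ → E} {T t M : ℝ}
    (hu : ContinuousOn u (Ioo 0 T)) (ht0 : 0 ≤ t) (ht : t ≤ T) (hM : ∀ s ∈ Ioo 0 t, ‖u s‖ ≤ M) :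
    IntervalIntegrable (fun s => Q (t - s) (u s)) volume 0 t := by
  refine intervalIntegrable_of_bound (ha := hQ.lt_one) (c := κ * M ^ 2) ht0
    (hQ.continuousOn_comp hu ht) fun s hs => ?_
  have hs' : 0 < t - s := sub_pos.2 hs.2
  have := hQ.nonneg
  calc _ ≤ _ := hQ.norm_le hs' _
    _ ≤ κ * (t - s) ^ (-a) * M ^ 2 := by gcongr; exact hM s hs
    _ = _ := by ring

variable [NormedSpace ℝ E]

theorem norm_integral_le_of_bound (ha : a < 1) {t c : ℝ} (ht : 0 ≤ t) {f : ℝ → E}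
    (hb : ∀ s ∈ Ioo 0 t, ‖f s‖ ≤ c * (t - s) ^ (-a)) :
    ‖∫ s in (0 : ℝ)..t, f s‖ ≤ c * (t ^ (1 - a) / (1 - a)) := by
  rw [← integral_rpow_sub ha, ← intervalIntegral.integral_const_mul]
  refine intervalIntegral.norm_integral_le_of_norm_le ht ?_ ((intervalIntegrable_rpow_sub ha t).const_mul c)
  have : ∀ᵐ s : ℝ, s ≠ t := by simp [ae_iff, measure_singleton]
  filter_upwards [this] with s hs h
  exact hb s ⟨h.1, lt_of_le_of_ne h.2 hs⟩

theorem norm_volterraTerm_le (hQ : SingularQuadratic Q κ a) {u : ℝ → E} {t M : ℝ}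
    (ht0 : 0 ≤ t) (hM : ∀ s ∈ Ioo 0 t, ‖u s‖ ≤ M) :
    ‖volterraTerm Q u t‖ ≤ κ * M ^ 2 * (t ^ (1 - a) / (1 - a)) := by
  refine norm_integral_le_of_bound hQ.lt_one ht0 fun s hs => ?_
  have hs' : 0 < t - s := sub_pos.2 hs.2
  have := hQ.nonneg
  calc _ ≤ _ := hQ.norm_le hs' _
    _ ≤ κ * (t - s) ^ (-a) * M ^ 2 := by gcongr; exact hM s hs
    _ = _ := by ring

theorem norm_volterraTerm_sub_le (hQ : SingularQuadratic Q κ a) {u v : ℝ → E} {T t M δ : ℝ}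
    (hu : ContinuousOn u (Ioo 0 T)) (hv : ContinuousOn v (Ioo 0 T)) (ht0 : 0 ≤ t) (ht : t ≤ T)
    (hMu : ∀ s ∈ Ioo 0 t, ‖u s‖ ≤ M) (hMv : ∀ s ∈ Ioo 0 t, ‖v s‖ ≤ M)
    (hδ : ∀ s ∈ Ioo 0 t, ‖u s - v s‖ ≤ δ) :
    ‖volterraTerm Q u t - volterraTerm Q v t‖ ≤ κ * (2 * M * δ) * (t ^ (1 - a) / (1 - a)) := by
  unfold volterraTerm
  rw [← intervalIntegral.integral_sub (hQ.intervalIntegrable hu ht0 ht hMu)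
    (hQ.intervalIntegrable hv ht0 ht hMv)]
  refine norm_integral_le_of_bound hQ.lt_one ht0 fun s hs => ?_
  have hs' : 0 < t - s := sub_pos.2 hs.2
  have := hQ.nonneg
  have hM0 : 0 ≤ M := (norm_nonneg _).trans (hMu s hs)
  calc _ ≤ _ := hQ.lipschitz _ hs' _ _
    _ ≤ κ * (t - s) ^ (-a) * ((M + M) * δ) := by
        gcongr
        exacts [hMu s hs, hMv s hs, hδ s hs]
    _ = _ := by ring

/-- In the variable `r = t - s` the singularity stays at `r = 0` as `t` varies, which makes
dominated convergence in `t` possible. -/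
theorem volterraTerm_eq (u : ℝ → E) {t : ℝ} (ht : 0 ≤ t) :
    volterraTerm Q u t = ∫ r, (Ioo 0 t).indicator (fun r => Q r (u (t - r))) r := by
  have := intervalIntegral.integral_comp_sub_left (a := 0) (b := t) (fun r => Q r (u (t - r))) t
  simp only [sub_sub_cancel, sub_self, sub_zero] at this
  rw [volterraTerm, this, intervalIntegral.integral_of_le ht, integral_Ioc_eq_integral_Ioo,
    integral_indicator measurableSet_Ioo]

/-- Dominated convergence with the majorant `κ M² r^{-a}`, integrable on `(0,T)` because `a < 1`. -/
theorem continuousOn_volterraTerm (hQ : SingularQuadratic Q κ a) {u : ℝ → E} {T M : ℝ}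
    (hu : ContinuousOn u (Ioo 0 T)) (hM : ∀ s ∈ Ioo 0 T, ‖u s‖ ≤ M) :
    ContinuousOn (volterraTerm Q u) (Ioo 0 T) := by
  intro t₀ ht₀
  apply ContinuousAt.continuousWithinAt
  have hmem : ∀ᶠ t in 𝓝 t₀, t ∈ Ioo 0 T := Ioo_mem_nhds ht₀.1 ht₀.2
  have key : ContinuousAt (fun t => ∫ r, (Ioo 0 t).indicator (fun r => Q r (u (t - r))) r) t₀ := by
    refine continuousAt_of_dominated
      (bound := (Ioo 0 T).indicator fun r => κ * M ^ 2 * r ^ (-a)) ?_ ?_ ?_ ?_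
    · filter_upwards [hmem] with t ht
      rw [aestronglyMeasurable_indicator_iff measurableSet_Ioo]
      refine ContinuousOn.aestronglyMeasurable ?_ measurableSet_Ioo
      refine hQ.continuousOn_prod.comp (f := fun r => (r, u (t - r))) (s := Ioo 0 t) ?_ ?_
      · refine continuousOn_id.prodMk (hu.comp (by fun_prop) ?_)
        intro r hr
        exact ⟨by linarith [hr.2], by linarith [hr.1, ht.2]⟩
      · intro r hr
        exact ⟨hr.1, mem_univ _⟩
    · filter_upwards [hmem] with t ht
      refine Eventually.of_forall fun r => ?_
      by_cases hr : r ∈ Ioo 0 t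
      · rw [indicator_of_mem hr, indicator_of_mem (Ioo_subset_Ioo_right ht.2.le hr)]
        have := hQ.nonneg
        have hr0 : 0 < r := hr.1
        calc _ ≤ _ := hQ.norm_le hr0 _
          _ ≤ κ * r ^ (-a) * M ^ 2 := by
            gcongr; exact hM _ ⟨by linarith [hr.2], by linarith [hr.1, ht.2]⟩
          _ = _ := by ring
      · rw [indicator_of_notMem hr, norm_zero]
        refine indicator_nonneg (fun r hr => ?_) _
        have := hQ.nonneg
        have hr0 : 0 < r := hr.1
        positivity
    · rw [integrable_indicator_iff measurableSet_Ioo,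
        ← intervalIntegrable_iff_integrableOn_Ioo_of_le (ht₀.1.trans ht₀.2).le]
      exact (intervalIntegral.intervalIntegrable_rpow' (by linarith [hQ.lt_one])).const_mul _
    -- Only at `r = t₀` can the indicator of `(0,t)` jump as `t → t₀`.
    · have : ∀ᵐ r : ℝ, r ≠ t₀ := by simp [ae_iff, measure_singleton]
      filter_upwards [this] with r hr
      by_cases hr0 : 0 < r
      swap
      · have : (fun t => (Ioo 0 t).indicator (fun r => Q r (u (t - r))) r) = fun _ => 0 := by
          ext t
          exact indicator_of_notMem (fun h => hr0 h.1) _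
        rw [this]
        exact continuousAt_const
      rcases lt_or_gt_of_ne hr with h | h
      · have h1 : ContinuousAt (fun t => Q r (u (t - r))) t₀ := by
          have h2 : ContinuousAt (fun z : ℝ × E => Q z.1 z.2) (r, u (t₀ - r)) :=
            hQ.continuousOn_prod.continuousAt (prod_mem_nhds (Ioi_mem_nhds hr0) univ_mem)
          refine ContinuousAt.comp (f := fun t => (r, u (t - r))) (x := t₀) h2 ?_
          refine continuousAt_const.prodMk ?_
          refine ContinuousAt.comp (f := fun t => t - r) (g := u) (x := t₀) ?_ (by fun_prop)
          exact hu.continuousAt (Ioo_mem_nhds (by linarith) (by linarith [ht₀.2]))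
        refine h1.congr ?_
        filter_upwards [Ioi_mem_nhds h] with t ht
        rw [indicator_of_mem (show r ∈ Ioo 0 t from ⟨hr0, ht⟩)]
      · refine continuousAt_const (y := (0 : E)) |>.congr ?_
        filter_upwards [Iio_mem_nhds h] with t ht
        rw [indicator_of_notMem (fun h' => lt_asymm h'.2 ht)]
  refine key.congr ?_
  filter_upwards [hmem] with t ht
  rw [volterraTerm_eq u ht.1.le]

/-- Uniqueness for the Volterra equation, in the class of functions bounded near the initial
time. -/
theorem unique (hQ : SingularQuadratic Q κ a) {u v h : ℝ → E} {T : ℝ}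
    (hu : ContinuousOn u (Ioo 0 T)) (hv : ContinuousOn v (Ioo 0 T))
    (hbu : ∀ t ∈ Ioo 0 T, ∃ M : ℝ, ∀ s ∈ Ioc 0 t, ‖u s‖ ≤ M)
    (hbv : ∀ t ∈ Ioo 0 T, ∃ M : ℝ, ∀ s ∈ Ioc 0 t, ‖v s‖ ≤ M)
    (heu : ∀ t ∈ Ioo 0 T, u t = h t - volterraTerm Q u t)
    (hev : ∀ t ∈ Ioo 0 T, v t = h t - volterraTerm Q v t) :
    ∀ t ∈ Ioo 0 T, u t = v t := by
  intro t₁ ht₁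
  obtain ⟨M₁, hM₁⟩ := hbu t₁ ht₁
  obtain ⟨M₂, hM₂⟩ := hbv t₁ ht₁
  obtain ⟨M, hM0, hMu, hMv⟩ : ∃ M : ℝ, 0 ≤ M ∧ (∀ s ∈ Ioc 0 t₁, ‖u s‖ ≤ M) ∧
      ∀ s ∈ Ioc 0 t₁, ‖v s‖ ≤ M :=
    ⟨max 0 (max M₁ M₂), le_max_left _ _, fun s hs => (hM₁ s hs).trans (by simp),
      fun s hs => (hM₂ s hs).trans (by simp)⟩
  have ha : 0 < 1 - a := by linarith [hQ.lt_one]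
  -- The step length `δ` depends only on `κ`, `a` and the common bound `M` on `(0,t₁]`, so finitely
  -- many steps reach `t₁`.
  obtain ⟨δ, hδ0, hδ⟩ : ∃ δ : ℝ, 0 < δ ∧ κ * (2 * M) * (δ ^ (1 - a) / (1 - a)) ≤ 1 / 2 := by
    have h1 : Tendsto (fun δ : ℝ => κ * (2 * M) * (δ ^ (1 - a) / (1 - a))) (𝓝[>] 0) (𝓝 0) := by
      have : ContinuousAt (fun δ : ℝ => κ * (2 * M) * (δ ^ (1 - a) / (1 - a))) 0 := by
        have := Real.continuousAt_rpow_const 0 (1 - a) (Or.inr ha.le)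
        fun_prop
      have h2 := this.tendsto.mono_left (nhdsWithin_le_nhds (s := Ioi 0))
      simpa [Real.zero_rpow ha.ne'] using h2
    have h2 := (h1.eventually (Iic_mem_nhds (show (0 : ℝ) < 1 / 2 by norm_num))).and
      self_mem_nhdsWithin
    obtain ⟨δ, h3, h4⟩ := h2.exists
    exact ⟨δ, h4, h3⟩
  have step : ∀ n : ℕ, ∀ t ∈ Ioc 0 t₁, t ≤ n * δ → u t = v t := by
    intro n
    induction n with
    | zero =>
      intro t ht h
      simp only [Nat.cast_zero, zero_mul] at h
      exact absurd ht.1 h.not_gt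
    | succ n ih =>
      -- Each use of the equation halves the bound on `u - v` up to time `(n+1)δ`, starting from the
      -- trivial bound `2M`.
      have main : ∀ k : ℕ, ∀ t ∈ Ioc 0 t₁, t ≤ (n + 1 : ℕ) * δ →
          ‖u t - v t‖ ≤ 2 * M * (1 / 2) ^ k := by
        intro k
        induction k with
        | zero =>
          intro t ht _
          have := norm_sub_le (u t) (v t)
          linarith [hMu t ht, hMv t ht]
        | succ k ihk =>
          intro t ht htn
          have htT : t ∈ Ioo 0 T := ⟨ht.1, ht.2.trans_lt ht₁.2⟩
          have hsub : ∀ s ∈ Ioo 0 t, s ∈ Ioc 0 t₁ := fun s hs => ⟨hs.1, hs.2.le.trans ht.2⟩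
          have e : u t - v t = -∫ s in (0 : ℝ)..t, (Q (t - s) (u s) - Q (t - s) (v s)) := by
            rw [heu t htT, hev t htT, intervalIntegral.integral_sub
              (hQ.intervalIntegrable hu ht.1.le htT.2.le fun s hs => hMu s (hsub s hs))
              (hQ.intervalIntegrable hv ht.1.le htT.2.le fun s hs => hMv s (hsub s hs))]
            simp only [volterraTerm]
            abel
          set m : ℝ := min t δ with hm
          have hm0 : 0 < m := lt_min ht.1 hδ0
          -- For `r > δ` the time `t - r` is at most `nδ`, where `u = v` by the outer induction;
          -- only the lags `r ≤ δ` contribute.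
          have e2 : ∫ s in (0 : ℝ)..t, (Q (t - s) (u s) - Q (t - s) (v s))
              = ∫ r in (0 : ℝ)..m, (Q r (u (t - r)) - Q r (v (t - r))) := by
            have h1 := intervalIntegral.integral_comp_sub_left (a := 0) (b := t)
              (fun r => Q r (u (t - r)) - Q r (v (t - r))) t
            simp only [sub_sub_cancel, sub_self, sub_zero] at h1
            rw [h1, intervalIntegral.integral_of_le ht.1.le, intervalIntegral.integral_of_le hm0.le,
              integral_Ioc_eq_integral_Ioo]
            rw [← integral_indicator measurableSet_Ioo, ← integral_indicator measurableSet_Ioc]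
            have hne : ∀ᵐ r : ℝ, r ≠ t := by simp [ae_iff, measure_singleton]
            refine integral_congr_ae ?_
            filter_upwards [hne] with r hr
            by_cases h2 : r ∈ Ioc 0 m
            · rw [indicator_of_mem h2, indicator_of_mem (show r ∈ Ioo 0 t from
                ⟨h2.1, lt_of_le_of_ne (h2.2.trans (min_le_left _ _)) hr⟩)]
            · rw [indicator_of_notMem h2]
              by_cases h3 : r ∈ Ioo 0 t
              · rw [indicator_of_mem h3, ih (t - r) ⟨by linarith [h3.2], by linarith [h3.1, ht.2]⟩ ?_,
                  sub_self]
                have : δ < r := by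
                  by_contra h4
                  exact h2 ⟨h3.1, le_min h3.2.le (not_lt.1 h4)⟩
                push_cast at htn
                linarith
              · rw [indicator_of_notMem h3]
          rw [e, norm_neg, e2]
          have hm1 : m ≤ δ := min_le_right _ _
          have hb : ‖∫ r in (0 : ℝ)..m, (Q r (u (t - r)) - Q r (v (t - r)))‖
              ≤ ∫ r in (0 : ℝ)..m, κ * (2 * M * (2 * M * (1 / 2) ^ k)) * r ^ (-a) := by
            refine intervalIntegral.norm_integral_le_of_norm_le hm0.le ?_
              ((intervalIntegral.intervalIntegrable_rpow' (by linarith)).const_mul _)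
            have hne : ∀ᵐ r : ℝ, r ≠ t := by simp [ae_iff, measure_singleton]
            filter_upwards [hne] with r hr h
            have hrt : r < t := lt_of_le_of_ne (h.2.trans (min_le_left _ _)) hr
            have h1 : t - r ∈ Ioc 0 t₁ := ⟨by linarith, by linarith [h.1, ht.2]⟩
            have hr0 : 0 < r := h.1
            have := hQ.nonneg
            calc _ ≤ _ := hQ.lipschitz _ h.1 _ _
              _ ≤ κ * r ^ (-a) * ((M + M) * (2 * M * (1 / 2) ^ k)) := by
                gcongr
                exacts [hMu _ h1, hMv _ h1, ihk _ h1 (by linarith)]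
              _ = _ := by ring
          refine hb.trans ?_
          rw [intervalIntegral.integral_const_mul, integral_rpow (Or.inl (by linarith)),
            show -a + 1 = 1 - a by ring, Real.zero_rpow ha.ne', sub_zero]
          have hκ := hQ.nonneg
          calc _ ≤ κ * (2 * M * (2 * M * (1 / 2) ^ k)) * (δ ^ (1 - a) / (1 - a)) := by gcongr
            _ = (κ * (2 * M) * (δ ^ (1 - a) / (1 - a))) * (2 * M * (1 / 2) ^ k) := by ring
            _ ≤ 1 / 2 * (2 * M * (1 / 2) ^ k) := by gcongr
            _ = _ := by ring
      intro t ht htn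
      have hlim : Tendsto (fun k : ℕ => 2 * M * (1 / 2 : ℝ) ^ k) atTop (𝓝 (2 * M * 0)) :=
        (tendsto_pow_atTop_nhds_zero_of_lt_one (by norm_num) (by norm_num)).const_mul _
      rw [mul_zero] at hlim
      have := ge_of_tendsto' hlim fun k => main k t ht htn
      exact sub_eq_zero.1 (norm_le_zero_iff.1 this)
  obtain ⟨n, hn⟩ := exists_nat_ge (t₁ / δ)
  exact step n t₁ ⟨ht₁.1, le_rfl⟩ ((div_le_iff₀ hδ0).1 hn)

/-- Existence of a solution of the Volterra equation on a short time interval. -/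
theorem exists_solution [CompleteSpace E] (hQ : SingularQuadratic Q κ a) {h : ℝ → E} {T H : ℝ}
    (hT : 0 < T) (hh : ContinuousOn h (Ioo 0 T)) (hH : ∀ t ∈ Ioo 0 T, ‖h t‖ ≤ H)
    {θ : ℝ} (hθ : 4 * κ * H * (T ^ (1 - a) / (1 - a)) ≤ θ) (hθ1 : θ < 1) :
    ∃ u : ℝ → E, ContinuousOn u (Ioo 0 T) ∧ (∀ t ∈ Ioo 0 T, ‖u t‖ ≤ 2 * H) ∧
      (∀ t ∈ Ioo 0 T, u t = h t - volterraTerm Q u t) ∧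
      ∀ t ∈ Ioo 0 T, ‖volterraTerm Q u t‖ ≤ θ * H := by
  classical
  have ha : 0 < 1 - a := by linarith [hQ.lt_one]
  have hκ := hQ.nonneg
  have hH0 : 0 ≤ H := (norm_nonneg _).trans (hH (T / 2) ⟨by linarith, by linarith⟩)
  have hθ0 : 0 ≤ θ := le_trans (by positivity) hθ
  have hmono : ∀ t ∈ Ioo 0 T, t ^ (1 - a) / (1 - a) ≤ T ^ (1 - a) / (1 - a) := by
    intro t ht
    have := ht.1.le
    have := ht.2.le
    gcongr
  -- The open interval asks for no limit at `t = 0`, which the heat flow of `L^∞` data need not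
  -- have. Functions are extended by zero outside it to fit the Duhamel integral.
  let X := BoundedContinuousFunction (Ioo (0 : ℝ) T) E
  let ext : X → ℝ → E := fun f t => if ht : t ∈ Ioo 0 T then f ⟨t, ht⟩ else 0
  have ext_apply : ∀ (f : X) (t) (ht : t ∈ Ioo 0 T), ext f t = f ⟨t, ht⟩ := fun f t ht => dif_pos ht
  have ext_cont : ∀ f : X, ContinuousOn (ext f) (Ioo 0 T) := by
    intro f
    rw [continuousOn_iff_continuous_domRestrict]
    convert f.continuous using 1
    ext t
    exact ext_apply f t t.2
  have ext_norm : ∀ f : X, ∀ t ∈ Ioo 0 T, ‖ext f t‖ ≤ ‖f‖ := by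
    intro f t ht
    rw [ext_apply f t ht]
    exact f.norm_coe_le_norm _
  have Dcont : ∀ f : X, ContinuousOn (volterraTerm Q (ext f)) (Ioo 0 T) := fun f =>
    hQ.continuousOn_volterraTerm (ext_cont f) (ext_norm f)
  have Dnorm : ∀ f : X, ∀ t ∈ Ioo 0 T,
      ‖volterraTerm Q (ext f) t‖ ≤ κ * ‖f‖ ^ 2 * (T ^ (1 - a) / (1 - a)) := by
    intro f t ht
    refine (hQ.norm_volterraTerm_le ht.1.le fun s hs =>
      ext_norm f s ⟨hs.1, hs.2.trans ht.2⟩).trans ?_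
    have := hmono t ht
    gcongr κ * ‖f‖ ^ 2 * ?_
  let Φ : X → X := fun f => BoundedContinuousFunction.ofNormedAddCommGroup
    (fun t : Ioo (0 : ℝ) T => h t - volterraTerm Q (ext f) t)
    (continuousOn_iff_continuous_domRestrict.1 (hh.sub (Dcont f)))
    (H + κ * ‖f‖ ^ 2 * (T ^ (1 - a) / (1 - a)))
    (fun t => (norm_sub_le _ _).trans (add_le_add (hH t t.2) (Dnorm f t t.2)))
  have Φ_apply : ∀ f t, Φ f t = h t - volterraTerm Q (ext f) t := fun _ _ => rfl
  have small : ∀ f : X, ‖f‖ ≤ 2 * H → κ * ‖f‖ ^ 2 * (T ^ (1 - a) / (1 - a)) ≤ θ * H := by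
    intro f hf
    calc _ ≤ κ * (2 * H) ^ 2 * (T ^ (1 - a) / (1 - a)) := by gcongr
      _ = (4 * κ * H * (T ^ (1 - a) / (1 - a))) * H := by ring
      _ ≤ _ := by gcongr
  -- On this ball the Duhamel term is at most `θH ≤ H`, so the ball is mapped to itself; the
  -- Lipschitz constant `κ · 2 · 2H · T^{1-a}/(1-a)` is the same quantity bounded by `θ`.
  let s : Set X := Metric.closedBall 0 (2 * H)
  have hs : ∀ f : X, f ∈ s ↔ ‖f‖ ≤ 2 * H := fun f => by simp [s]
  have hmaps : MapsTo Φ s s := by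
    intro f hf
    rw [hs] at hf ⊢
    rw [BoundedContinuousFunction.norm_le (by positivity)]
    intro t
    rw [Φ_apply]
    refine (norm_sub_le _ _).trans ?_
    have h1 := hH t t.2
    have h2 := Dnorm f t t.2
    have h3 := small f hf
    nlinarith
  have hcontr : ContractingWith ⟨θ, hθ0⟩ (hmaps.restrict Φ s s) := by
    refine ⟨by exact_mod_cast hθ1, LipschitzWith.of_dist_le_mul ?_⟩
    rintro ⟨f, hf⟩ ⟨g, hg⟩
    rw [hs] at hf hg
    change dist (Φ f) (Φ g) ≤ θ * dist f g
    rw [BoundedContinuousFunction.dist_le (by positivity)]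
    intro t
    rw [Φ_apply, Φ_apply, dist_eq_norm, sub_sub_sub_cancel_left]
    have hsub : ∀ r ∈ Ioo (0 : ℝ) t, r ∈ Ioo (0 : ℝ) T := fun r hr => ⟨hr.1, hr.2.trans t.2.2⟩
    have h1 := hQ.norm_volterraTerm_sub_le (ext_cont g) (ext_cont f) t.2.1.le t.2.2.le
      (M := 2 * H) (δ := dist f g)
      (fun r hr => (ext_norm g r (hsub r hr)).trans hg)
      (fun r hr => (ext_norm f r (hsub r hr)).trans hf)
      (fun r hr => by
        rw [ext_apply g r (hsub r hr), ext_apply f r (hsub r hr), ← dist_eq_norm, dist_comm]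
        exact BoundedContinuousFunction.dist_coe_le_dist _)
    refine h1.trans ?_
    calc _ ≤ κ * (2 * (2 * H) * dist f g) * (T ^ (1 - a) / (1 - a)) := by
          have := hmono t t.2
          gcongr κ * (2 * (2 * H) * dist f g) * ?_
      _ = (4 * κ * H * (T ^ (1 - a) / (1 - a))) * dist f g := by ring
      _ ≤ _ := by gcongr
  obtain ⟨f, hfs, hfix, -⟩ := hcontr.exists_fixedPoint' (Metric.isClosed_closedBall.isComplete) hmaps
    (x := 0) (by rw [hs]; simpa using hH0) (edist_ne_top _ _)
  rw [hs] at hfs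
  refine ⟨ext f, ext_cont f, fun t ht => (ext_norm f t ht).trans hfs, fun t ht => ?_, fun t ht =>
    (Dnorm f t ht).trans (small f hfs)⟩
  rw [ext_apply f t ht]
  conv_lhs => rw [← hfix.eq]
  rw [Φ_apply]

end SingularQuadratic

end Volterra

/-! ### Convolution with integrable, bounded, continuous kernels -/

section Young

variable {d : ℕ}

theorem aemeasurable_conv {κ g : RSpace d → ℝ≥0∞} (hκ : Measurable κ) (hg : AEMeasurable g) :
    AEMeasurable fun x => ∫⁻ y, κ (x - y) * g y :=
  AEMeasurable.lintegral_prod_right' (f := fun z : RSpace d × RSpace d => κ (z.1 - z.2) * g z.2)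
    ((hκ.comp (measurable_fst.sub measurable_snd)).aemeasurable.mul hg.comp_snd)

theorem lintegral_conv {κ g : RSpace d → ℝ≥0∞} (hκ : Measurable κ) (hg : AEMeasurable g) :
    ∫⁻ x, ∫⁻ y, κ (x - y) * g y = (∫⁻ x, κ x) * ∫⁻ y, g y := by
  rw [lintegral_lintegral_swap]
  · have (y : RSpace d) : ∫⁻ x, κ (x - y) * g y = (∫⁻ x, κ x) * g y := by
      have h : Measurable fun x => κ (x - y) := hκ.comp (measurable_id.sub measurable_const)
      rw [lintegral_mul_const _ h, lintegral_sub_right_eq_self κ y]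
    simp_rw [this]
    rw [lintegral_const_mul'' _ hg]
  · exact (hκ.comp (measurable_fst.sub measurable_snd)).aemeasurable.mul hg.comp_snd

/-- Hölder applied to `κ g = (κ g^q)^{1/q} κ^{1-1/q}`, followed by Tonelli. -/
theorem lintegral_rpow_conv_le {q : ℝ} (hq : 1 ≤ q) {κ g : RSpace d → ℝ≥0∞} (hκ : Measurable κ)
    (hg : AEMeasurable g) :
    (∫⁻ x, (∫⁻ y, κ (x - y) * g y) ^ q) ^ (1 / q)
      ≤ (∫⁻ x, κ x) * (∫⁻ x, g x ^ q) ^ (1 / q) := by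
  have hq0 : 0 < q := by linarith
  set A := ∫⁻ x, κ x with hA
  have hqi : 0 ≤ 1 / q := by positivity
  have hqi1 : 0 ≤ 1 - 1 / q := by rw [sub_nonneg, div_le_one hq0]; exact hq
  have htrans : ∀ x, ∫⁻ y, κ (x - y) = A := fun x => lintegral_sub_left_eq_self κ x
  have hκx : ∀ x, Measurable fun y => κ (x - y) := fun x => hκ.comp (measurable_const.sub measurable_id)
  have pt : ∀ x, (∫⁻ y, κ (x - y) * g y) ^ q ≤ (∫⁻ y, κ (x - y) * g y ^ q) * A ^ (q - 1) := by
    intro x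
    have h1 : ∀ y, κ (x - y) * g y = (κ (x - y) * g y ^ q) ^ (1 / q) * κ (x - y) ^ (1 - 1 / q) := by
      intro y
      rw [ENNReal.mul_rpow_of_nonneg _ _ hqi, ← ENNReal.rpow_mul, mul_one_div_cancel hq0.ne',
        ENNReal.rpow_one, mul_right_comm, ← ENNReal.rpow_add_of_nonneg _ _ hqi hqi1]
      simp
    have h2 : ∫⁻ y, κ (x - y) * g y ≤ (∫⁻ y, κ (x - y) * g y ^ q) ^ (1 / q) * A ^ (1 - 1 / q) := by
      simp_rw [h1]
      rw [← htrans x]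
      exact ENNReal.lintegral_mul_norm_pow_le ((hκx x).aemeasurable.mul (hg.pow_const q))
        (hκx x).aemeasurable hqi hqi1 (by ring)
    calc _ ≤ ((∫⁻ y, κ (x - y) * g y ^ q) ^ (1 / q) * A ^ (1 - 1 / q)) ^ q := by gcongr
      _ = _ := by
        rw [ENNReal.mul_rpow_of_nonneg _ _ hq0.le, ← ENNReal.rpow_mul, ← ENNReal.rpow_mul,
          one_div_mul_cancel hq0.ne', ENNReal.rpow_one]
        congr 2
        field_simp
  calc _ ≤ (∫⁻ x, (∫⁻ y, κ (x - y) * g y ^ q) * A ^ (q - 1)) ^ (1 / q) := by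
        gcongr with x
        exact pt x
    _ ≤ ((A * ∫⁻ y, g y ^ q) * A ^ (q - 1)) ^ (1 / q) := by
        gcongr
        rw [lintegral_mul_const'' _ (aemeasurable_conv hκ (hg.pow_const q)),
          lintegral_conv hκ (hg.pow_const q)]
    _ = (A ^ (1 : ℝ) * A ^ (q - 1)) ^ (1 / q) * (∫⁻ x, g x ^ q) ^ (1 / q) := by
      rw [mul_right_comm, ENNReal.mul_rpow_of_nonneg _ _ hqi, ENNReal.rpow_one]
    _ = _ := by
      rw [← ENNReal.rpow_add_of_nonneg _ _ zero_le_one (by linarith), ← ENNReal.rpow_mul,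
        show (1 + (q - 1)) * (1 / q) = 1 by field_simp; ring, ENNReal.rpow_one]

/-- Three-factor Hölder with the kernel distributed asymmetrically: `g₁^q` keeps the weight `κ` and
is integrated in `x` by Tonelli, while `g₂^q` carries no weight and gives a factor independent of
`x`. -/
theorem lintegral_rpow_conv_mul_le {q : ℝ} (hq : 2 ≤ q) {κ g₁ g₂ : RSpace d → ℝ≥0∞}
    (hκ : Measurable κ) (h₁ : AEMeasurable g₁) (h₂ : AEMeasurable g₂) {D : ℝ≥0∞} (hDt : D ≠ ⊤)
    (hD : ∀ x, κ x ≤ D) :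
    (∫⁻ x, (∫⁻ y, κ (x - y) * (g₁ y * g₂ y)) ^ q) ^ (1 / q)
      ≤ D ^ (1 / q) * (∫⁻ x, κ x) ^ (1 - 1 / q) * (∫⁻ x, g₁ x ^ q) ^ (1 / q)
        * (∫⁻ x, g₂ x ^ q) ^ (1 / q) := by
  have hq0 : 0 < q := by linarith
  set A := ∫⁻ x, κ x with hA
  have hqi : 0 ≤ 1 / q := by positivity
  have hqi2 : 0 ≤ 1 - 2 / q := by rw [sub_nonneg, div_le_one hq0]; exact hq
  have hqi1 : 0 ≤ 1 - 1 / q := by rw [sub_nonneg, div_le_one hq0]; linarith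
  have htrans : ∀ x, ∫⁻ y, κ (x - y) = A := fun x => lintegral_sub_left_eq_self κ x
  have hκx : ∀ x, Measurable fun y => κ (x - y) := fun x => hκ.comp (measurable_const.sub measurable_id)
  have pt : ∀ x, (∫⁻ y, κ (x - y) * (g₁ y * g₂ y)) ^ q
      ≤ (∫⁻ y, κ (x - y) * g₁ y ^ q) * (D * A ^ (q - 2) * ∫⁻ y, g₂ y ^ q) := by
    intro x
    -- Of the three powers `1/q`, `1/q`, `1 - 2/q` of `κ`, the first is traded for the supremum `D`;
    -- the Hölder exponents `1/q`, `1 - 2/q`, `1/q` sum to one.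
    have h1 : ∀ y, κ (x - y) * (g₁ y * g₂ y) ≤ D ^ (1 / q) *
        ∏ i ∈ (Finset.univ : Finset (Fin 3)),
          (![fun y => κ (x - y) * g₁ y ^ q, fun y => κ (x - y), fun y => g₂ y ^ q] i y)
            ^ (![1 / q, 1 - 2 / q, 1 / q] i) := by
      intro y
      simp only [Fin.prod_univ_three, Matrix.cons_val_zero, Matrix.cons_val_one, Matrix.cons_val]
      rw [ENNReal.mul_rpow_of_nonneg _ _ hqi, ← ENNReal.rpow_mul, ← ENNReal.rpow_mul,
        mul_one_div_cancel hq0.ne', ENNReal.rpow_one, ENNReal.rpow_one]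
      calc κ (x - y) * (g₁ y * g₂ y)
          = (κ (x - y) ^ (1 / q) * κ (x - y) ^ (1 / q) * κ (x - y) ^ (1 - 2 / q)) * (g₁ y * g₂ y) := by
            rw [← ENNReal.rpow_add_of_nonneg _ _ hqi hqi,
              ← ENNReal.rpow_add_of_nonneg _ _ (by positivity) hqi2,
              show 1 / q + 1 / q + (1 - 2 / q) = 1 by ring, ENNReal.rpow_one]
        _ ≤ (D ^ (1 / q) * κ (x - y) ^ (1 / q) * κ (x - y) ^ (1 - 2 / q)) * (g₁ y * g₂ y) := by
            gcongr
            exact hD _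
        _ = _ := by ring
    have h2 : ∫⁻ y, κ (x - y) * (g₁ y * g₂ y) ≤ D ^ (1 / q) *
        ((∫⁻ y, κ (x - y) * g₁ y ^ q) ^ (1 / q) * A ^ (1 - 2 / q) * (∫⁻ y, g₂ y ^ q) ^ (1 / q)) := by
      refine (lintegral_mono h1).trans ?_
      rw [lintegral_const_mul' _ _ (ENNReal.rpow_ne_top_of_nonneg hqi hDt)]
      gcongr
      refine (ENNReal.lintegral_prod_norm_pow_le Finset.univ ?_ ?_ ?_).trans ?_
      · intro i _
        fin_cases i
        · exact (hκx x).aemeasurable.mul (h₁.pow_const q)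
        · exact (hκx x).aemeasurable
        · exact h₂.pow_const q
      · simp [Fin.sum_univ_three]; ring
      · intro i _
        fin_cases i
        exacts [hqi, hqi2, hqi]
      · simp [Fin.prod_univ_three, htrans]
    calc _ ≤ (D ^ (1 / q) * ((∫⁻ y, κ (x - y) * g₁ y ^ q) ^ (1 / q) * A ^ (1 - 2 / q)
          * (∫⁻ y, g₂ y ^ q) ^ (1 / q))) ^ q := by gcongr
      _ = _ := by
        simp only [ENNReal.mul_rpow_of_nonneg _ _ hq0.le, ← ENNReal.rpow_mul,
          one_div_mul_cancel hq0.ne', ENNReal.rpow_one]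
        rw [show (1 - 2 / q) * q = q - 2 by field_simp]
        ring
  calc _ ≤ (∫⁻ x, (∫⁻ y, κ (x - y) * g₁ y ^ q) * (D * A ^ (q - 2) * ∫⁻ y, g₂ y ^ q)) ^ (1 / q) := by
        gcongr with x
        exact pt x
    _ = ((A ^ (1 : ℝ) * A ^ (q - 2)) * D * (∫⁻ y, g₁ y ^ q) * ∫⁻ y, g₂ y ^ q) ^ (1 / q) := by
        rw [lintegral_mul_const'' _ (aemeasurable_conv hκ (h₁.pow_const q)),
          lintegral_conv hκ (h₁.pow_const q), ENNReal.rpow_one]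
        congr 1
        ring
    _ = _ := by
        rw [← ENNReal.rpow_add_of_nonneg _ _ zero_le_one (by linarith)]
        simp only [ENNReal.mul_rpow_of_nonneg _ _ hqi, ← ENNReal.rpow_mul]
        rw [show (1 + (q - 2)) * (1 / q) = 1 - 1 / q by field_simp; ring]
        ring

end Young

/-- Kernels against which every `L^p` function can be convolved, with an everywhere defined
result. -/
structure IsConvKernel {d : ℕ} (k : RSpace d → ℝ) : Prop where
  continuous : Continuous k
  integrable : Integrable k
  bounded : ∃ D : ℝ, ∀ x, ‖k x‖ ≤ D

section Conv

variable {d : ℕ} {E : Type*} [NormedAddCommGroup E]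

/-- `f` is dominated by the sum of a constant and an integrable function. -/
def IsTame (f : RSpace d → E) : Prop :=
  AEStronglyMeasurable f ∧ ∃ (M : ℝ) (F : RSpace d → ℝ), Integrable F ∧ ∀ᵐ y, ‖f y‖ ≤ M + F y

/-- For finite `p` the inequality `|f| ≤ 1 + |f|^p` suffices; for `p = ∞` the constant alone does.
Tameness lets Fubini arguments treat all exponents at once. -/
theorem MeasureTheory.MemLp.isTame {p : ℝ≥0∞} (hp : 1 ≤ p) {f : RSpace d → E} (hf : MemLp f p) :
    IsTame f := by
  refine ⟨hf.1, ?_⟩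
  by_cases hpt : p = ⊤
  · subst hpt
    refine ⟨(eLpNorm f ⊤ volume).toReal, 0, integrable_zero _ _ _, ?_⟩
    filter_upwards [ae_le_eLpNormEssSup (f := f) (μ := (volume : Measure (RSpace d)))] with y hy
    rw [eLpNorm_exponent_top, Pi.zero_apply, add_zero, ← toReal_enorm]
    refine ENNReal.toReal_mono ?_ hy
    rw [← eLpNorm_exponent_top]
    exact hf.2.ne
  · refine ⟨1, fun y => ‖f y‖ ^ p.toReal, hf.integrable_norm_rpow (by positivity) hpt,
      Eventually.of_forall fun y => ?_⟩
    have h1 : 1 ≤ p.toReal := by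
      rw [← ENNReal.toReal_one]
      exact ENNReal.toReal_mono hpt hp
    rcases le_total ‖f y‖ 1 with h | h
    · have : 0 ≤ ‖f y‖ ^ p.toReal := by positivity
      linarith
    · have := Real.rpow_le_rpow_of_exponent_le h h1
      rw [Real.rpow_one] at this
      linarith

theorem MeasureTheory.MemLp.isTame_norm_sq {p : ℝ≥0∞} (hp : 2 ≤ p) {v : RSpace d → E}
    (hv : MemLp v p) : IsTame fun y => ‖v y‖ ^ 2 := by
  have h1 : MemLp (fun y => ‖v y‖ ^ 2) (p / 2) := by
    have := hv.norm_rpow_div 2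
    simpa using this
  refine h1.isTame ?_
  rw [ENNReal.le_div_iff_mul_le (by simp) (by simp)]
  simpa using hp

/-- By `ab ≤ a² + b²` this reduces to squares, which lie in `L^{p/2}` with `p/2 ≥ 1`. -/
theorem IsTame.mul {p : ℝ≥0∞} (hp : 2 ≤ p) {E₁ E₂ : Type*} [NormedAddCommGroup E₁]
    [NormedAddCommGroup E₂] {f : RSpace d → E} {v : RSpace d → E₁} {w : RSpace d → E₂}
    (hf : AEStronglyMeasurable f) (hv : MemLp v p) (hw : MemLp w p)
    (h : ∀ᵐ y, ‖f y‖ ≤ ‖v y‖ * ‖w y‖) : IsTame f := by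
  obtain ⟨-, M₁, F₁, hF₁, h₁⟩ := hv.isTame_norm_sq hp
  obtain ⟨-, M₂, F₂, hF₂, h₂⟩ := hw.isTame_norm_sq hp
  refine ⟨hf, M₁ + M₂, F₁ + F₂, hF₁.add hF₂, ?_⟩
  filter_upwards [h, h₁, h₂] with y hy hy₁ hy₂
  simp only [norm_pow, norm_norm, Pi.add_apply] at *
  nlinarith [sq_nonneg (‖v y‖ - ‖w y‖), sq_nonneg (‖v y‖), sq_nonneg (‖w y‖)]

namespace IsConvKernel

variable {k : RSpace d → ℝ}

theorem sub {k' : RSpace d → ℝ} (hk : IsConvKernel k) (hk' : IsConvKernel k') :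
    IsConvKernel (fun x => k x - k' x) := by
  obtain ⟨D, hD⟩ := hk.bounded
  obtain ⟨D', hD'⟩ := hk'.bounded
  exact ⟨hk.continuous.sub hk'.continuous, hk.integrable.sub hk'.integrable, D + D',
    fun x => (norm_sub_le _ _).trans (add_le_add (hD x) (hD' x))⟩

/-- The constant part of the majorant is paired with the `L^1` norm of the kernel and the integrable
part with its supremum, so the bound is uniform in `x`. -/
theorem exists_bound (hk : IsConvKernel k) {f : RSpace d → E} (hf : IsTame f) :
    ∃ B : ℝ, ∀ x, Integrable (fun y => ‖k (x - y)‖ * ‖f y‖) ∧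
      ∫ y, ‖k (x - y)‖ * ‖f y‖ ≤ B := by
  obtain ⟨hm, M, F, hF, hb⟩ := hf
  obtain ⟨D, hD⟩ := hk.bounded
  have hD0 : 0 ≤ D := (norm_nonneg _).trans (hD 0)
  refine ⟨(∫ y, ‖k y‖ * |M|) + ∫ y, D * |F y|, fun x => ?_⟩
  have h1 : Integrable fun y => ‖k (x - y)‖ * |M| :=
    ((hk.integrable.comp_sub_left x).norm).mul_const _
  have h2 : Integrable fun y => D * |F y| := hF.abs.const_mul _
  have h3 : ∀ᵐ y, ‖k (x - y)‖ * ‖f y‖ ≤ ‖k (x - y)‖ * |M| + D * |F y| := by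
    filter_upwards [hb] with y hy
    calc _ ≤ ‖k (x - y)‖ * (|M| + |F y|) := by
          gcongr
          exact hy.trans (add_le_add (le_abs_self _) (le_abs_self _))
      _ ≤ _ := by
        rw [mul_add]
        gcongr
        exact hD _
  have h4 : Integrable (fun y => ‖k (x - y)‖ * ‖f y‖) := by
    refine (h1.add h2).mono' ?_ ?_
    · exact (hk.continuous.comp (by fun_prop : Continuous fun y => x - y)).norm.aestronglyMeasurable.mul
        hm.norm
    · filter_upwards [h3] with y hy
      rwa [Real.norm_of_nonneg (by positivity)]
  refine ⟨h4, ?_⟩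
  calc _ ≤ ∫ y, (‖k (x - y)‖ * |M| + D * |F y|) := integral_mono_ae h4 (h1.add h2) h3
    _ = _ := by
      rw [integral_add h1 h2, integral_sub_left_eq_self (fun y => ‖k y‖ * |M|) volume x]

variable [NormedSpace ℝ E]

theorem integrable_smul (hk : IsConvKernel k) {f : RSpace d → E} (hf : IsTame f) (x : RSpace d) :
    Integrable fun y => k (x - y) • f y := by
  obtain ⟨B, hB⟩ := hk.exists_bound hf
  refine (hB x).1.mono' ?_ (Eventually.of_forall fun y => (norm_smul _ _).le)
  exact (hk.continuous.comp (by fun_prop : Continuous fun y => x - y)).aestronglyMeasurable.smul hf.1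

theorem aestronglyMeasurable_prod (hk : IsConvKernel k) {f : RSpace d → E}
    (hf : AEStronglyMeasurable f) :
    AEStronglyMeasurable (fun z : RSpace d × RSpace d => k (z.1 - z.2) • f z.2) :=
  (hk.continuous.comp (continuous_fst.sub continuous_snd)).aestronglyMeasurable.smul hf.comp_snd

theorem aestronglyMeasurable (hk : IsConvKernel k) {f : RSpace d → E}
    (hf : AEStronglyMeasurable f) : AEStronglyMeasurable fun x => ∫ y, k (x - y) • f y :=
  (hk.aestronglyMeasurable_prod hf).integral_prod_right'

theorem enorm_conv_le (x : RSpace d) (f : RSpace d → E) :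
    ‖∫ y, k (x - y) • f y‖ₑ ≤ ∫⁻ y, ‖k (x - y)‖ₑ * ‖f y‖ₑ := by
  refine (enorm_integral_le_lintegral_enorm _).trans (le_of_eq ?_)
  simp_rw [enorm_smul]

theorem lintegral_enorm (hk : IsConvKernel k) :
    ∫⁻ x, ‖k x‖ₑ = ENNReal.ofReal (∫ x, ‖k x‖) :=
  (ofReal_integral_norm_eq_lintegral_enorm hk.integrable).symm

/-- Young's inequality `L^1 * L^p ⊆ L^p`. -/
theorem eLpNorm_conv_le (hk : IsConvKernel k) {p : ℝ≥0∞} (hp : 1 ≤ p) {f : RSpace d → E}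
    (hf : AEStronglyMeasurable f) :
    eLpNorm (fun x => ∫ y, k (x - y) • f y) p volume
      ≤ ENNReal.ofReal (∫ x, ‖k x‖) * eLpNorm f p volume := by
  rw [← hk.lintegral_enorm]
  have hκ : Measurable fun x => ‖k x‖ₑ := hk.continuous.measurable.enorm
  have hκx (x : RSpace d) : Measurable fun y => ‖k (x - y)‖ₑ :=
    hκ.comp (measurable_const.sub measurable_id)
  by_cases hpt : p = ⊤
  · subst hpt
    simp only [eLpNorm_exponent_top]
    refine eLpNormEssSup_le_of_ae_enorm_bound (Eventually.of_forall fun x => ?_)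
    refine (enorm_conv_le x f).trans ?_
    have h1 : ∀ᵐ y, ‖k (x - y)‖ₑ * ‖f y‖ₑ ≤ ‖k (x - y)‖ₑ * eLpNormEssSup f volume := by
      filter_upwards [ae_le_eLpNormEssSup (f := f) (μ := (volume : Measure (RSpace d)))] with y hy
      gcongr
    refine (lintegral_mono_ae h1).trans ?_
    rw [lintegral_mul_const _ (hκx x),
      lintegral_sub_left_eq_self (fun y => ‖k y‖ₑ) x]
  · have h1 : 1 ≤ p.toReal := by
      rw [← ENNReal.toReal_one]
      exact ENNReal.toReal_mono hpt hp
    rw [eLpNorm_eq_lintegral_rpow_enorm_toReal (by positivity) hpt,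
      eLpNorm_eq_lintegral_rpow_enorm_toReal (by positivity) hpt]
    refine le_trans ?_ (lintegral_rpow_conv_le h1 hκ hf.enorm)
    gcongr with x
    exact enorm_conv_le x f

/-- Young's inequality `L^{p'} * L^{p/2} ⊆ L^p`, with the norm in `L^{p'}` of the kernel
interpolated between `L^1` and `L^∞`. -/
theorem eLpNorm_conv_mul_le (hk : IsConvKernel k) {p : ℝ≥0∞} (hp : 2 ≤ p) {f : RSpace d → E}
    {E₁ E₂ : Type*} [NormedAddCommGroup E₁] [NormedAddCommGroup E₂]
    {v : RSpace d → E₁} {w : RSpace d → E₂}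
    (hv : AEStronglyMeasurable v) (hw : AEStronglyMeasurable w)
    (h : ∀ᵐ y, ‖f y‖ ≤ ‖v y‖ * ‖w y‖) {A D : ℝ} (hA : ∫ x, ‖k x‖ ≤ A) (hD : ∀ x, ‖k x‖ ≤ D) :
    eLpNorm (fun x => ∫ y, k (x - y) • f y) p volume
      ≤ ENNReal.ofReal (A ^ (1 - p.toReal⁻¹) * D ^ p.toReal⁻¹) * eLpNorm v p volume
        * eLpNorm w p volume := by
  have hκ : Measurable fun x => ‖k x‖ₑ := hk.continuous.measurable.enorm
  have hκx (x : RSpace d) : Measurable fun y => ‖k (x - y)‖ₑ :=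
    hκ.comp (measurable_const.sub measurable_id)
  have hA0 : 0 ≤ A := (integral_nonneg fun _ => norm_nonneg _).trans hA
  have hD0 : 0 ≤ D := (norm_nonneg _).trans (hD 0)
  have hA' : ∫⁻ x, ‖k x‖ₑ ≤ ENNReal.ofReal A := by
    rw [hk.lintegral_enorm]
    exact ENNReal.ofReal_le_ofReal hA
  have hb : ∀ x, ‖∫ y, k (x - y) • f y‖ₑ ≤ ∫⁻ y, ‖k (x - y)‖ₑ * (‖v y‖ₑ * ‖w y‖ₑ) := by
    intro x
    refine (enorm_conv_le x f).trans (lintegral_mono_ae ?_)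
    filter_upwards [h] with y hy
    gcongr
    rw [← ofReal_norm, ← ofReal_norm, ← ofReal_norm, ← ENNReal.ofReal_mul (norm_nonneg _)]
    exact ENNReal.ofReal_le_ofReal hy
  by_cases hpt : p = ⊤
  · subst hpt
    simp only [eLpNorm_exponent_top, ENNReal.toReal_top, inv_zero, sub_zero, Real.rpow_one,
      Real.rpow_zero, mul_one]
    refine eLpNormEssSup_le_of_ae_enorm_bound (Eventually.of_forall fun x => ?_)
    refine (hb x).trans ?_
    have h1 : ∀ᵐ y, ‖k (x - y)‖ₑ * (‖v y‖ₑ * ‖w y‖ₑ)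
        ≤ ‖k (x - y)‖ₑ * (eLpNormEssSup v volume * eLpNormEssSup w volume) := by
      filter_upwards [ae_le_eLpNormEssSup (f := v) (μ := (volume : Measure (RSpace d))),
        ae_le_eLpNormEssSup (f := w) (μ := (volume : Measure (RSpace d)))] with y hy hy'
      gcongr
    refine (lintegral_mono_ae h1).trans ?_
    rw [lintegral_mul_const _ (hκx x),
      lintegral_sub_left_eq_self (fun y => ‖k y‖ₑ) x, mul_assoc]
    gcongr
  · have h1 : 2 ≤ p.toReal := by
      rw [← ENNReal.toReal_ofNat]
      exact ENNReal.toReal_mono hpt hp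
    have h2 : p.toReal⁻¹ ≤ 1 := inv_le_one_of_one_le₀ (by linarith)
    have h0 : p ≠ 0 := by
      rintro rfl
      simp at hp
    rw [eLpNorm_eq_lintegral_rpow_enorm_toReal h0 hpt,
      eLpNorm_eq_lintegral_rpow_enorm_toReal h0 hpt,
      eLpNorm_eq_lintegral_rpow_enorm_toReal h0 hpt]
    have hDk : ∀ x, ‖k x‖ₑ ≤ ENNReal.ofReal D := fun x => by
      rw [← ofReal_norm]
      exact ENNReal.ofReal_le_ofReal (hD x)
    refine le_trans (by gcongr with x; exact hb x)
      ((lintegral_rpow_conv_mul_le h1 hκ hv.enorm hw.enorm ENNReal.ofReal_ne_top hDk).trans ?_)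
    simp only [one_div]
    gcongr
    rw [ENNReal.ofReal_mul (by positivity), mul_comm,
      ENNReal.ofReal_rpow_of_nonneg hD0 (by positivity),
      ← ENNReal.ofReal_rpow_of_nonneg hA0 (by linarith)]
    gcongr

theorem memLp_conv (hk : IsConvKernel k) {p : ℝ≥0∞} (hp : 1 ≤ p) {f : RSpace d → E}
    (hf : MemLp f p) : MemLp (fun x => ∫ y, k (x - y) • f y) p :=
  ⟨hk.aestronglyMeasurable hf.1, (hk.eLpNorm_conv_le hp hf.1).trans_lt
    (ENNReal.mul_lt_top ENNReal.ofReal_lt_top hf.2)⟩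

/-- Exchanging the order of integration in a convolution tested against an integrable function. -/
theorem integrable_prod (hk : IsConvKernel k) {f ψ : RSpace d → ℝ} (hf : IsTame f)
    (hψ : Integrable ψ) :
    Integrable (fun z : RSpace d × RSpace d => ψ z.1 * (k (z.1 - z.2) * f z.2)) := by
  have hm : AEStronglyMeasurable (fun z : RSpace d × RSpace d => ψ z.1 * (k (z.1 - z.2) * f z.2)) :=
    hψ.1.comp_fst.mul (hk.aestronglyMeasurable_prod hf.1)
  obtain ⟨B, hB⟩ := hk.exists_bound hf
  refine (integrable_prod_iff hm).2 ⟨Eventually.of_forall fun x => ?_, ?_⟩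
  · exact (hk.integrable_smul hf x).const_mul (ψ x)
  · refine (hψ.norm.mul_const B).mono' hm.norm.integral_prod_right' (Eventually.of_forall fun x => ?_)
    rw [Real.norm_of_nonneg (integral_nonneg fun _ => norm_nonneg _)]
    simp only [norm_mul]
    rw [integral_const_mul]
    gcongr
    exact (hB x).2

theorem integral_mul_conv (hk : IsConvKernel k) {f ψ : RSpace d → ℝ} (hf : IsTame f)
    (hψ : Integrable ψ) :
    Integrable (fun x => ψ x * ∫ y, k (x - y) * f y) ∧
    Integrable (fun y => f y * ∫ x, k (x - y) * ψ x) ∧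
    ∫ x, ψ x * ∫ y, k (x - y) * f y = ∫ y, f y * ∫ x, k (x - y) * ψ x := by
  have hint := hk.integrable_prod hf hψ
  have h1 (x : RSpace d) : ψ x * ∫ y, k (x - y) * f y = ∫ y, ψ x * (k (x - y) * f y) :=
    (integral_const_mul _ _).symm
  have h2 (y : RSpace d) : f y * ∫ x, k (x - y) * ψ x = ∫ x, ψ x * (k (x - y) * f y) := by
    rw [← integral_const_mul]
    congr with x
    ring
  simp_rw [h1, h2]
  exact ⟨hint.integral_prod_left, hint.integral_prod_right, integral_integral_swap hint⟩

/-- Fubini after the change of variables `x = y + z`: the convolution becomes an average over `z` of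
pairings with translated test functions, suited to translation-invariant conditions on `f`. -/
theorem integral_mul_conv' (hk : IsConvKernel k) {f ψ : RSpace d → ℝ} (hf : IsTame f)
    (hψ : Integrable ψ) :
    Integrable (fun z => k z * ∫ y, f y * ψ (y + z)) ∧
    ∫ x, ψ x * ∫ y, k (x - y) * f y = ∫ z, k z * ∫ y, f y * ψ (y + z) := by
  have hm : AEStronglyMeasurable
      (fun z : RSpace d × RSpace d => ψ z.1 * (k z.2 * f (z.1 - z.2))) :=
    hψ.1.comp_fst.mul (hk.continuous.aestronglyMeasurable.comp_snd.mul
      (hf.1.comp_quasiMeasurePreserving (quasiMeasurePreserving_sub volume volume)))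
  obtain ⟨B, hB⟩ := hk.exists_bound hf
  have hint : Integrable (fun z : RSpace d × RSpace d => ψ z.1 * (k z.2 * f (z.1 - z.2)))
      (volume.prod volume) := by
    refine (integrable_prod_iff hm).2 ⟨Eventually.of_forall fun x => ?_, ?_⟩
    · have := ((hk.integrable_smul hf x).comp_sub_left x).const_mul (ψ x)
      simpa using this
    · refine (hψ.norm.mul_const B).mono' hm.norm.integral_prod_right'
        (Eventually.of_forall fun x => ?_)
      rw [Real.norm_of_nonneg (integral_nonneg fun _ => norm_nonneg _)]
      simp only [norm_mul]
      rw [integral_const_mul]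
      gcongr
      have := integral_sub_left_eq_self (fun y => ‖k (x - y)‖ * ‖f y‖) volume x
      simp only [sub_sub_cancel] at this
      rw [this]
      exact (hB x).2
  have h1 (x : RSpace d) : ψ x * ∫ y, k (x - y) * f y = ∫ z, ψ x * (k z * f (x - z)) := by
    rw [integral_const_mul]
    have := integral_sub_left_eq_self (fun y => k (x - y) * f y) volume x
    simp only [sub_sub_cancel] at this
    rw [this]
  have h2 (z : RSpace d) : k z * ∫ y, f y * ψ (y + z) = ∫ x, ψ x * (k z * f (x - z)) := by
    rw [← integral_const_mul,
      ← integral_add_right_eq_self (fun x => ψ x * (k z * f (x - z))) z]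
    congr with y
    simp only [add_sub_cancel_right]
    ring
  simp_rw [h1, h2]
  exact ⟨hint.integral_prod_right, integral_integral_swap hint⟩

end IsConvKernel

end Conv

/-! ### The Gauss kernel -/

section Gauss

variable {d : ℕ}

theorem gaussKernel_nonneg {t : ℝ} (ht : 0 < t) (x : RSpace d) : 0 ≤ gaussKernel t x := by
  unfold gaussKernel
  positivity

theorem gaussKernel_eq {t : ℝ} (x : RSpace d) :
    gaussKernel t x = (4 * Real.pi * t) ^ (-(d : ℝ) / 2) * Real.exp (-(1 / (4 * t)) * ‖x‖ ^ 2) := by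
  unfold gaussKernel
  congr 2
  ring

theorem integrable_exp_neg_mul_norm_sq {b : ℝ} (hb : 0 < b) :
    Integrable fun x : RSpace d => Real.exp (-b * ‖x‖ ^ 2) := by
  refine .of_integral_ne_zero ?_
  rw [GaussianFourier.integral_rexp_neg_mul_sq_norm hb]
  positivity

theorem integral_gaussKernel {t : ℝ} (ht : 0 < t) : ∫ x : RSpace d, gaussKernel t x = 1 := by
  simp_rw [gaussKernel_eq]
  rw [integral_const_mul, GaussianFourier.integral_rexp_neg_mul_sq_norm (by positivity),
    finrank_euclideanSpace_fin, show Real.pi / (1 / (4 * t)) = 4 * Real.pi * t by field_simp,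
    ← Real.rpow_add (by positivity)]
  rw [show -(d : ℝ) / 2 + d / 2 = 0 by ring, Real.rpow_zero]

theorem isConvKernel_gaussKernel {t : ℝ} (ht : 0 < t) :
    IsConvKernel (gaussKernel t : RSpace d → ℝ) := by
  refine ⟨?_, ?_, (4 * Real.pi * t) ^ (-(d : ℝ) / 2), fun x => ?_⟩
  · unfold gaussKernel
    fun_prop
  · have := (integrable_exp_neg_mul_norm_sq (d := d) (b := 1 / (4 * t)) (by positivity)).const_mul
      ((4 * Real.pi * t) ^ (-(d : ℝ) / 2))
    exact this.congr (Eventually.of_forall fun x => (gaussKernel_eq x).symm)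
  · rw [Real.norm_of_nonneg (gaussKernel_nonneg ht x)]
    unfold gaussKernel
    refine mul_le_of_le_one_right (by positivity) (Real.exp_le_one_iff.2 ?_)
    rw [neg_div]
    exact neg_nonpos.2 (by positivity)

theorem integral_norm_gaussKernel {t : ℝ} (ht : 0 < t) :
    ∫ x : RSpace d, ‖gaussKernel t x‖ = 1 := by
  simp_rw [Real.norm_of_nonneg (gaussKernel_nonneg ht _)]
  exact integral_gaussKernel ht

/-- Continuity of the Gauss kernel in `L^1`. -/
theorem tendsto_integral_norm_gaussKernel_sub {t₀ : ℝ} (ht₀ : 0 < t₀) :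
    Tendsto (fun t => ∫ x : RSpace d, ‖gaussKernel t x - gaussKernel t₀ x‖) (𝓝 t₀) (𝓝 0) := by
  have hmem : ∀ᶠ t in 𝓝 t₀, t ∈ Ioo (t₀ / 2) (2 * t₀) := Ioo_mem_nhds (by linarith) (by linarith)
  -- A majorant for all `t` in `(t₀/2, 2t₀)`: the prefactor is largest at the left end, the Gaussian
  -- widest at the right end.
  set c := (4 * Real.pi * (t₀ / 2)) ^ (-(d : ℝ) / 2)
  have hb : ∀ t ∈ Ioo (t₀ / 2) (2 * t₀), ∀ x : RSpace d,
      gaussKernel t x ≤ c * Real.exp (-(1 / (8 * t₀)) * ‖x‖ ^ 2) := by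
    intro t ht x
    have h0 : 0 < t := by linarith [ht.1]
    rw [gaussKernel_eq]
    gcongr ?_ * Real.exp (-(?_) * _)
    · exact Real.rpow_le_rpow_of_nonpos (by positivity) (by nlinarith [ht.1, Real.pi_pos])
        (by rw [neg_div]; exact neg_nonpos.2 (by positivity))
    · gcongr 1 / ?_
      linarith [ht.2]
  have hI := (integrable_exp_neg_mul_norm_sq (d := d) (b := 1 / (8 * t₀)) (by positivity)).const_mul c
  have key : Tendsto (fun t => ∫ x : RSpace d, ‖gaussKernel t x - gaussKernel t₀ x‖) (𝓝 t₀)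
      (𝓝 (∫ _ : RSpace d, (0 : ℝ))) := by
    refine tendsto_integral_filter_of_dominated_convergence
      (fun x => c * Real.exp (-(1 / (8 * t₀)) * ‖x‖ ^ 2) + c * Real.exp (-(1 / (8 * t₀)) * ‖x‖ ^ 2))
      ?_ ?_ (hI.add hI) ?_
    · filter_upwards [hmem] with t ht
      have h0 : 0 < t := by linarith [ht.1]
      exact ((isConvKernel_gaussKernel h0).sub
        (isConvKernel_gaussKernel ht₀)).continuous.norm.aestronglyMeasurable
    · filter_upwards [hmem] with t ht
      have h0 : 0 < t := by linarith [ht.1]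
      refine Eventually.of_forall fun x => ?_
      rw [norm_norm]
      refine (norm_sub_le _ _).trans ?_
      rw [Real.norm_of_nonneg (gaussKernel_nonneg h0 x), Real.norm_of_nonneg (gaussKernel_nonneg ht₀ x)]
      exact add_le_add (hb t ht x) (hb t₀ ⟨by linarith, by linarith⟩ x)
    · refine Eventually.of_forall fun x => ?_
      have h1 : ContinuousAt (fun t => gaussKernel t x) t₀ := by
        unfold gaussKernel
        refine ContinuousAt.mul (ContinuousAt.rpow_const (by fun_prop) (Or.inl (by positivity))) ?_
        refine ContinuousAt.rexp (ContinuousAt.div (by fun_prop) (by fun_prop) (by positivity))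
      have h2 := (h1.sub (continuousAt_const (y := gaussKernel t₀ x))).norm.tendsto
      simpa using h2
  simpa using key

/-- The line derivative of the Gauss kernel is controlled by a wider Gauss kernel. -/
theorem hasDerivAt_gaussKernel_line {t : ℝ} (ht : 0 < t) (x y : RSpace d) (θ : ℝ) :
    ∃ D : ℝ, HasDerivAt (fun θ : ℝ => gaussKernel t (x - θ • y)) D θ ∧
      ‖D‖ ≤ ‖y‖ * (t ^ (-(1 / 2) : ℝ) * 2 ^ ((d : ℝ) / 2)) * gaussKernel (2 * t) (x - θ • y) := by
  set z := x - θ • y with hz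
  have h1 : HasDerivAt (fun θ : ℝ => x - θ • y) (-y) θ := by
    have := ((hasDerivAt_id θ).smul_const y).const_sub x
    simpa using this
  have h2 : HasDerivAt (fun θ : ℝ => -‖x - θ • y‖ ^ 2 / (4 * t)) (-(2 * inner ℝ z (-y)) / (4 * t)) θ :=
    (h1.norm_sq.neg).div_const _
  refine ⟨_, (h2.exp.const_mul ((4 * Real.pi * t) ^ (-(d : ℝ) / 2))), ?_⟩
  have hcoef : (4 * Real.pi * t) ^ (-(d : ℝ) / 2)
      = 2 ^ ((d : ℝ) / 2) * (4 * Real.pi * (2 * t)) ^ (-(d : ℝ) / 2) := by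
    rw [show 4 * Real.pi * (2 * t) = 2 * (4 * Real.pi * t) by ring,
      Real.mul_rpow (x := 2) (by norm_num) (by positivity), ← mul_assoc,
      ← Real.rpow_add (by norm_num)]
    rw [show (d : ℝ) / 2 + -(d : ℝ) / 2 = 0 by ring, Real.rpow_zero, one_mul]
  have hin : |inner ℝ z y| ≤ ‖z‖ * ‖y‖ := abs_real_inner_le_norm z y
  have hst : 0 < √t := Real.sqrt_pos.2 ht
  have hsq : √t * √t = t := Real.mul_self_sqrt ht.le
  have hrt : t ^ (-(1 / 2) : ℝ) = (√t)⁻¹ := by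
    rw [Real.rpow_neg ht.le, Real.sqrt_eq_rpow]
  set w := ‖z‖ / (2 * √t) with hw
  have hzw : ‖z‖ = w * (2 * √t) := by rw [hw]; field_simp
  -- With `w = |z|/(2√t)` this reads `w e^{-w²} ≤ e^{-w²/2}`, which follows from `w ≤ 1 + w²/2 ≤
  -- e^{w²/2}`.
  have hexp : w * Real.exp (-‖z‖ ^ 2 / (4 * t)) ≤ Real.exp (-‖z‖ ^ 2 / (4 * (2 * t))) := by
    have e1 : -‖z‖ ^ 2 / (4 * (2 * t)) = w ^ 2 / 2 + -‖z‖ ^ 2 / (4 * t) := by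
      rw [hw, div_pow, mul_pow, Real.sq_sqrt ht.le]
      field_simp
      ring
    rw [e1, Real.exp_add]
    gcongr
    nlinarith [Real.add_one_le_exp (w ^ 2 / 2), sq_nonneg (w - 1)]
  rw [norm_mul, norm_mul, Real.norm_of_nonneg (by positivity), Real.norm_of_nonneg (Real.exp_nonneg _)]
  rw [inner_neg_right, Real.norm_eq_abs, abs_div, abs_neg, abs_mul, abs_neg, abs_two,
    abs_of_pos (show 0 < 4 * t by positivity), hrt]
  unfold gaussKernel
  rw [hcoef]
  calc _ ≤ 2 ^ ((d : ℝ) / 2) * (4 * Real.pi * (2 * t)) ^ (-(d : ℝ) / 2)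
        * (Real.exp (-‖z‖ ^ 2 / (4 * t)) * (2 * (‖z‖ * ‖y‖) / (4 * t))) := by gcongr
    _ = ‖y‖ * ((√t)⁻¹ * 2 ^ ((d : ℝ) / 2)) * ((4 * Real.pi * (2 * t)) ^ (-(d : ℝ) / 2)
        * (w * Real.exp (-‖z‖ ^ 2 / (4 * t)))) := by
      rw [hzw]
      have : (√t)⁻¹ = √t / t := by field_simp; nlinarith
      rw [this]
      field_simp
      ring
    _ ≤ _ := by gcongr

/-- Integrate the line derivative along the segment from `x` to `x - y` and exchange integrals: each
slice costs the mass of a translated `G_{2t}`, which is one. -/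
theorem integral_norm_gaussKernel_sub_translate_le {t : ℝ} (ht : 0 < t) (y : RSpace d) :
    ∫ x, ‖gaussKernel t x - gaussKernel t (x - y)‖
      ≤ ‖y‖ * (t ^ (-(1 / 2) : ℝ) * 2 ^ ((d : ℝ) / 2)) := by
  set c := ‖y‖ * (t ^ (-(1 / 2) : ℝ) * 2 ^ ((d : ℝ) / 2)) with hc
  have hc0 : 0 ≤ c := by positivity
  have h2 : 0 < 2 * t := by positivity
  choose D hD hDn using fun x θ => hasDerivAt_gaussKernel_line ht x y θ
  have hcont : Continuous (gaussKernel (2 * t) : RSpace d → ℝ) := (isConvKernel_gaussKernel h2).continuous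
  have pt : ∀ x, ‖gaussKernel t x - gaussKernel t (x - y)‖ₑ
      ≤ ∫⁻ θ in Ioc (0 : ℝ) 1, ENNReal.ofReal (c * gaussKernel (2 * t) (x - θ • y)) := by
    intro x
    have hcx : Continuous fun θ : ℝ => c * gaussKernel (2 * t) (x - θ • y) :=
      continuous_const.mul (hcont.comp (by fun_prop))
    have hii : IntervalIntegrable (fun θ : ℝ => c * gaussKernel (2 * t) (x - θ • y)) volume 0 1 :=
      hcx.intervalIntegrable 0 1
    have h := norm_sub_le_integral_of_norm_deriv_le_of_le (f := fun θ : ℝ => gaussKernel t (x - θ • y))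
      (B := fun θ => c * gaussKernel (2 * t) (x - θ • y)) zero_le_one
      (fun θ _ => (hD x θ).continuousAt.continuousWithinAt)
      (fun θ _ => (hD x θ).differentiableAt.differentiableWithinAt)
      (Eventually.of_forall fun θ _ => by rw [(hD x θ).deriv]; exact hDn x θ) hii
    simp only [one_smul, zero_smul, sub_zero] at h
    rw [norm_sub_rev, intervalIntegral.integral_of_le zero_le_one] at h
    rw [← ofReal_norm]
    refine (ENNReal.ofReal_le_ofReal h).trans (le_of_eq ?_)
    rw [ofReal_integral_eq_lintegral_ofReal hii.1]
    exact Eventually.of_forall fun θ => mul_nonneg hc0 (gaussKernel_nonneg h2 _)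
  have hk : IsConvKernel (gaussKernel (2 * t) : RSpace d → ℝ) := isConvKernel_gaussKernel h2
  have hInt : Integrable fun x => gaussKernel t x - gaussKernel t (x - y) :=
    (isConvKernel_gaussKernel ht).integrable.sub ((isConvKernel_gaussKernel ht).integrable.comp_sub_right y)
  have hslice : ∀ θ : ℝ, ∫⁻ x : RSpace d, ENNReal.ofReal (c * gaussKernel (2 * t) (x - θ • y))
      = ENNReal.ofReal c := by
    intro θ
    rw [lintegral_sub_right_eq_self (fun x => ENNReal.ofReal (c * gaussKernel (2 * t) x)),
      ← ofReal_integral_eq_lintegral_ofReal (hk.integrable.const_mul c)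
        (Eventually.of_forall fun x => mul_nonneg hc0 (gaussKernel_nonneg h2 _)),
      integral_const_mul, integral_gaussKernel h2, mul_one]
  refine (ENNReal.ofReal_le_ofReal_iff hc0).1 ?_
  rw [ofReal_integral_norm_eq_lintegral_enorm hInt]
  refine (lintegral_mono pt).trans ?_
  rw [lintegral_lintegral_swap]
  · simp_rw [hslice]
    simp
  · refine Measurable.aemeasurable ?_
    refine Measurable.ennreal_ofReal ?_
    refine Continuous.measurable ?_
    exact continuous_const.mul (hcont.comp
      (by fun_prop : Continuous fun z : RSpace d × ℝ => z.1 - z.2 • y))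

/-! ### The heat semigroup -/

/-- Parabolic scaling fixes the Gaussian and moves `t` into the other factor, where dominated
convergence as `t → 0` is direct. -/
theorem integral_gaussKernel_mul_eq {t : ℝ} (ht : 0 < t) (osc : RSpace d → ℝ) :
    ∫ z, gaussKernel t z * osc z = ∫ z, gaussKernel 1 z * osc (√t • z) := by
  have hst : 0 < √t := Real.sqrt_pos.2 ht
  have h1 := Measure.integral_comp_smul_of_nonneg (volume : Measure (RSpace d))
    (fun z => gaussKernel t z * osc z) √t (hR := hst.le)
  have h2 : ∀ z : RSpace d, gaussKernel t (√t • z) = ((√t) ^ d)⁻¹ * gaussKernel 1 z := by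
    intro z
    unfold gaussKernel
    rw [norm_smul, Real.norm_of_nonneg hst.le, mul_pow, Real.sq_sqrt ht.le, mul_one,
      Real.mul_rpow (by positivity) ht.le, Real.sqrt_eq_rpow, ← Real.rpow_mul_natCast ht.le,
      ← Real.rpow_neg ht.le]
    rw [show -(t * ‖z‖ ^ 2) / (4 * t) = -‖z‖ ^ 2 / (4 * 1) by field_simp,
      show -(1 / 2 * (d : ℝ)) = -(d : ℝ) / 2 by ring]
    ring
  simp only [h2, finrank_euclideanSpace_fin, smul_eq_mul] at h1
  simp_rw [mul_assoc] at h1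
  rw [integral_const_mul] at h1
  exact (mul_left_cancel₀ (by positivity) h1).symm

theorem tendsto_integral_gaussKernel_mul {osc : RSpace d → ℝ} (hc : Continuous osc) (h0 : osc 0 = 0)
    {B : ℝ} (hB : ∀ z, ‖osc z‖ ≤ B) :
    Tendsto (fun t => ∫ z, gaussKernel t z * osc z) (𝓝[>] 0) (𝓝 0) := by
  have hk : IsConvKernel (gaussKernel 1 : RSpace d → ℝ) := isConvKernel_gaussKernel one_pos
  have key : Tendsto (fun t : ℝ => ∫ z : RSpace d, gaussKernel 1 z * osc (√t • z)) (𝓝[>] 0)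
      (𝓝 (∫ _ : RSpace d, (0 : ℝ))) := by
    refine tendsto_integral_filter_of_dominated_convergence (fun z => gaussKernel 1 z * B) ?_ ?_
      (hk.integrable.mul_const B) ?_
    · refine Eventually.of_forall fun t => ?_
      exact (hk.continuous.mul (hc.comp (by fun_prop))).aestronglyMeasurable
    · refine Eventually.of_forall fun t => Eventually.of_forall fun z => ?_
      rw [norm_mul, Real.norm_of_nonneg (gaussKernel_nonneg one_pos z)]
      exact mul_le_mul_of_nonneg_left (hB _) (gaussKernel_nonneg one_pos z)
    · refine Eventually.of_forall fun z => ?_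
      have h1 : Continuous fun t : ℝ => gaussKernel 1 z * osc (√t • z) :=
        continuous_const.mul (hc.comp (by fun_prop))
      have h2 := (h1.tendsto 0).mono_left (nhdsWithin_le_nhds (s := Ioi 0))
      simpa [h0] using h2
  rw [integral_zero] at key
  refine key.congr' ?_
  filter_upwards [self_mem_nhdsWithin] with t ht
  exact (integral_gaussKernel_mul_eq ht osc).symm

theorem integral_conv_sub (k : RSpace d → ℝ) (f : RSpace d → RSpace d) (x : RSpace d) :
    ∫ y, k (x - y) • f y = ∫ z, k z • f (x - z) := by
  have := integral_sub_left_eq_self (fun y => k (x - y) • f y) volume x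
  simpa using this.symm

/-- Jensen's inequality, obtained from Hölder, for the probability density `G_t`, then Tonelli. The
right side averages the `L^q` modulus of continuity of `f` under translations. -/
theorem lintegral_enorm_heatFlow_sub_le {t q : ℝ} (ht : 0 < t) (hq : 1 ≤ q)
    {f : RSpace d → RSpace d} (hf : IsTame f) :
    ∫⁻ x, ‖heatFlow t f x - f x‖ₑ ^ q
      ≤ ∫⁻ z, ENNReal.ofReal (gaussKernel t z) * ∫⁻ x, ‖f (x - z) - f x‖ₑ ^ q := by
  have hk : IsConvKernel (gaussKernel t : RSpace d → ℝ) := isConvKernel_gaussKernel ht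
  have hq0 : 0 < q := by linarith
  set κ : RSpace d → ℝ≥0∞ := fun z => ENNReal.ofReal (gaussKernel t z) with hκ
  have hκm : Measurable κ := hk.continuous.measurable.ennreal_ofReal
  have hκe : ∀ z, ‖gaussKernel t z‖ₑ = κ z := fun z =>
    Real.enorm_of_nonneg (gaussKernel_nonneg ht z)
  have hκ1 : ∫⁻ z, κ z = 1 := by
    simp_rw [← hκe]
    rw [hk.lintegral_enorm, integral_norm_gaussKernel ht, ENNReal.ofReal_one]
  have hm : AEMeasurable (fun z : RSpace d × RSpace d => ‖f (z.1 - z.2) - f z.1‖ₑ)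
      (volume.prod volume) :=
    ((hf.1.comp_quasiMeasurePreserving (quasiMeasurePreserving_sub volume volume)).sub
      hf.1.comp_fst).enorm
  have pt : ∀ x, ‖heatFlow t f x - f x‖ₑ ^ q ≤ ∫⁻ z, κ z * ‖f (x - z) - f x‖ₑ ^ q := by
    intro x
    have hfx : AEMeasurable fun z => ‖f (x - z) - f x‖ₑ :=
      ((hf.1.comp_measurePreserving (Measure.measurePreserving_sub_left volume x)).sub
        aestronglyMeasurable_const).enorm
    have e1 : heatFlow t f x - f x = ∫ z, gaussKernel t z • (f (x - z) - f x) := by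
      have h1 : Integrable fun z => gaussKernel t z • f (x - z) := by
        have := (hk.integrable_smul hf x).comp_sub_left x
        simpa using this
      simp_rw [smul_sub]
      rw [integral_sub h1 (hk.integrable.smul_const _), integral_smul_const, integral_gaussKernel ht,
        one_smul, heatFlow, integral_conv_sub]
    have e2 : ‖heatFlow t f x - f x‖ₑ ≤ ∫⁻ z, κ z * ‖f (x - z) - f x‖ₑ := by
      rw [e1]
      refine (enorm_integral_le_lintegral_enorm _).trans (le_of_eq ?_)
      simp_rw [enorm_smul, hκe]
    have hqi : 0 ≤ 1 / q := by positivity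
    have hqi1 : 0 ≤ 1 - 1 / q := by rw [sub_nonneg, div_le_one hq0]; exact hq
    have e3 : ∫⁻ z, κ z * ‖f (x - z) - f x‖ₑ
        ≤ (∫⁻ z, κ z * ‖f (x - z) - f x‖ₑ ^ q) ^ (1 / q) * (∫⁻ z, κ z) ^ (1 - 1 / q) := by
      refine le_trans (lintegral_mono fun z => ?_) (ENNReal.lintegral_mul_norm_pow_le
        (hκm.aemeasurable.mul (hfx.pow_const q)) hκm.aemeasurable hqi hqi1 (by ring))
      rw [Pi.mul_apply, ENNReal.mul_rpow_of_nonneg _ _ hqi, ← ENNReal.rpow_mul,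
        mul_one_div_cancel hq0.ne', ENNReal.rpow_one, mul_right_comm,
        ← ENNReal.rpow_add_of_nonneg _ _ hqi hqi1]
      simp
    rw [hκ1, ENNReal.one_rpow, mul_one] at e3
    calc _ ≤ ((∫⁻ z, κ z * ‖f (x - z) - f x‖ₑ ^ q) ^ (1 / q)) ^ q := by
          gcongr
          exact e2.trans e3
      _ = _ := by rw [← ENNReal.rpow_mul, one_div_mul_cancel hq0.ne', ENNReal.rpow_one]
  refine (lintegral_mono pt).trans (le_of_eq ?_)
  rw [lintegral_lintegral_swap ((hκm.comp measurable_snd).aemeasurable.mul (hm.pow_const q))]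
  congr with z
  have : AEMeasurable fun x => ‖f (x - z) - f x‖ₑ ^ q :=
    (((hf.1.comp_measurePreserving (measurePreserving_sub_right volume z)).sub hf.1).enorm).pow_const q
  rw [lintegral_const_mul'' _ this]

/-- The heat semigroup is strongly continuous at the initial time in `L^p`, `p < ∞`. -/
theorem tendsto_eLpNorm_heatFlow_sub {p : ℝ≥0∞} [hp : Fact (1 ≤ p)] (hpt : p ≠ ⊤)
    (f : LpField d p) :
    Tendsto (fun t => eLpNorm (fun x => heatFlow t f x - f x) p volume) (𝓝[>] 0) (𝓝 0) := by
  have hq : 1 ≤ p.toReal := by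
    rw [← ENNReal.toReal_one]
    exact ENNReal.toReal_mono hpt hp.out
  have hq0 : 0 < p.toReal := by linarith
  have hp0 : p ≠ 0 := (zero_lt_one.trans_le hp.out).ne'
  have hmp : ∀ z : RSpace d, MeasurePreserving (fun x : RSpace d => x - z) volume volume :=
    fun z => measurePreserving_sub_right volume z
  let g : RSpace d → C(RSpace d, RSpace d) := fun z => ⟨fun x => x - z, by fun_prop⟩
  have hg : Continuous g := by
    refine ContinuousMap.continuous_of_continuous_uncurry g ?_
    change Continuous fun z : RSpace d × RSpace d => z.2 - z.1
    fun_prop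
  let τ : RSpace d → LpField d p := fun z => Lp.compMeasurePreserving (g z) (hmp z) f
  -- Strong continuity of translations holds only for `p < ∞`.
  have hτ : Continuous τ := continuous_const.compMeasurePreservingLp hg hmp hpt
  have hτe : ∀ z, τ z =ᵐ[volume] fun x => f (x - z) := fun z => Lp.coeFn_compMeasurePreserving _ _
  let osc : RSpace d → ℝ := fun z => ‖τ z - f‖ ^ p.toReal
  have osc_cont : Continuous osc := (hτ.sub continuous_const).norm.rpow_const fun _ => Or.inr hq0.le
  have osc_zero : osc 0 = 0 := by
    have : τ 0 = f := by
      refine Lp.ext ((hτe 0).trans (Eventually.of_forall fun x => ?_))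
      simp
    simp only [osc, this, sub_self, norm_zero]
    exact Real.zero_rpow hq0.ne'
  have osc_le : ∀ z, ‖osc z‖ ≤ (2 * ‖f‖) ^ p.toReal := by
    intro z
    rw [Real.norm_of_nonneg (by positivity)]
    refine Real.rpow_le_rpow (norm_nonneg _) ?_ hq0.le
    refine (norm_sub_le _ _).trans ?_
    rw [Lp.norm_compMeasurePreserving]
    linarith
  have osc_eq : ∀ z, ∫⁻ x, ‖f (x - z) - f x‖ₑ ^ p.toReal = ENNReal.ofReal (osc z) := by
    intro z
    have h1 : eLpNorm (fun x => f (x - z) - f x) p volume = ENNReal.ofReal ‖τ z - f‖ := by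
      rw [Lp.norm_def, ENNReal.ofReal_toReal (Lp.eLpNorm_ne_top _)]
      refine eLpNorm_congr_ae ?_
      filter_upwards [Lp.coeFn_sub (τ z) f, hτe z] with x h1 h2
      rw [h1, Pi.sub_apply, h2]
    rw [eLpNorm_eq_lintegral_rpow_enorm_toReal hp0 hpt] at h1
    rw [← ENNReal.ofReal_rpow_of_nonneg (norm_nonneg _) hq0.le, ← h1, ← ENNReal.rpow_mul,
      one_div_mul_cancel hq0.ne', ENNReal.rpow_one]
  have hlim := tendsto_integral_gaussKernel_mul osc_cont osc_zero osc_le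
  have hlim2 : Tendsto (fun t => (ENNReal.ofReal (∫ z, gaussKernel t z * osc z)) ^ (1 / p.toReal))
      (𝓝[>] 0) (𝓝 0) := by
    have h1 := (ENNReal.continuous_ofReal.tendsto 0).comp hlim
    have h2 := (ENNReal.continuous_rpow_const (y := 1 / p.toReal)).tendsto (ENNReal.ofReal 0)
    have h3 := h2.comp h1
    have h4 : (0 : ℝ≥0∞) ^ (1 / p.toReal) = 0 := ENNReal.zero_rpow_of_pos (by positivity)
    rwa [ENNReal.ofReal_zero, h4] at h3
  refine tendsto_of_tendsto_of_tendsto_of_le_of_le' tendsto_const_nhds hlim2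
    (Eventually.of_forall fun _ => zero_le) ?_
  filter_upwards [self_mem_nhdsWithin] with t ht
  rw [eLpNorm_eq_lintegral_rpow_enorm_toReal hp0 hpt]
  gcongr
  refine (lintegral_enorm_heatFlow_sub_le ht hq ((Lp.memLp f).isTame hp.out)).trans (le_of_eq ?_)
  simp_rw [osc_eq]
  have hk : IsConvKernel (gaussKernel t : RSpace d → ℝ) := isConvKernel_gaussKernel ht
  rw [ofReal_integral_eq_lintegral_ofReal]
  · congr with z
    rw [ENNReal.ofReal_mul (gaussKernel_nonneg ht z)]
  · refine (hk.integrable.mul_const ((2 * ‖f‖) ^ p.toReal)).mono'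
      (hk.continuous.mul osc_cont).aestronglyMeasurable (Eventually.of_forall fun z => ?_)
    rw [norm_mul, Real.norm_of_nonneg (gaussKernel_nonneg ht z)]
    exact mul_le_mul_of_nonneg_left (osc_le z) (gaussKernel_nonneg ht z)
  · exact Eventually.of_forall fun z => mul_nonneg (gaussKernel_nonneg ht z) (by positivity)

end Gauss

/-! ### The Oseen kernel as a superposition of rescaled Schwartz functions -/

open scoped SchwartzMap

/-- The polynomial is at most `M! e^{1+r}`, and completing the square bounds `r - b r²` by `1/(4b)`.
-/
theorem exists_one_add_pow_mul_exp_le (M : ℕ) {b : ℝ} (hb : 0 < b) :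
    ∃ C : ℝ, ∀ r : ℝ, 0 ≤ r → (1 + r) ^ M * Real.exp (-b * r ^ 2) ≤ C := by
  refine ⟨M.factorial * Real.exp (1 + 1 / (4 * b)), fun r hr => ?_⟩
  have h1 : (1 + r) ^ M ≤ M.factorial * Real.exp (1 + r) := by
    have := Real.pow_div_factorial_le_exp (1 + r) (by positivity) M
    rw [div_le_iff₀ (by positivity)] at this
    linarith
  calc _ ≤ M.factorial * Real.exp (1 + r) * Real.exp (-b * r ^ 2) := by gcongr
    _ = M.factorial * Real.exp (1 + r + -b * r ^ 2) := by rw [mul_assoc, ← Real.exp_add]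
    _ ≤ _ := by
      refine mul_le_mul_of_nonneg_left (Real.exp_le_exp.2 ?_) (by positivity)
      have : 0 ≤ b * (r - 1 / (2 * b)) ^ 2 := by positivity
      have e : b * (r - 1 / (2 * b)) ^ 2 = b * r ^ 2 - r + 1 / (4 * b) := by
        field_simp
        ring
      linarith

/-- Gaussians are Schwartz functions. -/
def gaussianSchwartz (d : ℕ) {b : ℝ} (hb : 0 < b) : 𝓢(RSpace d, ℝ) where
  toFun x := Real.exp (-b * ‖x‖ ^ 2)
  smooth' := (contDiff_const.mul (contDiff_norm_sq ℝ)).exp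
  decay' := by
    intro m n
    have hf : (fun x : RSpace d => -b * ‖x‖ ^ 2).HasTemperateGrowth :=
      (Function.HasTemperateGrowth.const (-b)).mul (Function.hasTemperateGrowth_norm_sq (RSpace d))
    obtain ⟨k, C, hC, h⟩ := hf.norm_iteratedFDeriv_le_uniform n
    obtain ⟨B, hB⟩ := exists_one_add_pow_mul_exp_le (m + k * n) hb
    refine ⟨n.factorial * (1 + C) ^ n * B, fun x => ?_⟩
    -- The composition estimate wants the `i`-th derivative of the exponent bounded by `D^i`. Using
    -- `1 + C` in place of `C` forces `D ≥ 1`, so a bound by `D` is enough for `i ≥ 1`.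
    have h1 : ‖iteratedFDeriv ℝ n (Real.exp ∘ fun x : RSpace d => -b * ‖x‖ ^ 2) x‖
        ≤ n.factorial * Real.exp (-b * ‖x‖ ^ 2) * ((1 + C) * (1 + ‖x‖) ^ k) ^ n := by
      refine norm_iteratedFDeriv_comp_le (N := ∞) Real.contDiff_exp hf.1 (mod_cast le_top) x ?_ ?_
      · intro i _
        rw [norm_iteratedFDeriv_eq_norm_iteratedDeriv, iteratedDeriv_eq_iterate, Real.iter_deriv_exp,
          Real.norm_of_nonneg (Real.exp_nonneg _)]
      · intro i hi hi'
        calc _ ≤ C * (1 + ‖x‖) ^ k := h i hi' x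
          _ ≤ (1 + C) * (1 + ‖x‖) ^ k := by gcongr; simp
          _ ≤ _ := by
            apply le_self_pow₀ (one_le_mul_of_one_le_of_one_le (by simp [hC]) (by simp [one_le_pow₀]))
            omega
    have h2 := hB ‖x‖ (norm_nonneg x)
    calc _ ≤ (1 + ‖x‖) ^ m * (n.factorial * Real.exp (-b * ‖x‖ ^ 2) * ((1 + C) * (1 + ‖x‖) ^ k) ^ n) := by
          gcongr
          · linarith [norm_nonneg x]
          · exact h1
      _ = n.factorial * (1 + C) ^ n * ((1 + ‖x‖) ^ (m + k * n) * Real.exp (-b * ‖x‖ ^ 2)) := by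
        rw [pow_add, pow_mul, mul_pow]
        ring
      _ ≤ _ := by gcongr

section Oseen

variable {d : ℕ}

/-- The polynomial part of the symbol of `-∂_t e^{tΔ} ℙ ∇·`. -/
def oseenPoly (i j k : Fin d) (ξ : RSpace d) : ℝ :=
  (‖ξ‖ ^ 2 * (if i = j then 1 else 0) - ξ i * ξ j) * ξ k

theorem hasTemperateGrowth_oseenPoly (i j k : Fin d) : (oseenPoly i j k).HasTemperateGrowth := by
  have hp : ∀ i : Fin d, (fun ξ : RSpace d => ξ i).HasTemperateGrowth := fun i =>
    (EuclideanSpace.proj (𝕜 := ℝ) i : RSpace d →L[ℝ] ℝ).hasTemperateGrowth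
  exact (((Function.hasTemperateGrowth_norm_sq (RSpace d)).mul (Function.HasTemperateGrowth.const _)).sub
    ((hp i).mul (hp j))).mul (hp k)

theorem oseenPoly_smul (i j k : Fin d) (c : ℝ) (ξ : RSpace d) :
    oseenPoly i j k (c • ξ) = c ^ 3 * oseenPoly i j k ξ := by
  simp only [oseenPoly, norm_smul, PiLp.smul_apply, smul_eq_mul, mul_pow, Real.norm_eq_abs, sq_abs]
  ring

/-- The symbol of `-∂_t e^{tΔ} ℙ ∇·` at time `s`. -/
def oseenRate (i j k : Fin d) (s : ℝ) (ξ : RSpace d) : ℂ :=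
  (8 * Real.pi ^ 3 * Complex.I) *
    ((oseenPoly i j k ξ * Real.exp (-(4 * Real.pi ^ 2) * s * ‖ξ‖ ^ 2) : ℝ) : ℂ)

/-- The symbol `oseenRate` at time `1` as a Schwartz function. -/
def oseenRateSchwartz (i j k : Fin d) : 𝓢(RSpace d, ℂ) :=
  SchwartzMap.postcompCLM (((8 * Real.pi ^ 3 * Complex.I : ℂ)) • Complex.ofRealCLM)
    (SchwartzMap.smulLeftCLM ℝ (oseenPoly i j k)
      (gaussianSchwartz d (b := 4 * Real.pi ^ 2) (by positivity)))

theorem oseenRateSchwartz_apply (i j k : Fin d) (ξ : RSpace d) :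
    oseenRateSchwartz i j k ξ = oseenRate i j k 1 ξ := by
  rw [oseenRateSchwartz, SchwartzMap.postcompCLM_apply,
    SchwartzMap.smulLeftCLM_apply_apply (hasTemperateGrowth_oseenPoly i j k)]
  simp only [oseenRate, mul_one]
  rfl

/-- The polynomial factor is homogeneous of degree three, whence the power `s^{-3/2}`. -/
theorem oseenRate_eq (i j k : Fin d) {s : ℝ} (hs : 0 < s) (ξ : RSpace d) :
    oseenRate i j k s ξ = ((s ^ (-(3 / 2) : ℝ) : ℝ) : ℂ) * oseenRateSchwartz i j k (√s • ξ) := by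
  rw [oseenRateSchwartz_apply]
  unfold oseenRate
  rw [oseenPoly_smul, norm_smul, Real.norm_of_nonneg (Real.sqrt_nonneg s), mul_pow,
    Real.sq_sqrt hs.le]
  have h : s ^ (-(3 / 2) : ℝ) * √s ^ 3 = 1 := by
    rw [Real.sqrt_eq_rpow, ← Real.rpow_mul_natCast hs.le, ← Real.rpow_add hs]
    norm_num
  have h' : ((s ^ (-(3 / 2) : ℝ) : ℝ) : ℂ) * ((√s ^ 3 : ℝ) : ℂ) = 1 := by
    rw [← Complex.ofReal_mul, h, Complex.ofReal_one]
  rw [show -(4 * Real.pi ^ 2) * 1 * (s * ‖ξ‖ ^ 2) = -(4 * Real.pi ^ 2) * s * ‖ξ‖ ^ 2 by ring]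
  rw [mul_assoc (√s ^ 3), Complex.ofReal_mul (√s ^ 3)]
  linear_combination (-(8 * Real.pi ^ 3 * Complex.I) *
    ((oseenPoly i j k ξ * Real.exp (-(4 * Real.pi ^ 2) * s * ‖ξ‖ ^ 2) : ℝ) : ℂ)) * h'

/-- Integrating the exponential over `s > τ` produces `1/(4π²|ξ|²)`, which recreates the denominator
of the Leray projection. The singular symbol is thus a superposition of Schwartz functions. -/
theorem oseenSymbol_eq (i j k : Fin d) {τ : ℝ} (ξ : RSpace d) :
    oseenSymbol τ i j k ξ = ∫ s in Ioi τ, oseenRate i j k s ξ := by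
  unfold oseenRate
  rw [integral_const_mul, integral_complex_ofReal, integral_const_mul]
  -- At the origin both sides vanish because of the factor `ξ_k`.
  rcases eq_or_ne ξ 0 with rfl | hξ
  · simp [oseenSymbol, oseenPoly]
  have hn : 0 < ‖ξ‖ := norm_pos_iff.2 hξ
  have h1 : ∫ s in Ioi τ, Real.exp (-(4 * Real.pi ^ 2) * s * ‖ξ‖ ^ 2)
      = Real.exp (-4 * Real.pi ^ 2 * τ * ‖ξ‖ ^ 2) / (4 * Real.pi ^ 2 * ‖ξ‖ ^ 2) := by
    have := integral_exp_mul_Ioi (a := -(4 * Real.pi ^ 2 * ‖ξ‖ ^ 2))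
      (neg_lt_zero.2 (by positivity)) τ
    rw [neg_div_neg_eq] at this
    rw [show -4 * Real.pi ^ 2 * τ * ‖ξ‖ ^ 2 = -(4 * Real.pi ^ 2 * ‖ξ‖ ^ 2) * τ by ring, ← this]
    refine setIntegral_congr_fun measurableSet_Ioi fun s _ => ?_
    congr 1
    ring
  rw [h1]
  unfold oseenSymbol oseenPoly
  have hpi : (Real.pi : ℂ) ≠ 0 := by exact_mod_cast Real.pi_ne_zero
  have hnc : ((‖ξ‖ : ℝ) : ℂ) ≠ 0 := by exact_mod_cast hn.ne'
  push_cast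
  field_simp
  ring

/-- The convolution kernel of `-∂_t e^{tΔ} ℙ ∇·` at time `1`. -/
def oseenProfile (i j k : Fin d) : 𝓢(RSpace d, ℂ) := 𝓕⁻ (oseenRateSchwartz i j k)

theorem fourierInv_comp_smul (f : RSpace d → ℂ) {c : ℝ} (hc : 0 < c) (x : RSpace d) :
    𝓕⁻ (fun ξ => f (c • ξ)) x = ((c ^ d)⁻¹ : ℝ) • 𝓕⁻ f (c⁻¹ • x) := by
  rw [Real.fourierInv_eq, Real.fourierInv_eq]
  have := Measure.integral_comp_smul_of_nonneg (volume : Measure (RSpace d))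
    (fun η => Real.fourierChar (inner ℝ η (c⁻¹ • x)) • f η) c (hR := hc.le)
  rw [finrank_euclideanSpace_fin] at this
  rw [← this]
  congr with ξ
  rw [inner_smul_left, inner_smul_right]
  simp [hc.ne']

theorem fourierInv_const_mul (c : ℂ) (f : RSpace d → ℂ) (x : RSpace d) :
    𝓕⁻ (fun ξ => c * f ξ) x = c * 𝓕⁻ f x := by
  rw [Real.fourierInv_eq', Real.fourierInv_eq', ← integral_const_mul]
  congr with ξ
  simp only [smul_eq_mul]
  ring

/-- Of the exponent, `3/2` comes from homogeneity of the symbol and `d/2` from the dilation by `√s`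
under the Fourier transform. -/
theorem fourierInv_oseenRate (i j k : Fin d) {s : ℝ} (hs : 0 < s) (x : RSpace d) :
    𝓕⁻ (oseenRate i j k s) x
      = ((s ^ (-(3 / 2 + d / 2) : ℝ) : ℝ) : ℂ) * oseenProfile i j k ((√s)⁻¹ • x) := by
  have h1 : oseenRate i j k s
      = fun ξ => ((s ^ (-(3 / 2) : ℝ) : ℝ) : ℂ) * oseenRateSchwartz i j k (√s • ξ) := by
    ext ξ
    rw [oseenRate_eq i j k hs]
  rw [h1, fourierInv_const_mul,
    fourierInv_comp_smul _ (Real.sqrt_pos.2 hs), oseenProfile, SchwartzMap.fourierInv_coe]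
  have h2 : s ^ (-(3 / 2 + d / 2) : ℝ) = s ^ (-(3 / 2) : ℝ) * (√s ^ d)⁻¹ := by
    rw [Real.sqrt_eq_rpow, ← Real.rpow_mul_natCast hs.le, ← Real.rpow_neg hs.le, ← Real.rpow_add hs]
    ring_nf
  rw [h2]
  simp only [Complex.real_smul, Complex.ofReal_mul]
  ring

theorem continuous_oseenRate_prod (i j k : Fin d) :
    Continuous fun z : ℝ × RSpace d => oseenRate i j k z.1 z.2 := by
  unfold oseenRate oseenPoly
  fun_prop

theorem integrable_oseenRate (i j k : Fin d) {s : ℝ} (hs : 0 < s) :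
    Integrable (oseenRate i j k s) ∧
      ∫ ξ, ‖oseenRate i j k s ξ‖
        = s ^ (-(3 / 2 + d / 2) : ℝ) * ∫ ξ, ‖oseenRateSchwartz i j k ξ‖ := by
  have hst := Real.sqrt_pos.2 hs
  have h2 : s ^ (-(3 / 2 + d / 2) : ℝ) = s ^ (-(3 / 2) : ℝ) * (√s ^ d)⁻¹ := by
    rw [Real.sqrt_eq_rpow, ← Real.rpow_mul_natCast hs.le, ← Real.rpow_neg hs.le, ← Real.rpow_add hs]
    ring_nf
  constructor
  · have := ((oseenRateSchwartz i j k).integrable (μ := volume)).comp_smul hst.ne'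
    exact (this.const_mul ((s ^ (-(3 / 2) : ℝ) : ℝ) : ℂ)).congr
      (Eventually.of_forall fun ξ => (oseenRate_eq i j k hs ξ).symm)
  · simp_rw [oseenRate_eq i j k hs, norm_mul, Complex.norm_real]
    rw [integral_const_mul, Measure.integral_comp_smul_of_nonneg (volume : Measure (RSpace d))
      (fun ξ => ‖oseenRateSchwartz i j k ξ‖) √s (hR := hst.le), finrank_euclideanSpace_fin,
      Real.norm_of_nonneg (by positivity), h2, smul_eq_mul, mul_assoc]

/-- The `L^1` norm in `ξ` at time `s` is a multiple of `s^{-(3/2+d/2)}`, integrable at infinity.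
This licenses exchanging the time integral with the Fourier integral. -/
theorem integrable_oseenRate_prod (i j k : Fin d) {τ : ℝ} (hτ : 0 < τ) :
    Integrable (fun z : ℝ × RSpace d => oseenRate i j k z.1 z.2)
      ((volume.restrict (Ioi τ)).prod volume) := by
  refine (integrable_prod_iff (continuous_oseenRate_prod i j k).aestronglyMeasurable).2 ⟨?_, ?_⟩
  · rw [ae_restrict_iff' measurableSet_Ioi]
    exact Eventually.of_forall fun s hs => (integrable_oseenRate i j k (hτ.trans hs)).1
  · have h1 : IntegrableOn (fun s : ℝ => s ^ (-(3 / 2 + d / 2) : ℝ)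
        * ∫ ξ, ‖oseenRateSchwartz i j k ξ‖) (Ioi τ) := by
      refine Integrable.mul_const ?_ _
      refine integrableOn_Ioi_rpow_of_lt ?_ hτ
      have : (0 : ℝ) ≤ d / 2 := by positivity
      linarith
    refine h1.congr ?_
    filter_upwards [self_mem_ae_restrict measurableSet_Ioi] with s hs
    exact (integrable_oseenRate i j k (hτ.trans hs)).2.symm

theorem integrable_oseenSymbol (i j k : Fin d) {τ : ℝ} (hτ : 0 < τ) :
    Integrable (oseenSymbol τ i j k) :=
  (integrable_oseenRate_prod i j k hτ).integral_prod_right.congr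
    (Eventually.of_forall fun ξ => (oseenSymbol_eq i j k ξ).symm)

theorem fourierInv_oseenSymbol (i j k : Fin d) {τ : ℝ} (hτ : 0 < τ) (x : RSpace d) :
    𝓕⁻ (oseenSymbol τ i j k) x
      = ∫ s in Ioi τ, ((s ^ (-(3 / 2 + d / 2) : ℝ) : ℝ) : ℂ) * oseenProfile i j k ((√s)⁻¹ • x) := by
  rw [Real.fourierInv_eq]
  have h1 : ∀ ξ : RSpace d, Real.fourierChar (inner ℝ ξ x) • oseenSymbol τ i j k ξ
      = ∫ s in Ioi τ, Real.fourierChar (inner ℝ ξ x) • oseenRate i j k s ξ := by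
    intro ξ
    rw [oseenSymbol_eq]
    simp_rw [Circle.smul_def]
    rw [integral_smul]
  simp_rw [h1]
  rw [← integral_integral_swap]
  · refine setIntegral_congr_fun measurableSet_Ioi fun s hs => ?_
    change ∫ ξ, Real.fourierChar (inner ℝ ξ x) • oseenRate i j k s ξ = _
    rw [← Real.fourierInv_eq, fourierInv_oseenRate i j k (hτ.trans hs)]
  · refine (integrable_oseenRate_prod i j k hτ).norm.mono' ?_ ?_
    · refine Continuous.aestronglyMeasurable ?_
      have := continuous_oseenRate_prod i j k
      have h2 : Continuous fun z : ℝ × RSpace d => (Real.fourierChar (inner ℝ z.2 x) : ℂ) := by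
        fun_prop
      simp only [Function.uncurry_def, Circle.smul_def, smul_eq_mul]
      exact h2.mul this
    · refine Eventually.of_forall fun z => ?_
      simp [Function.uncurry_def]

end Oseen

/-! ### Norm bounds for the Oseen kernels -/

section OseenBounds

variable {d : ℕ}

/-- The integral over the times in `I` of the rescaled profiles. -/
def oseenPart (i j k : Fin d) (I : Set ℝ) (x : RSpace d) : ℂ :=
  ∫ s in I, ((s ^ (-(3 / 2 + d / 2) : ℝ) : ℝ) : ℂ) * oseenProfile i j k ((√s)⁻¹ • x)

theorem integrableOn_rpow_rate {α τ : ℝ} (hτ : 0 < τ) (hα : 1 < α) :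
    IntegrableOn (fun s : ℝ => s ^ (-α)) (Ioi τ) :=
  integrableOn_Ioi_rpow_of_lt (by linarith) hτ

theorem one_lt_rate (d : ℕ) : (1 : ℝ) < 3 / 2 + d / 2 := by
  have : (0 : ℝ) ≤ d / 2 := by positivity
  linarith

theorem measurable_oseenPart_integrand (i j k : Fin d) :
    Measurable fun z : RSpace d × ℝ =>
      ((z.2 ^ (-(3 / 2 + d / 2) : ℝ) : ℝ) : ℂ) * oseenProfile i j k ((√z.2)⁻¹ • z.1) := by
  have hN : Measurable (oseenProfile i j k) := (oseenProfile i j k).continuous.measurable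
  refine Measurable.mul (by fun_prop) (hN.comp ?_)
  fun_prop

theorem integrableOn_oseenPart (i j k : Fin d) {I : Set ℝ} {τ : ℝ} (hτ : 0 < τ) (hI : MeasurableSet I)
    (hIτ : I ⊆ Ioi τ) {B : ℝ} (hB : ∀ x, ‖oseenProfile i j k x‖ ≤ B) (x : RSpace d) :
    IntegrableOn (fun s : ℝ =>
      ((s ^ (-(3 / 2 + d / 2) : ℝ) : ℝ) : ℂ) * oseenProfile i j k ((√s)⁻¹ • x)) I ∧
    ‖oseenPart i j k I x‖ ≤ B * ∫ s in I, s ^ (-(3 / 2 + d / 2) : ℝ) := by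
  have h1 : IntegrableOn (fun s : ℝ => B * s ^ (-(3 / 2 + d / 2) : ℝ)) I :=
    ((integrableOn_rpow_rate hτ (one_lt_rate d)).mono_set hIτ).const_mul B
  have h2 : ∀ᵐ s ∂(volume.restrict I),
      ‖((s ^ (-(3 / 2 + d / 2) : ℝ) : ℝ) : ℂ) * oseenProfile i j k ((√s)⁻¹ • x)‖
        ≤ B * s ^ (-(3 / 2 + d / 2) : ℝ) := by
    filter_upwards [self_mem_ae_restrict hI] with s hs
    have hs0 : 0 < s := hτ.trans (hIτ hs)
    rw [norm_mul, Complex.norm_real, Real.norm_of_nonneg (by positivity), mul_comm]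
    gcongr
    exact hB _
  constructor
  · exact h1.mono' ((measurable_oseenPart_integrand i j k).comp
      (measurable_const.prodMk measurable_id)).aestronglyMeasurable h2
  · rw [← integral_const_mul]
    exact norm_integral_le_of_norm_le h1 h2

/-- Dilating the profile by `√s` multiplies its `L^1` norm by `s^{d/2}`, leaving the rate
`s^{-3/2}`. -/
theorem lintegral_enorm_oseenPart_le (i j k : Fin d) {I : Set ℝ} {τ : ℝ} (hτ : 0 < τ)
    (hI : MeasurableSet I) (hIτ : I ⊆ Ioi τ) :
    ∫⁻ x, ‖oseenPart i j k I x‖ₑ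
      ≤ ENNReal.ofReal ((∫ x, ‖oseenProfile i j k x‖) * ∫ s in I, s ^ (-(3 / 2) : ℝ)) := by
  have h1 : ∀ x, ‖oseenPart i j k I x‖ₑ ≤ ∫⁻ s in I,
      ‖((s ^ (-(3 / 2 + d / 2) : ℝ) : ℝ) : ℂ) * oseenProfile i j k ((√s)⁻¹ • x)‖ₑ := fun x =>
    enorm_integral_le_lintegral_enorm _
  refine (lintegral_mono h1).trans ?_
  rw [lintegral_lintegral_swap (measurable_oseenPart_integrand i j k).enorm.aemeasurable]
  have h2 : ∀ s ∈ I, ∫⁻ x : RSpace d,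
      ‖((s ^ (-(3 / 2 + d / 2) : ℝ) : ℝ) : ℂ) * oseenProfile i j k ((√s)⁻¹ • x)‖ₑ
        = ENNReal.ofReal ((∫ x, ‖oseenProfile i j k x‖) * s ^ (-(3 / 2) : ℝ)) := by
    intro s hs
    have hs0 : 0 < s := hτ.trans (hIτ hs)
    have hst := Real.sqrt_pos.2 hs0
    have hint : Integrable fun x => ((s ^ (-(3 / 2 + d / 2) : ℝ) : ℝ) : ℂ)
        * oseenProfile i j k ((√s)⁻¹ • x) :=
      (((oseenProfile i j k).integrable (μ := volume)).comp_smul (inv_pos.2 hst).ne').const_mul _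
    rw [← ofReal_integral_norm_eq_lintegral_enorm hint]
    congr 1
    simp_rw [norm_mul, Complex.norm_real]
    rw [integral_const_mul, Measure.integral_comp_inv_smul_of_nonneg (volume : Measure (RSpace d))
      (fun x => ‖oseenProfile i j k x‖) hst.le, finrank_euclideanSpace_fin,
      Real.norm_of_nonneg (by positivity), smul_eq_mul, mul_comm, mul_right_comm, mul_comm]
    congr 1
    rw [Real.sqrt_eq_rpow, ← Real.rpow_mul_natCast hs0.le, ← Real.rpow_add hs0]
    ring_nf
  rw [setLIntegral_congr_fun hI h2, ← ofReal_integral_eq_lintegral_ofReal, integral_const_mul]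
  · exact ((integrableOn_rpow_rate hτ (by norm_num)).mono_set hIτ).const_mul _
  · filter_upwards [self_mem_ae_restrict hI] with s hs
    have hs0 : 0 < s := hτ.trans (hIτ hs)
    have : 0 ≤ ∫ x, ‖oseenProfile i j k x‖ := integral_nonneg fun _ => norm_nonneg _
    positivity

theorem oseenKernel_eq_re (i j k : Fin d) {τ : ℝ} (hτ : 0 < τ) (x : RSpace d) :
    oseenKernel τ i j k x = (oseenPart i j k (Ioi τ) x).re := by
  rw [oseenKernel, fourierInv_oseenSymbol i j k hτ, oseenPart]

theorem continuous_fourierInv {f : RSpace d → ℂ} (hf : Integrable f) : Continuous (𝓕⁻ f) :=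
  VectorFourier.fourierIntegral_continuous Real.continuous_fourierChar
    (L := -innerₗ (RSpace d)) (by
      simp only [LinearMap.neg_apply, innerₗ_apply_apply]
      fun_prop) hf

theorem continuous_oseenKernel (i j k : Fin d) {τ : ℝ} (hτ : 0 < τ) :
    Continuous (oseenKernel τ i j k) :=
  Complex.continuous_re.comp (continuous_fourierInv (integrable_oseenSymbol i j k hτ))

theorem exists_norm_le_schwartz (f : SchwartzMap (RSpace d) ℂ) : ∃ B : ℝ, 0 ≤ B ∧ ∀ x, ‖f x‖ ≤ B := by
  obtain ⟨B, hB⟩ := f.decay 0 0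
  exact ⟨B, hB.1.le, fun x => by simpa using hB.2 x⟩

theorem integral_Ioi_rpow_rate {α τ : ℝ} (hα : 1 < α) (hτ : 0 < τ) :
    ∫ s in Ioi τ, s ^ (-α) = τ ^ (1 - α) / (α - 1) := by
  rw [integral_Ioi_rpow_of_lt (by linarith) hτ, show -α + 1 = 1 - α by ring, neg_div,
    ← div_neg, neg_sub]

/-- `L^1`, `L^∞` and Lipschitz bounds for the Oseen kernels. -/
theorem exists_oseenKernel_bounds (d : ℕ) : ∃ c : ℝ, 0 < c ∧ ∀ i j k : Fin d,
    (∀ τ, 0 < τ → IsConvKernel (oseenKernel τ i j k)) ∧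
    (∀ τ, 0 < τ → ∫ x, ‖oseenKernel τ i j k x‖ ≤ c * τ ^ (-(1 / 2) : ℝ)) ∧
    (∀ τ, 0 < τ → ∀ x, ‖oseenKernel τ i j k x‖ ≤ c * τ ^ (-(1 / 2 + d / 2) : ℝ)) ∧
    (∀ τ, 0 < τ → ∀ τ', τ ≤ τ' → ∫ x, ‖oseenKernel τ i j k x - oseenKernel τ' i j k x‖
      ≤ c * (τ ^ (-(1 / 2) : ℝ) - τ' ^ (-(1 / 2) : ℝ))) := by
  have hex : ∀ i j k : Fin d, ∃ c : ℝ, 0 ≤ c ∧ (∀ x, ‖oseenProfile i j k x‖ ≤ c) ∧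
      2 * ∫ x, ‖oseenProfile i j k x‖ ≤ c := by
    intro i j k
    obtain ⟨B, hB0, hB⟩ := exists_norm_le_schwartz (oseenProfile i j k)
    have : 0 ≤ ∫ x, ‖oseenProfile i j k x‖ := integral_nonneg fun _ => norm_nonneg _
    exact ⟨B + 2 * ∫ x, ‖oseenProfile i j k x‖, by positivity,
      fun x => (hB x).trans (by linarith), by linarith⟩
  choose b hb0 hb1 hb2 using hex
  -- One constant for all index triples. The factor `2` absorbs `1/(1/2 + d/2) ≤ 2` in the supremum
  -- bound; the summand `1` keeps `c` positive even when the sum is zero.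
  let c : ℝ := 1 + 2 * ∑ i, ∑ j, ∑ k, b i j k
  have hbc : ∀ i j k, 2 * b i j k ≤ c := by
    intro i j k
    have h1 : b i j k ≤ ∑ k, b i j k :=
      Finset.single_le_sum (f := fun k => b i j k) (fun k _ => hb0 i j k) (Finset.mem_univ k)
    have h2 : ∑ k, b i j k ≤ ∑ j, ∑ k, b i j k :=
      Finset.single_le_sum (f := fun j => ∑ k, b i j k)
        (fun j _ => Finset.sum_nonneg fun k _ => hb0 i j k) (Finset.mem_univ j)
    have h3 : ∑ j, ∑ k, b i j k ≤ ∑ i, ∑ j, ∑ k, b i j k :=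
      Finset.single_le_sum (f := fun i => ∑ j, ∑ k, b i j k)
        (fun i _ => Finset.sum_nonneg fun j _ => Finset.sum_nonneg fun k _ => hb0 i j k)
        (Finset.mem_univ i)
    simp only [c]
    linarith
  have hc : 0 < c := by
    have : 0 ≤ ∑ i, ∑ j, ∑ k, b i j k :=
      Finset.sum_nonneg fun i _ => Finset.sum_nonneg fun j _ => Finset.sum_nonneg fun k _ => hb0 i j k
    simp only [c]
    linarith
  refine ⟨c, hc, fun i j k => ?_⟩
  have hbc1 : b i j k ≤ c := by linarith [hbc i j k, hb0 i j k]
  set N1 := ∫ x, ‖oseenProfile i j k x‖ with hN1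
  have hN10 : 0 ≤ N1 := integral_nonneg fun _ => norm_nonneg _
  have hN1c : 2 * N1 ≤ c := (hb2 i j k).trans hbc1
  have hre : ∀ z : ℂ, ‖z.re‖ₑ ≤ ‖z‖ₑ := fun z => by
    rw [← ofReal_norm, ← ofReal_norm]
    exact ENNReal.ofReal_le_ofReal (Complex.abs_re_le_norm z)
  have h32 : ∀ τ : ℝ, 0 < τ → ∫ s in Ioi τ, s ^ (-(3 / 2) : ℝ) = 2 * τ ^ (-(1 / 2) : ℝ) := by
    intro τ hτ
    rw [integral_Ioi_rpow_rate (by norm_num) hτ]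
    norm_num
    ring
  have hL : ∀ τ, 0 < τ → ∫⁻ x, ‖oseenKernel τ i j k x‖ₑ
      ≤ ENNReal.ofReal (c * τ ^ (-(1 / 2) : ℝ)) := by
    intro τ hτ
    calc _ ≤ ∫⁻ x, ‖oseenPart i j k (Ioi τ) x‖ₑ := lintegral_mono fun x => by
          rw [oseenKernel_eq_re i j k hτ]
          exact hre _
      _ ≤ _ := lintegral_enorm_oseenPart_le i j k hτ measurableSet_Ioi Subset.rfl
      _ ≤ _ := by
        refine ENNReal.ofReal_le_ofReal ?_
        rw [h32 τ hτ, ← mul_assoc, mul_comm N1]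
        gcongr
  have hS : ∀ τ, 0 < τ → ∀ x, ‖oseenKernel τ i j k x‖ ≤ c * τ ^ (-(1 / 2 + d / 2) : ℝ) := by
    intro τ hτ x
    rw [oseenKernel_eq_re i j k hτ]
    refine (Complex.abs_re_le_norm _).trans ?_
    refine (integrableOn_oseenPart i j k hτ measurableSet_Ioi Subset.rfl (hb1 i j k) x).2.trans ?_
    rw [integral_Ioi_rpow_rate (one_lt_rate d) hτ,
      show 1 - (3 / 2 + (d : ℝ) / 2) = -(1 / 2 + d / 2) by ring, ← mul_div_assoc,
      div_le_iff₀ (by linarith [one_lt_rate d])]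
    have h0 : (0 : ℝ) ≤ d / 2 := by positivity
    have hτp : 0 ≤ τ ^ (-(1 / 2 + d / 2) : ℝ) := by positivity
    nlinarith [hbc i j k, hb0 i j k, mul_nonneg hτp hc.le, mul_nonneg (mul_nonneg hτp hc.le) h0,
      mul_nonneg hτp (sub_nonneg.2 (hbc i j k))]
  have hK : ∀ τ, 0 < τ → IsConvKernel (oseenKernel τ i j k) := by
    intro τ hτ
    have hcont := continuous_oseenKernel i j k hτ
    exact ⟨hcont, ⟨hcont.aestronglyMeasurable, (hL τ hτ).trans_lt ENNReal.ofReal_lt_top⟩, _, hS τ hτ⟩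
  refine ⟨hK, fun τ hτ => ?_, hS, fun τ hτ τ' hττ' => ?_⟩
  · refine (ENNReal.ofReal_le_ofReal_iff (by positivity)).1 ?_
    rw [ofReal_integral_norm_eq_lintegral_enorm (hK τ hτ).integrable]
    exact hL τ hτ
  · have hτ' : 0 < τ' := hτ.trans_le hττ'
    have hmono : τ' ^ (-(1 / 2) : ℝ) ≤ τ ^ (-(1 / 2) : ℝ) :=
      Real.rpow_le_rpow_of_nonpos hτ hττ' (by norm_num)
    refine (ENNReal.ofReal_le_ofReal_iff (mul_nonneg hc.le (sub_nonneg.2 hmono))).1 ?_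
    rw [ofReal_integral_norm_eq_lintegral_enorm ((hK τ hτ).sub (hK τ' hτ')).integrable]
    have hdisj : Disjoint (Ioc τ τ') (Ioi τ') := by
      rw [Set.disjoint_left]
      exact fun s hs hs' => hs.2.not_gt hs'
    -- The difference of two kernels is the part of the superposition with times in `(τ, τ']`, which
    -- gives continuity in time from the same estimate.
    have hpart : ∀ x, oseenKernel τ i j k x - oseenKernel τ' i j k x
        = (oseenPart i j k (Ioc τ τ') x).re := by
      intro x
      rw [oseenKernel_eq_re i j k hτ, oseenKernel_eq_re i j k hτ', ← Complex.sub_re]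
      congr 1
      unfold oseenPart
      rw [← Ioc_union_Ioi_eq_Ioi hττ', setIntegral_union hdisj measurableSet_Ioi
        (integrableOn_oseenPart i j k hτ measurableSet_Ioc Ioc_subset_Ioi_self (hb1 i j k) x).1
        (integrableOn_oseenPart i j k hτ' measurableSet_Ioi Subset.rfl (hb1 i j k) x).1,
        add_sub_cancel_right]
    calc _ ≤ ∫⁻ x, ‖oseenPart i j k (Ioc τ τ') x‖ₑ := lintegral_mono fun x => by
          rw [hpart]
          exact hre _
      _ ≤ _ := lintegral_enorm_oseenPart_le i j k hτ measurableSet_Ioc Ioc_subset_Ioi_self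
      _ ≤ _ := by
        refine ENNReal.ofReal_le_ofReal ?_
        have e : ∫ s in Ioc τ τ', s ^ (-(3 / 2) : ℝ)
            = 2 * (τ ^ (-(1 / 2) : ℝ) - τ' ^ (-(1 / 2) : ℝ)) := by
          have h1 := setIntegral_union (μ := volume) (f := fun s : ℝ => s ^ (-(3 / 2) : ℝ)) hdisj
            measurableSet_Ioi
            ((integrableOn_rpow_rate hτ (by norm_num)).mono_set Ioc_subset_Ioi_self)
            (integrableOn_rpow_rate hτ' (by norm_num))
          rw [Ioc_union_Ioi_eq_Ioi hττ', h32 τ hτ, h32 τ' hτ'] at h1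
          linarith
        rw [e, ← mul_assoc, mul_comm N1]
        exact mul_le_mul_of_nonneg_right hN1c (sub_nonneg.2 hmono)

end OseenBounds

/-! ### Divergence free fields -/

section DivFree

variable {d : ℕ}

theorem gradient_apply_eq (φ : RSpace d → ℝ) (x : RSpace d) (i : Fin d) :
    gradient φ x i = fderiv ℝ φ x (EuclideanSpace.single i 1) := by
  rw [← inner_gradient_left, EuclideanSpace.inner_single_right]
  simp

theorem continuous_gradient {φ : RSpace d → ℝ} (hφ : ContDiff ℝ ∞ φ) : Continuous (gradient φ) :=
  (InnerProductSpace.toDual ℝ (RSpace d)).symm.continuous.comp (hφ.continuous_fderiv (by simp))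

theorem hasCompactSupport_gradient {φ : RSpace d → ℝ} (hφ : HasCompactSupport φ) :
    HasCompactSupport (gradient φ) :=
  (hφ.fderiv ℝ).comp_left (map_zero _)

theorem IsConvKernel.of_hasCompactSupport {ψ : RSpace d → ℝ} (hc : Continuous ψ)
    (hs : HasCompactSupport ψ) : IsConvKernel ψ :=
  ⟨hc, hc.integrable_of_hasCompactSupport hs, hs.exists_bound_of_continuous hc⟩

theorem isConvKernel_gradient {φ : RSpace d → ℝ} (hφ : ContDiff ℝ ∞ φ)
    (hs : HasCompactSupport φ) (i : Fin d) : IsConvKernel fun x => gradient φ x i :=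
  .of_hasCompactSupport ((EuclideanSpace.proj (𝕜 := ℝ) i : RSpace d →L[ℝ] ℝ).continuous.comp
    (continuous_gradient hφ)) ((hasCompactSupport_gradient hs).comp_left (g := fun v : RSpace d => v i) rfl)

theorem IsTame.apply {f : RSpace d → RSpace d} (hf : IsTame f) (i : Fin d) :
    IsTame fun x => f x i := by
  obtain ⟨hm, M, F, hF, hb⟩ := hf
  refine ⟨(EuclideanSpace.proj (𝕜 := ℝ) i : RSpace d →L[ℝ] ℝ).continuous.comp_aestronglyMeasurable hm,
    M, F, hF, ?_⟩
  filter_upwards [hb] with y hy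
  exact (PiLp.norm_apply_le _ i).trans hy

theorem integrable_mul_of_isTame {f ψ : RSpace d → ℝ} (hf : IsTame f) (hψ : IsConvKernel ψ) :
    Integrable fun x => f x * ψ x := by
  have hk : IsConvKernel fun x => ψ (-x) :=
    ⟨hψ.continuous.comp continuous_neg, hψ.integrable.comp_neg,
      hψ.bounded.imp fun D hD x => hD _⟩
  refine (hk.integrable_smul hf 0).congr (Eventually.of_forall fun y => ?_)
  simp [mul_comm]

theorem inner_gradient_eq_sum (φ : RSpace d → ℝ) (v x : RSpace d) :
    inner ℝ v (gradient φ x) = ∑ i, v i * gradient φ x i := by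
  rw [PiLp.inner_apply]
  simp [mul_comm]

theorem gradient_translate (φ : RSpace d → ℝ) (z x : RSpace d) :
    gradient (fun y => φ (y + z)) x = gradient φ (x + z) := by
  unfold gradient
  rw [fderiv_comp_add_right]

theorem contDiff_translate {φ : RSpace d → ℝ} (hφ : ContDiff ℝ ∞ φ) (z : RSpace d) :
    ContDiff ℝ ∞ fun y => φ (y + z) :=
  hφ.comp (contDiff_id.add contDiff_const)

theorem hasCompactSupport_translate {φ : RSpace d → ℝ} (hφ : HasCompactSupport φ) (z : RSpace d) :
    HasCompactSupport fun y => φ (y + z) :=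
  hφ.comp_homeomorph (Homeomorph.addRight z)

theorem IsConvKernel.conv_apply {k : RSpace d → ℝ} (hk : IsConvKernel k)
    {v : RSpace d → RSpace d} (hv : IsTame v) (x : RSpace d) (i : Fin d) :
    (∫ y, k (x - y) • v y) i = ∫ y, k (x - y) * v y i := by
  have := (EuclideanSpace.proj (𝕜 := ℝ) i : RSpace d →L[ℝ] ℝ).integral_comp_comm
    (hk.integrable_smul hv x)
  simpa using this.symm

theorem heatFlow_apply {t : ℝ} (ht : 0 < t) {v : RSpace d → RSpace d} (hv : IsTame v)
    (x : RSpace d) (i : Fin d) : heatFlow t v x i = ∫ y, gaussKernel t (x - y) * v y i :=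
  (isConvKernel_gaussKernel ht).conv_apply hv x i

/-- The heat flow averages translates of `v`; moving each translation to the test function gives
another admissible test function. -/
theorem IsDivFree.heatFlow {t : ℝ} (ht : 0 < t) {v : RSpace d → RSpace d} (hv : IsTame v)
    (hdiv : IsDivFree v) : IsDivFree (heatFlow t v) := by
  intro φ hφ hs
  have hk : IsConvKernel (gaussKernel t : RSpace d → ℝ) := isConvKernel_gaussKernel ht
  have hψ := isConvKernel_gradient hφ hs
  simp_rw [inner_gradient_eq_sum, heatFlow_apply ht hv]
  have h1 := fun i => hk.integral_mul_conv (hv.apply i) (hψ i).integrable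
  have h2 := fun i => hk.integral_mul_conv' (hv.apply i) (hψ i).integrable
  rw [integral_finsetSum _ fun i _ => by simpa only [mul_comm] using (h1 i).1]
  simp_rw [mul_comm _ (gradient φ _ _)]
  rw [Finset.sum_congr rfl fun i _ => (h2 i).2, ← integral_finsetSum _ fun i _ => (h2 i).1]
  simp_rw [← Finset.mul_sum]
  rw [integral_eq_zero_of_ae]
  refine Eventually.of_forall fun z => ?_
  have h3 : ∑ i, ∫ y, v y i * gradient φ (y + z) i = 0 := by
    have hφz := contDiff_translate hφ z
    have hsz := hasCompactSupport_translate hs z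
    have h4 := hdiv _ hφz hsz
    simp_rw [inner_gradient_eq_sum] at h4
    rw [integral_finsetSum _ fun i _ =>
      integrable_mul_of_isTame (hv.apply i) (isConvKernel_gradient hφz hsz i)] at h4
    simpa only [gradient_translate] using h4
  change gaussKernel t z * _ = 0
  rw [h3, mul_zero]

theorem integral_fourierInv_mul {f g : RSpace d → ℂ} (hf : Integrable f) (hg : Integrable g) :
    ∫ x, 𝓕⁻ f x * g x = ∫ x, f x * 𝓕⁻ g x := by
  have := VectorFourier.integral_fourierIntegral_smul_eq_flip (μ := volume) (ν := volume)
    (L := -innerₗ (RSpace d)) Real.continuous_fourierChar (by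
      simp only [LinearMap.neg_apply, innerₗ_apply_apply]
      fun_prop) hf hg
  have hflip : (-innerₗ (RSpace d)).flip = -innerₗ (RSpace d) := by
    ext x y
    simp [real_inner_comm]
  rw [hflip] at this
  exact this

/-- The Leray symbol is the orthogonal projection onto the complement of `ξ`. -/
theorem sum_oseenSymbol_mul (τ : ℝ) (j k : Fin d) (ξ : RSpace d) :
    ∑ i, oseenSymbol τ i j k ξ * (ξ i : ℂ) = 0 := by
  rcases eq_or_ne ξ 0 with rfl | hξ
  · simp
  have hn : ‖ξ‖ ^ 2 ≠ 0 := by positivity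
  have h1 : ∑ i, ((if i = j then (1 : ℝ) else 0) - ξ i * ξ j / ‖ξ‖ ^ 2) * ξ i = 0 := by
    simp_rw [sub_mul]
    rw [Finset.sum_sub_distrib]
    have h2 : ∑ i, ξ i * ξ j / ‖ξ‖ ^ 2 * ξ i = ξ j / ‖ξ‖ ^ 2 * ∑ i, ξ i ^ 2 := by
      rw [Finset.mul_sum]
      refine Finset.sum_congr rfl fun i _ => ?_
      ring
    rw [h2, ← EuclideanSpace.real_norm_sq_eq]
    simp [div_mul_cancel₀ _ hn]
  have h3 : ∑ i, oseenSymbol τ i j k ξ * (ξ i : ℂ)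
      = 2 * Real.pi * Complex.I * (ξ k : ℂ) * (Real.exp (-4 * Real.pi ^ 2 * τ * ‖ξ‖ ^ 2) : ℂ)
        * ((∑ i, ((if i = j then (1 : ℝ) else 0) - ξ i * ξ j / ‖ξ‖ ^ 2) * ξ i : ℝ) : ℂ) := by
    rw [Complex.ofReal_sum, Finset.mul_sum]
    refine Finset.sum_congr rfl fun i _ => ?_
    unfold oseenSymbol
    push_cast
    ring
  rw [h3, h1]
  simp

/-- Transferring the inverse Fourier transform to the test function turns `∂_i` into multiplication
by a constant times `ξ_i`, and the sum over `i` is killed by the orthogonality of the symbol to `ξ`.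
-/
theorem sum_integral_oseenKernel_mul_gradient {τ : ℝ} (hτ : 0 < τ) (j k : Fin d)
    {φ : RSpace d → ℝ} (hφ : ContDiff ℝ ∞ φ) (hs : HasCompactSupport φ) :
    ∑ i, ∫ x, oseenKernel τ i j k x * gradient φ x i = 0 := by
  let Φ : SchwartzMap (RSpace d) ℂ :=
    SchwartzMap.postcompCLM Complex.ofRealCLM (hs.toSchwartzMap hφ)
  have hΦ : ∀ x i, (LineDeriv.lineDerivOp (EuclideanSpace.single i (1 : ℝ)) Φ :
      SchwartzMap (RSpace d) ℂ) x
      = ((gradient φ x i : ℝ) : ℂ) := by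
    intro x i
    rw [SchwartzMap.lineDerivOp_apply_eq_fderiv, gradient_apply_eq]
    have h1 : (Φ : RSpace d → ℂ) = Complex.ofRealCLM ∘ φ := rfl
    rw [h1, fderiv_comp _ Complex.ofRealCLM.differentiableAt (hφ.differentiable (by simp) x)]
    simp
  have hint : ∀ i, Integrable fun ξ : RSpace d => oseenSymbol τ i j k ξ *
      𝓕⁻ (LineDeriv.lineDerivOp (EuclideanSpace.single i (1 : ℝ)) Φ) ξ := by
    intro i
    obtain ⟨B, -, hB⟩ := exists_norm_le_schwartz
      (𝓕⁻ (LineDeriv.lineDerivOp (EuclideanSpace.single i (1 : ℝ)) Φ))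
    exact (integrable_oseenSymbol i j k hτ).mul_bdd (c := B)
      (SchwartzMap.continuous _).aestronglyMeasurable (Eventually.of_forall hB)
  have key : ∀ i, ((∫ x, oseenKernel τ i j k x * gradient φ x i : ℝ))
      = (∫ ξ : RSpace d, oseenSymbol τ i j k ξ *
      𝓕⁻ (LineDeriv.lineDerivOp (EuclideanSpace.single i (1 : ℝ)) Φ) ξ).re := by
    intro i
    rw [SchwartzMap.fourierInv_coe, ← integral_fourierInv_mul (integrable_oseenSymbol i j k hτ)
      (SchwartzMap.integrable _)]
    rw [← RCLike.re_to_complex, ← integral_re]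
    · refine integral_congr_ae (Eventually.of_forall fun x => ?_)
      simp [hΦ, oseenKernel]
    · obtain ⟨c, -, hc⟩ := exists_oseenKernel_bounds d
      have hK := isConvKernel_gradient hφ hs i
      have hcont := continuous_fourierInv (integrable_oseenSymbol i j k hτ)
      refine (Continuous.mul hcont (SchwartzMap.continuous _)).integrable_of_hasCompactSupport ?_
      refine HasCompactSupport.mul_left ?_
      have : (LineDeriv.lineDerivOp (EuclideanSpace.single i (1 : ℝ)) Φ : RSpace d → ℂ)
          = fun x => ((gradient φ x i : ℝ) : ℂ) := funext fun x => hΦ x i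
      rw [this]
      exact (hasCompactSupport_gradient hs).comp_left (g := fun v : RSpace d => ((v i : ℝ) : ℂ))
        (by simp)
  simp_rw [key]
  rw [← Complex.re_sum, ← integral_finsetSum _ fun i _ => hint i]
  have h0 : ∀ ξ : RSpace d, ∑ i, oseenSymbol τ i j k ξ *
      𝓕⁻ (LineDeriv.lineDerivOp (EuclideanSpace.single i (1 : ℝ)) Φ) ξ = 0 := by
    intro ξ
    have h1 : ∀ i, oseenSymbol τ i j k ξ *
        𝓕⁻ (LineDeriv.lineDerivOp (EuclideanSpace.single i (1 : ℝ)) Φ) ξ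
        = (oseenSymbol τ i j k ξ * (ξ i : ℂ)) * (-(2 * Real.pi * Complex.I) * 𝓕⁻ Φ ξ) := by
      intro i
      have ht : (fun ξ : RSpace d => inner ℝ ξ (EuclideanSpace.single i (1 : ℝ))).HasTemperateGrowth := by
        fun_prop
      rw [SchwartzMap.fourierInv_lineDerivOp_eq, smul_apply,
        SchwartzMap.smulLeftCLM_apply_apply ht, EuclideanSpace.inner_single_right]
      simp
      ring
    simp_rw [h1]
    rw [← Finset.sum_mul, sum_oseenSymbol_mul, zero_mul]
  simp_rw [h0]
  simp

theorem isTame_mul_apply {p : ℝ≥0∞} (hp : 2 ≤ p) {v w : RSpace d → RSpace d} (hv : MemLp v p)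
    (hw : MemLp w p) (j k : Fin d) : IsTame fun y => v y j * w y k := by
  have hm : ∀ {v : RSpace d → RSpace d}, AEStronglyMeasurable v → ∀ i,
      AEStronglyMeasurable fun y => v y i := fun h i =>
    (EuclideanSpace.proj (𝕜 := ℝ) i : RSpace d →L[ℝ] ℝ).continuous.comp_aestronglyMeasurable h
  refine IsTame.mul hp ((hm hv.1 j).mul (hm hw.1 k)) hv hw (Eventually.of_forall fun y => ?_)
  rw [norm_mul]
  gcongr
  · exact PiLp.norm_apply_le _ j
  · exact PiLp.norm_apply_le _ k

/-- Fubini pairs the kernel with the gradient first; for each fixed `y` that pairing, summed over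
`i`, vanishes whatever `v` is. -/
theorem isDivFree_oseenFlow {p : ℝ≥0∞} (hp : 2 ≤ p) {τ : ℝ} (hτ : 0 < τ)
    {v : RSpace d → RSpace d} (hv : MemLp v p) : IsDivFree (oseenFlow τ v) := by
  intro φ hφ hs
  obtain ⟨c, -, hc⟩ := exists_oseenKernel_bounds d
  have hψ := isConvKernel_gradient hφ hs
  have h1 := fun i j k => ((hc i j k).1 τ hτ).integral_mul_conv (isTame_mul_apply hp hv hv j k)
    (hψ i).integrable
  simp_rw [inner_gradient_eq_sum]
  have e1 : ∀ x, ∑ i, oseenFlow τ v x i * gradient φ x i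
      = ∑ j, ∑ k, ∑ i, gradient φ x i * ∫ y, oseenKernel τ i j k (x - y) * (v y j * v y k) := by
    intro x
    simp_rw [Finset.sum_comm (s := Finset.univ (α := Fin d)) (t := Finset.univ)
      (f := fun k i => gradient φ x i * ∫ y, oseenKernel τ i _ k (x - y) * (v y _ * v y k))]
    rw [Finset.sum_comm]
    refine Finset.sum_congr rfl fun i _ => ?_
    simp only [oseenFlow, mul_comm _ (gradient φ x i), Finset.mul_sum]
  simp_rw [e1]
  rw [integral_finsetSum _ fun j _ => integrable_finsetSum _ fun k _ =>
    integrable_finsetSum _ fun i _ => (h1 i j k).1]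
  refine Finset.sum_eq_zero fun j _ => ?_
  rw [integral_finsetSum _ fun k _ => integrable_finsetSum _ fun i _ => (h1 i j k).1]
  refine Finset.sum_eq_zero fun k _ => ?_
  rw [integral_finsetSum _ fun i _ => (h1 i j k).1, Finset.sum_congr rfl fun i _ => (h1 i j k).2.2,
    ← integral_finsetSum _ fun i _ => (h1 i j k).2.1]
  simp_rw [← Finset.mul_sum]
  rw [integral_eq_zero_of_ae]
  refine Eventually.of_forall fun y => ?_
  have h2 : ∑ i, ∫ x, oseenKernel τ i j k (x - y) * gradient φ x i = 0 := by
    rw [← sum_integral_oseenKernel_mul_gradient hτ j k (contDiff_translate hφ y)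
      (hasCompactSupport_translate hs y)]
    refine Finset.sum_congr rfl fun i _ => ?_
    rw [← integral_add_right_eq_self _ y]
    simp [gradient_translate]
  change v y j * v y k * _ = 0
  rw [h2, mul_zero]

/-- A gradient of a test function lies in the dual exponent, so the pairing commutes with
differences and Bochner integrals in `L^p`. -/
theorem exists_clm_inner_gradient {p : ℝ≥0∞} [Fact (1 ≤ p)] {φ : RSpace d → ℝ}
    (hφ : ContDiff ℝ ∞ φ) (hs : HasCompactSupport φ) :
    ∃ L : LpField d p →L[ℝ] ℝ, ∀ v : LpField d p, L v = ∫ x, inner ℝ (v x) (gradient φ x) := by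
  have : Fact (1 ≤ p.conjExponent) := ⟨(ENNReal.HolderConjugate.conjExponent Fact.out).symm.one_le⟩
  have hm : MemLp (gradient φ) p.conjExponent (volume : Measure (RSpace d)) :=
    (continuous_gradient hφ).memLp_of_hasCompactSupport (hasCompactSupport_gradient hs)
  refine ⟨((innerSL ℝ).lpPairing volume p p.conjExponent).flip (hm.toLp _), fun v => ?_⟩
  rw [ContinuousLinearMap.flip_apply, ContinuousLinearMap.lpPairing_eq_integral]
  refine integral_congr_ae ?_
  filter_upwards [hm.coeFn_toLp] with x hx
  rw [hx]
  rfl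

theorem isDivFree_congr {v w : RSpace d → RSpace d} (h : v =ᵐ[volume] w) (hv : IsDivFree v) :
    IsDivFree w := by
  intro φ hφ hs
  rw [← hv φ hφ hs]
  refine integral_congr_ae ?_
  filter_upwards [h] with x hx
  rw [hx]

theorem IsDivFree.sub {p : ℝ≥0∞} [Fact (1 ≤ p)] {v w : LpField d p} (hv : IsDivFree v)
    (hw : IsDivFree w) : IsDivFree (v - w : LpField d p) := by
  intro φ hφ hs
  obtain ⟨L, hL⟩ := exists_clm_inner_gradient (p := p) hφ hs
  rw [← hL, map_sub, hL, hL, hv φ hφ hs, hw φ hφ hs, sub_zero]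

theorem isDivFree_intervalIntegral {p : ℝ≥0∞} [Fact (1 ≤ p)] {w : ℝ → LpField d p} {t : ℝ}
    (ht : 0 ≤ t) (hw : IntervalIntegrable w volume 0 t) (hdiv : ∀ s ∈ Ioo 0 t, IsDivFree (w s)) :
    IsDivFree (∫ s in (0 : ℝ)..t, w s : LpField d p) := by
  intro φ hφ hs
  obtain ⟨L, hL⟩ := exists_clm_inner_gradient (p := p) hφ hs
  rw [← hL, ← L.intervalIntegral_comp_comm hw, intervalIntegral.integral_of_le ht,
    integral_Ioc_eq_integral_Ioo, setIntegral_congr_fun (g := fun _ => 0) measurableSet_Ioo]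
  · simp
  · intro s h
    simp only [hL]
    exact hdiv s h φ hφ hs

end DivFree

/-! ### Low frequency truncation of the heat flow -/

section LowFreq

variable {d : ℕ}

/-- The cut-off function, as a Schwartz function of Mathlib's frequency variable. -/
def LPCutoff.schwartz (χ : LPCutoff d) : SchwartzMap (RSpace d) ℂ :=
  HasCompactSupport.toSchwartzMap (f := fun ξ : RSpace d => (χ.toFun ((2 * Real.pi) • ξ) : ℂ))
    (by
      have h : HasCompactSupport χ.toFun := by
        refine HasCompactSupport.intro (isCompact_closedBall 0 (4 / 3)) fun ξ hξ => χ.eq_zero ξ ?_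
        rw [Metric.mem_closedBall, dist_zero_right, not_le] at hξ
        exact hξ.le
      have h2 := h.comp_homeomorph (Homeomorph.smulOfNeZero (2 * Real.pi) (by positivity))
      exact h2.comp_left (g := fun r : ℝ => (r : ℂ)) (by simp))
    (by
      have := χ.smooth
      exact Complex.ofRealCLM.contDiff.comp (this.comp (contDiff_const_smul (2 * Real.pi))))

theorem LPCutoff.schwartz_apply (χ : LPCutoff d) (ξ : RSpace d) :
    χ.schwartz ξ = (χ.toFun ((2 * Real.pi) • ξ) : ℂ) := rfl

/-- The convolution kernel of `Δ_{<0}`, with complex values. -/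
def LPCutoff.profile (χ : LPCutoff d) : SchwartzMap (RSpace d) ℂ := 𝓕⁻ χ.schwartz

theorem lowFreqKernel_eq (χ : LPCutoff d) (J : ℝ) (x : RSpace d) :
    lowFreqKernel χ J x = (((((2 : ℝ) ^ J) ^ d : ℝ) : ℂ) * χ.profile ((2 : ℝ) ^ J • x)).re := by
  have h0 : (0 : ℝ) < 2 ^ (-J) := by positivity
  have h1 := fourierInv_comp_smul (fun ξ : RSpace d => χ.schwartz ξ) h0 x
  have h2 : (fun ξ : RSpace d => χ.schwartz ((2 : ℝ) ^ (-J) • ξ))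
      = fun ξ => (χ.toFun (((2 : ℝ) ^ (-J) * (2 * Real.pi)) • ξ) : ℂ) := by
    ext ξ
    rw [χ.schwartz_apply, smul_smul, mul_comm]
  rw [h2] at h1
  rw [lowFreqKernel, h1, Real.rpow_neg zero_le_two, inv_inv, inv_pow, inv_inv,
    LPCutoff.profile, SchwartzMap.fourierInv_coe, Complex.real_smul]

/-- The first moment of the convolution kernel of `Δ_{<0}`. -/
def lowFreqMoment (χ : LPCutoff d) : ℝ := ∫ x, ‖x‖ * ‖χ.profile x‖

theorem lowFreqMoment_nonneg (χ : LPCutoff d) : 0 ≤ lowFreqMoment χ :=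
  integral_nonneg fun _ => by positivity

theorem isConvKernel_lowFreqKernel (χ : LPCutoff d) (J : ℝ) : IsConvKernel (lowFreqKernel χ J) := by
  have hJ : (0 : ℝ) < 2 ^ J := by positivity
  have he : lowFreqKernel χ J = fun x => (((((2 : ℝ) ^ J) ^ d : ℝ) : ℂ) * χ.profile ((2 : ℝ) ^ J • x)).re :=
    funext (lowFreqKernel_eq χ J)
  rw [he]
  have hc : Continuous χ.profile := SchwartzMap.continuous _
  refine ⟨by fun_prop, ?_, ?_⟩
  · exact Integrable.re (((χ.profile.integrable (μ := volume)).comp_smul hJ.ne').const_mul _)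
  · obtain ⟨B, hB0, hB⟩ := exists_norm_le_schwartz χ.profile
    refine ⟨((2 : ℝ) ^ J) ^ d * B, fun x => (Complex.abs_re_le_norm _).trans ?_⟩
    rw [norm_mul]
    gcongr
    · simp [abs_of_pos hJ]
    · exact hB _

/-- The mass is the value of the cut-off at frequency zero. It is what makes the high-frequency
kernel a difference of Gaussians. -/
theorem integral_lowFreqKernel (χ : LPCutoff d) (J : ℝ) : ∫ x, lowFreqKernel χ J x = 1 := by
  have hJ : (0 : ℝ) < 2 ^ J := by positivity
  have hint := (χ.profile.integrable (μ := volume)).comp_smul hJ.ne'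
  have h1 : ∫ x, χ.profile x = 1 := by
    have h2 : 𝓕 χ.profile = χ.schwartz := FourierTransform.fourier_fourierInv_eq _
    have h3 : (𝓕 χ.profile) 0 = 1 := by
      rw [h2, χ.schwartz_apply, smul_zero, χ.eq_one 0 (by simp; norm_num), Complex.ofReal_one]
    rw [SchwartzMap.fourier_coe, Real.fourier_eq] at h3
    simpa using h3
  simp_rw [lowFreqKernel_eq]
  have h4 := integral_re (hint.const_mul ((((2 : ℝ) ^ J) ^ d : ℝ) : ℂ))
  simp only [RCLike.re_to_complex] at h4 ⊢
  rw [h4, integral_const_mul, Measure.integral_comp_smul_of_nonneg (volume : Measure (RSpace d))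
      (fun x => χ.profile x) ((2 : ℝ) ^ J) (hR := hJ.le), h1, finrank_euclideanSpace_fin]
  rw [Complex.real_smul, mul_one, ← Complex.ofReal_mul,
    mul_inv_cancel₀ (by positivity), Complex.ofReal_one, Complex.one_re]

theorem integrable_norm_mul_lowFreqKernel (χ : LPCutoff d) (J : ℝ) :
    Integrable (fun x => ‖x‖ * ‖lowFreqKernel χ J x‖) ∧
      ∫ x, ‖x‖ * ‖lowFreqKernel χ J x‖ ≤ ((2 : ℝ) ^ J)⁻¹ * lowFreqMoment χ := by
  set c : ℝ := 2 ^ J with hc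
  have hJ : 0 < c := by positivity
  have h0 : Integrable fun x : RSpace d => ‖x‖ * ‖χ.profile x‖ := by
    have := χ.profile.integrable_pow_mul volume 1
    simpa using this
  have h1 : Integrable fun x : RSpace d => c ^ d * (c⁻¹ * (‖c • x‖ * ‖χ.profile (c • x)‖)) :=
    ((h0.comp_smul hJ.ne').const_mul _).const_mul _
  have hle : ∀ x : RSpace d, ‖x‖ * ‖lowFreqKernel χ J x‖
      ≤ c ^ d * (c⁻¹ * (‖c • x‖ * ‖χ.profile (c • x)‖)) := by
    intro x
    rw [lowFreqKernel_eq]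
    have h2 := Complex.abs_re_le_norm (((c ^ d : ℝ) : ℂ) * χ.profile (c • x))
    rw [norm_mul, Complex.norm_real, Real.norm_of_nonneg (by positivity)] at h2
    rw [← hc, Real.norm_eq_abs]
    calc _ ≤ ‖x‖ * (c ^ d * ‖χ.profile (c • x)‖) := by gcongr
      _ = _ := by
        rw [norm_smul, Real.norm_of_nonneg hJ.le]
        field_simp
  have h3 : Integrable fun x => ‖x‖ * ‖lowFreqKernel χ J x‖ := by
    refine h1.mono' ?_ (Eventually.of_forall fun x => ?_)
    · exact (continuous_norm.mul (isConvKernel_lowFreqKernel χ J).continuous.norm).aestronglyMeasurable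
    · rw [Real.norm_of_nonneg (by positivity)]
      exact hle x
  refine ⟨h3, (integral_mono h3 h1 hle).trans (le_of_eq ?_)⟩
  have h4 := Measure.integral_comp_smul_of_nonneg
    (volume : Measure (RSpace d)) (fun x => ‖x‖ * ‖χ.profile x‖) c (hR := hJ.le)
  rw [finrank_euclideanSpace_fin, smul_eq_mul] at h4
  rw [integral_const_mul, integral_const_mul, h4, lowFreqMoment]
  field_simp

/-- The convolution kernel of `e^{tΔ} (1 - K)`, where `K` is the convolution with `k`. -/
def gaussDefect (t : ℝ) (k : RSpace d → ℝ) (x : RSpace d) : ℝ :=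
  gaussKernel t x - ∫ y, gaussKernel t (x - y) * k y

theorem integrable_gaussKernel_mul {t : ℝ} (ht : 0 < t) {k : RSpace d → ℝ} (hk : IsConvKernel k)
    (x : RSpace d) : Integrable fun y => gaussKernel t (x - y) * k y := by
  obtain ⟨D, hD⟩ := (isConvKernel_gaussKernel (d := d) ht).bounded
  exact hk.integrable.bdd_mul (c := D)
    ((isConvKernel_gaussKernel ht).continuous.comp
      (by fun_prop : Continuous fun y => x - y)).aestronglyMeasurable
    (Eventually.of_forall fun y => hD _)

/-- Unit mass of `k` lets `G_t(x)` be written under the integral, exposing the cancellation. -/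
theorem gaussDefect_eq {t : ℝ} (ht : 0 < t) {k : RSpace d → ℝ} (hk : IsConvKernel k)
    (hk1 : ∫ y, k y = 1) (x : RSpace d) :
    gaussDefect t k x = ∫ y, k y * (gaussKernel t x - gaussKernel t (x - y)) := by
  have h1 : ∀ y, k y * (gaussKernel t x - gaussKernel t (x - y))
      = k y * gaussKernel t x - gaussKernel t (x - y) * k y := fun y => by ring
  simp_rw [h1]
  rw [integral_sub (hk.integrable.mul_const _) (integrable_gaussKernel_mul ht hk x),
    integral_mul_const, hk1, one_mul, gaussDefect]

/-- The `L^1` cost of translating `G_t` by `y` is `O(t^{-1/2}|y|)`; integrating against `|k(y)|`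
leaves the first moment of `k`, which for the low-frequency kernel scales like `2^{-J}`. -/
theorem isConvKernel_gaussDefect {t : ℝ} (ht : 0 < t) {k : RSpace d → ℝ} (hk : IsConvKernel k)
    (hk1 : ∫ y, k y = 1) (hm : Integrable fun y => ‖y‖ * ‖k y‖) :
    IsConvKernel (gaussDefect t k) ∧ ∫ x, ‖gaussDefect t k x‖
      ≤ (t ^ (-(1 / 2) : ℝ) * 2 ^ ((d : ℝ) / 2)) * ∫ y, ‖y‖ * ‖k y‖ := by
  set c := t ^ (-(1 / 2) : ℝ) * 2 ^ ((d : ℝ) / 2) with hc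
  have hc0 : 0 ≤ c := by positivity
  have hG : IsConvKernel (gaussKernel t : RSpace d → ℝ) := isConvKernel_gaussKernel ht
  have hGc := hG.continuous
  have hkc := hk.continuous
  obtain ⟨D, hD⟩ := hG.bounded
  have hle : ∀ x y, ‖gaussKernel t (x - y) * k y‖ ≤ D * ‖k y‖ := by
    intro x y
    rw [norm_mul]
    gcongr
    exact hD _
  have hcont : Continuous (gaussDefect t k) := by
    refine hGc.sub (continuous_of_dominated (bound := fun y => D * ‖k y‖) ?_ ?_ ?_ ?_)
    · exact fun x => (integrable_gaussKernel_mul ht hk x).aestronglyMeasurable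
    · exact fun x => Eventually.of_forall (hle x)
    · exact hk.integrable.norm.const_mul _
    · exact Eventually.of_forall fun y => by fun_prop
  have hL : ∫⁻ x, ‖gaussDefect t k x‖ₑ ≤ ENNReal.ofReal (c * ∫ y, ‖y‖ * ‖k y‖) := by
    have h1 : ∀ x, ‖gaussDefect t k x‖ₑ
        ≤ ∫⁻ y, ‖k y * (gaussKernel t x - gaussKernel t (x - y))‖ₑ := fun x => by
      rw [gaussDefect_eq ht hk hk1]
      exact enorm_integral_le_lintegral_enorm _
    refine (lintegral_mono h1).trans ?_
    have hcj : Continuous fun z : RSpace d × RSpace d =>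
        k z.2 * (gaussKernel t z.1 - gaussKernel t (z.1 - z.2)) := by fun_prop
    rw [lintegral_lintegral_swap hcj.measurable.enorm.aemeasurable, ← integral_const_mul,
      ofReal_integral_eq_lintegral_ofReal (hm.const_mul c)
        (Eventually.of_forall fun y => by positivity)]
    refine lintegral_mono fun y => ?_
    have hi : Integrable fun x => k y * (gaussKernel t x - gaussKernel t (x - y)) :=
      (hG.integrable.sub (hG.integrable.comp_sub_right y)).const_mul _
    rw [← ofReal_integral_norm_eq_lintegral_enorm hi]
    refine ENNReal.ofReal_le_ofReal ?_
    simp_rw [norm_mul]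
    rw [integral_const_mul]
    calc _ ≤ ‖k y‖ * (‖y‖ * c) := by
          gcongr
          exact integral_norm_gaussKernel_sub_translate_le ht y
      _ = _ := by ring
  have hi : Integrable (gaussDefect t k) :=
    ⟨hcont.aestronglyMeasurable, hL.trans_lt ENNReal.ofReal_lt_top⟩
  refine ⟨⟨hcont, hi, D + ∫ y, D * ‖k y‖, fun x => (norm_sub_le _ _).trans (add_le_add (hD x)
    (norm_integral_le_of_norm_le (hk.integrable.norm.const_mul _)
      (Eventually.of_forall (hle x))))⟩, ?_⟩
  have hnn : 0 ≤ ∫ y, ‖y‖ * ‖k y‖ := integral_nonneg fun _ => by positivity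
  refine (ENNReal.ofReal_le_ofReal_iff (by positivity)).1 ?_
  rw [ofReal_integral_norm_eq_lintegral_enorm hi]
  exact hL

theorem heatFlow_eq_lowFreq_add {t : ℝ} (ht : 0 < t) {k : RSpace d → ℝ} (hk : IsConvKernel k)
    (hR : IsConvKernel (gaussDefect t k)) {p : ℝ≥0∞} (hp : 1 ≤ p) {v : RSpace d → RSpace d}
    (hv : MemLp v p) (x : RSpace d) :
    heatFlow t v x = heatFlow t (fun y => ∫ z, k (y - z) • v z) x
      + ∫ z, gaussDefect t k (x - z) • v z := by
  have hvt := hv.isTame hp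
  have hG : IsConvKernel (gaussKernel t : RSpace d → ℝ) := isConvKernel_gaussKernel ht
  ext i
  rw [PiLp.add_apply, heatFlow_apply ht hvt, heatFlow_apply ht ((hk.memLp_conv hp hv).isTame hp),
    hR.conv_apply hvt]
  simp_rw [hk.conv_apply hvt]
  have h1 := hk.integral_mul_conv (hvt.apply i) (hG.integrable.comp_sub_left x)
  have h3 := hR.integrable_smul (hvt.apply i) x
  simp only [smul_eq_mul] at h3
  rw [h1.2.2, ← integral_add h1.2.1 h3]
  congr with z
  have h2 : ∫ y, k (y - z) * gaussKernel t (x - y) = ∫ y, gaussKernel t (x - z - y) * k y := by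
    rw [← integral_add_right_eq_self _ z]
    congr with y
    rw [add_sub_cancel_right, mul_comm, sub_sub, add_comm z y]
  rw [h2, gaussDefect]
  ring

theorem eLpNorm_heatFlow_le {t : ℝ} (ht : 0 < t) {p : ℝ≥0∞} (hp : 1 ≤ p) {v : RSpace d → RSpace d}
    (hv : AEStronglyMeasurable v) : eLpNorm (heatFlow t v) p volume ≤ eLpNorm v p volume := by
  have := (isConvKernel_gaussKernel (d := d) ht).eLpNorm_conv_le hp hv
  rwa [integral_norm_gaussKernel ht, ENNReal.ofReal_one, one_mul] at this

/-- Decay of the heat flow for data that are sparse in frequency. -/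
theorem eLpNorm_heatFlow_le_of_sparse (χ : LPCutoff d) {t : ℝ} (ht : 0 < t) {p : ℝ≥0∞} (hp : 1 ≤ p)
    {v : RSpace d → RSpace d} (hv : MemLp v p) {β J : ℝ} (hs : IsFreqSparse χ p β J v) :
    eLpNorm (heatFlow t v) p volume ≤ ENNReal.ofReal β * eLpNorm v p volume
      + ENNReal.ofReal ((t ^ (-(1 / 2) : ℝ) * 2 ^ ((d : ℝ) / 2))
        * (((2 : ℝ) ^ J)⁻¹ * lowFreqMoment χ)) * eLpNorm v p volume := by
  have hk := isConvKernel_lowFreqKernel χ J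
  obtain ⟨hm, hm'⟩ := integrable_norm_mul_lowFreqKernel χ J
  obtain ⟨hR, hR'⟩ := isConvKernel_gaussDefect ht hk (integral_lowFreqKernel χ J) hm
  have he : heatFlow t v = heatFlow t (lowFreq χ J v)
      + fun x => ∫ z, gaussDefect t (lowFreqKernel χ J) (x - z) • v z :=
    funext (heatFlow_eq_lowFreq_add ht hk hR hp hv)
  have hl : AEStronglyMeasurable (lowFreq χ J v) := hk.aestronglyMeasurable hv.1
  rw [he]
  refine (eLpNorm_add_le ((isConvKernel_gaussKernel ht).aestronglyMeasurable hl)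
    (hR.aestronglyMeasurable hv.1) hp).trans (add_le_add ?_ ?_)
  · exact (eLpNorm_heatFlow_le ht hp hl).trans hs
  · refine (hR.eLpNorm_conv_le hp hv.1).trans ?_
    gcongr
    exact hR'.trans (by gcongr)

end LowFreq

/-! ### The bilinear term of the Navier-Stokes equations in `L^p` -/

section TensorConv

variable {d : ℕ}

/-- Convolution of a tensor valued function with a tensor of kernels. -/
def tensorConv (K : Fin d → Fin d → Fin d → RSpace d → ℝ) (F : Fin d → Fin d → RSpace d → ℝ)
    (x : RSpace d) : RSpace d :=
  WithLp.toLp 2 fun i => ∑ j, ∑ k, ∫ y, K i j k (x - y) * F j k y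

theorem oseenFlow_eq_tensorConv (τ : ℝ) (v : RSpace d → RSpace d) :
    oseenFlow τ v = tensorConv (oseenKernel τ) fun j k y => v y j * v y k := rfl

/-- Reduces measurability and norm bounds to scalar convolutions, at the cost of a factor `d³` in
the norm. -/
theorem tensorConv_eq_sum (K : Fin d → Fin d → Fin d → RSpace d → ℝ)
    (F : Fin d → Fin d → RSpace d → ℝ) :
    tensorConv K F = ∑ i, ∑ j, ∑ k, fun x =>
      (∫ y, K i j k (x - y) • F j k y) • (EuclideanSpace.single i (1 : ℝ) : RSpace d) := by
  ext x l
  have h : ∀ i, ((∑ j, ∑ k, fun x => (∫ y, K i j k (x - y) • F j k y) •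
      (EuclideanSpace.single i (1 : ℝ) : RSpace d)) x) l
      = if i = l then tensorConv K F x l else 0 := by
    intro i
    rcases eq_or_ne i l with rfl | hi
    · simp [tensorConv, Finset.sum_apply]
    · simp [Finset.sum_apply, hi]
  rw [Finset.sum_apply, WithLp.ofLp_sum, Finset.sum_apply, Finset.sum_congr rfl fun i _ => h i]
  simp

variable {K : Fin d → Fin d → Fin d → RSpace d → ℝ} {F : Fin d → Fin d → RSpace d → ℝ}

theorem tensorConv_sub (hK : ∀ i j k, IsConvKernel (K i j k)) (hF : ∀ j k, IsTame (F j k))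
    {F' : Fin d → Fin d → RSpace d → ℝ} (hF' : ∀ j k, IsTame (F' j k)) :
    tensorConv K F - tensorConv K F' = tensorConv K fun j k y => F j k y - F' j k y := by
  ext x i
  simp only [Pi.sub_apply, tensorConv, PiLp.sub_apply, ← Finset.sum_sub_distrib]
  refine Finset.sum_congr rfl fun j _ => Finset.sum_congr rfl fun k _ => ?_
  have h1 := (hK i j k).integrable_smul (hF j k) x
  have h2 := (hK i j k).integrable_smul (hF' j k) x
  simp only [smul_eq_mul] at h1 h2
  rw [← integral_sub h1 h2]
  simp_rw [mul_sub]

theorem tensorConv_kernel_sub (hK : ∀ i j k, IsConvKernel (K i j k))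
    {K' : Fin d → Fin d → Fin d → RSpace d → ℝ} (hK' : ∀ i j k, IsConvKernel (K' i j k))
    (hF : ∀ j k, IsTame (F j k)) :
    tensorConv K F - tensorConv K' F = tensorConv (fun i j k x => K i j k x - K' i j k x) F := by
  ext x i
  simp only [Pi.sub_apply, tensorConv, PiLp.sub_apply, ← Finset.sum_sub_distrib]
  refine Finset.sum_congr rfl fun j _ => Finset.sum_congr rfl fun k _ => ?_
  have h1 := (hK i j k).integrable_smul (hF j k) x
  have h2 := (hK' i j k).integrable_smul (hF j k) x
  simp only [smul_eq_mul] at h1 h2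
  rw [← integral_sub h1 h2]
  simp_rw [sub_mul]

theorem aestronglyMeasurable_tensorConv (hK : ∀ i j k, IsConvKernel (K i j k))
    (hF : ∀ j k, AEStronglyMeasurable (F j k)) : AEStronglyMeasurable (tensorConv K F) := by
  rw [tensorConv_eq_sum]
  exact Finset.aestronglyMeasurable_sum _ fun i _ => Finset.aestronglyMeasurable_sum _ fun j _ =>
    Finset.aestronglyMeasurable_sum _ fun k _ =>
      ((hK i j k).aestronglyMeasurable (hF j k)).smul_const _

theorem eLpNorm_tensorConv_le (hK : ∀ i j k, IsConvKernel (K i j k)) {p : ℝ≥0∞} (hp : 2 ≤ p)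
    (hF : ∀ j k, AEStronglyMeasurable (F j k)) {E₁ E₂ : Type*} [NormedAddCommGroup E₁]
    [NormedAddCommGroup E₂] {v : RSpace d → E₁} {w : RSpace d → E₂}
    (hv : AEStronglyMeasurable v) (hw : AEStronglyMeasurable w)
    (h : ∀ j k, ∀ᵐ y, ‖F j k y‖ ≤ ‖v y‖ * ‖w y‖) {A D : ℝ} (hA : ∀ i j k, ∫ x, ‖K i j k x‖ ≤ A)
    (hD : ∀ i j k, ∀ x, ‖K i j k x‖ ≤ D) :
    eLpNorm (tensorConv K F) p volume
      ≤ d ^ 3 * (ENNReal.ofReal (A ^ (1 - p.toReal⁻¹) * D ^ p.toReal⁻¹) * eLpNorm v p volume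
        * eLpNorm w p volume) := by
  have hp1 : 1 ≤ p := one_le_two.trans hp
  set R := ENNReal.ofReal (A ^ (1 - p.toReal⁻¹) * D ^ p.toReal⁻¹) * eLpNorm v p volume
        * eLpNorm w p volume with hR
  have hm : ∀ i j k, AEStronglyMeasurable fun x =>
      (∫ y, K i j k (x - y) • F j k y) • (EuclideanSpace.single i (1 : ℝ) : RSpace d) := fun i j k =>
    ((hK i j k).aestronglyMeasurable (hF j k)).smul_const _
  have h1 : ∀ i j k, eLpNorm (fun x => (∫ y, K i j k (x - y) • F j k y) •
      (EuclideanSpace.single i (1 : ℝ) : RSpace d)) p volume ≤ R := by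
    intro i j k
    refine le_trans (eLpNorm_mono fun x => ?_)
      ((hK i j k).eLpNorm_conv_mul_le hp hv hw (h j k) (hA i j k) (hD i j k))
    rw [norm_smul, PiLp.norm_single, norm_one, mul_one]
  have hsum : ∀ {g : Fin d → RSpace d → RSpace d} {B : ℝ≥0∞},
      (∀ i, AEStronglyMeasurable (g i)) → (∀ i, eLpNorm (g i) p volume ≤ B) →
      eLpNorm (∑ i, g i) p volume ≤ d * B := by
    intro g B hg hB
    refine (eLpNorm_sum_le (fun i _ => hg i) hp1).trans ((Finset.sum_le_sum fun i _ => hB i).trans ?_)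
    simp
  have hmk := fun i j => Finset.aestronglyMeasurable_sum Finset.univ fun k _ => hm i j k
  have hmj := fun i => Finset.aestronglyMeasurable_sum Finset.univ fun j _ => hmk i j
  rw [tensorConv_eq_sum]
  refine (hsum hmj fun i => hsum (hmk i) fun j => hsum (hm i j) (h1 i j)).trans (le_of_eq ?_)
  ring

end TensorConv

/-! ### The Oseen flow as a quadratic map on `L^p` -/

section OseenLp

variable {d : ℕ} {p : ℝ≥0∞}

/-- The right side is a product of two norms, with `‖v‖ + ‖w‖` as a scalar function, to match the
form that the bilinear Young inequality takes. -/
theorem abs_mul_sub_mul_le (v w : RSpace d) (j k : Fin d) :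
    ‖v j * v k - w j * w k‖ ≤ ‖v - w‖ * ‖‖v‖ + ‖w‖‖ := by
  have h1 : ‖v k - w k‖ ≤ ‖v - w‖ := PiLp.norm_apply_le (v - w) k
  have h2 : ‖v j - w j‖ ≤ ‖v - w‖ := PiLp.norm_apply_le (v - w) j
  rw [Real.norm_of_nonneg (show 0 ≤ ‖v‖ + ‖w‖ by positivity),
    show v j * v k - w j * w k = v j * (v k - w k) + (v j - w j) * w k by ring]
  refine (norm_add_le _ _).trans ?_
  rw [norm_mul, norm_mul]
  calc _ ≤ ‖v‖ * ‖v - w‖ + ‖v - w‖ * ‖w‖ := by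
        gcongr
        · exact PiLp.norm_apply_le v j
        · exact PiLp.norm_apply_le w k
    _ = _ := by ring

/-- The order of the singularity of `e^{τΔ} ℙ ∇·` from `L^{p/2}` to `L^p`. -/
def singularOrder (d : ℕ) (p : ℝ≥0∞) : ℝ := 1 / 2 + d / 2 * p.toReal⁻¹

/-- A constant for the bounds of the Oseen kernels in dimension `d`. -/
def oseenConst (d : ℕ) : ℝ := (exists_oseenKernel_bounds d).choose

theorem oseenConst_pos (d : ℕ) : 0 < oseenConst d := (exists_oseenKernel_bounds d).choose_spec.1

theorem isConvKernel_oseenKernel {τ : ℝ} (hτ : 0 < τ) (i j k : Fin d) :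
    IsConvKernel (oseenKernel τ i j k) :=
  ((exists_oseenKernel_bounds d).choose_spec.2 i j k).1 τ hτ

theorem integral_norm_oseenKernel_le {τ : ℝ} (hτ : 0 < τ) (i j k : Fin d) :
    ∫ x, ‖oseenKernel τ i j k x‖ ≤ oseenConst d * τ ^ (-(1 / 2) : ℝ) :=
  ((exists_oseenKernel_bounds d).choose_spec.2 i j k).2.1 τ hτ

theorem norm_oseenKernel_le {τ : ℝ} (hτ : 0 < τ) (i j k : Fin d) (x : RSpace d) :
    ‖oseenKernel τ i j k x‖ ≤ oseenConst d * τ ^ (-(1 / 2 + d / 2) : ℝ) :=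
  ((exists_oseenKernel_bounds d).choose_spec.2 i j k).2.2.1 τ hτ x

theorem integral_norm_oseenKernel_sub_le {τ τ' : ℝ} (hτ : 0 < τ) (hτ' : 0 < τ') (i j k : Fin d) :
    ∫ x, ‖oseenKernel τ i j k x - oseenKernel τ' i j k x‖
      ≤ oseenConst d * |τ ^ (-(1 / 2) : ℝ) - τ' ^ (-(1 / 2) : ℝ)| := by
  have key := ((exists_oseenKernel_bounds d).choose_spec.2 i j k).2.2.2
  have hc := (oseenConst_pos d).le
  rcases le_total τ τ' with h | h
  · exact (key τ hτ τ' h).trans (mul_le_mul_of_nonneg_left (le_abs_self _) hc)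
  · simp_rw [norm_sub_rev (oseenKernel τ i j k _)]
    rw [abs_sub_comm]
    exact (key τ' hτ' τ h).trans (mul_le_mul_of_nonneg_left (le_abs_self _) hc)

/-- With `r = 1/p` the weights `1 - r` and `r` on the `L^1` and `L^∞` bounds give the singular order
`1/2 + d/(2p)`. -/
theorem oseenConst_interpolate {τ : ℝ} (hτ : 0 < τ) (r : ℝ) :
    (oseenConst d * τ ^ (-(1 / 2) : ℝ)) ^ (1 - r) * (oseenConst d * τ ^ (-(1 / 2 + d / 2) : ℝ)) ^ r
      = oseenConst d * τ ^ (-(1 / 2 + d / 2 * r)) := by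
  have hc := oseenConst_pos d
  rw [Real.mul_rpow hc.le (by positivity), Real.mul_rpow hc.le (by positivity),
    ← Real.rpow_mul hτ.le, ← Real.rpow_mul hτ.le, mul_mul_mul_comm, ← Real.rpow_add hc,
    ← Real.rpow_add hτ, sub_add_cancel, Real.rpow_one]
  ring_nf

theorem ofReal_natCast_cube_mul (d : ℕ) (c : ℝ) :
    ENNReal.ofReal ((d : ℝ) ^ 3 * c) = (d : ℝ≥0∞) ^ 3 * ENNReal.ofReal c := by
  rw [ENNReal.ofReal_mul (by positivity), ENNReal.ofReal_pow (Nat.cast_nonneg d),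
    ENNReal.ofReal_natCast]

theorem memLp_oseenFlow_aux (hp : 2 ≤ p) {τ : ℝ} (hτ : 0 < τ) {v : RSpace d → RSpace d}
    (hv : MemLp v p) : MemLp (oseenFlow τ v) p ∧ eLpNorm (oseenFlow τ v) p volume
      ≤ ENNReal.ofReal (d ^ 3 * oseenConst d * τ ^ (-singularOrder d p)) * eLpNorm v p volume
        * eLpNorm v p volume := by
  have hF := fun j k => isTame_mul_apply hp hv hv j k
  have hb := eLpNorm_tensorConv_le (fun i j k => isConvKernel_oseenKernel (d := d) hτ i j k) hp
    (fun j k => (hF j k).1) hv.1 hv.1 (fun j k => Eventually.of_forall fun y => by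
      rw [norm_mul]
      gcongr
      · exact PiLp.norm_apply_le (v y) j
      · exact PiLp.norm_apply_le (v y) k)
    (integral_norm_oseenKernel_le hτ) (norm_oseenKernel_le hτ)
  rw [← oseenFlow_eq_tensorConv, oseenConst_interpolate hτ] at hb
  have hc := oseenConst_pos d
  have hb' : eLpNorm (oseenFlow τ v) p volume
      ≤ ENNReal.ofReal (d ^ 3 * oseenConst d * τ ^ (-singularOrder d p)) * eLpNorm v p volume
        * eLpNorm v p volume := by
    refine hb.trans (le_of_eq ?_)
    rw [mul_assoc ((d : ℝ) ^ 3), ofReal_natCast_cube_mul, singularOrder]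
    simp only [mul_assoc]
  refine ⟨⟨aestronglyMeasurable_tensorConv (fun i j k => isConvKernel_oseenKernel hτ i j k)
    fun j k => (hF j k).1, hb'.trans_lt ?_⟩, hb'⟩
  exact ENNReal.mul_lt_top (ENNReal.mul_lt_top ENNReal.ofReal_lt_top hv.2) hv.2

theorem eLpNorm_oseenFlow_sub_le (hp : 2 ≤ p) {τ : ℝ} (hτ : 0 < τ) {v w : RSpace d → RSpace d}
    (hv : MemLp v p) (hw : MemLp w p) :
    eLpNorm (oseenFlow τ v - oseenFlow τ w) p volume
      ≤ ENNReal.ofReal (d ^ 3 * oseenConst d * τ ^ (-singularOrder d p)) * eLpNorm (v - w) p volume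
        * (eLpNorm v p volume + eLpNorm w p volume) := by
  have hK := fun i j k => isConvKernel_oseenKernel (d := d) hτ i j k
  have hFv := fun j k => isTame_mul_apply hp hv hv j k
  have hFw := fun j k => isTame_mul_apply hp hw hw j k
  have hb := eLpNorm_tensorConv_le hK hp
    (F := fun j k y => v y j * v y k - w y j * w y k)
    (fun j k => (hFv j k).1.sub (hFw j k).1) (hv.1.sub hw.1) (hv.1.norm.add hw.1.norm)
    (fun j k => Eventually.of_forall fun y => abs_mul_sub_mul_le (v y) (w y) j k)
    (integral_norm_oseenKernel_le hτ) (norm_oseenKernel_le hτ)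
  rw [← tensorConv_sub hK hFv hFw, ← oseenFlow_eq_tensorConv, ← oseenFlow_eq_tensorConv,
    oseenConst_interpolate hτ] at hb
  have hc := oseenConst_pos d
  have hadd : eLpNorm ((fun y => ‖v y‖) + fun y => ‖w y‖) p volume
      ≤ eLpNorm v p volume + eLpNorm w p volume := by
    have := eLpNorm_add_le hv.1.norm hw.1.norm (one_le_two.trans hp)
    rwa [eLpNorm_norm, eLpNorm_norm] at this
  calc _ ≤ _ := hb
    _ = ENNReal.ofReal (d ^ 3 * oseenConst d * τ ^ (-singularOrder d p)) * eLpNorm (v - w) p volume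
        * eLpNorm ((fun y => ‖v y‖) + fun y => ‖w y‖) p volume := by
      rw [mul_assoc ((d : ℝ) ^ 3), ofReal_natCast_cube_mul, singularOrder]
      simp only [mul_assoc]
    _ ≤ _ := by gcongr

/-- In the interpolated bound the `L^1` factor tends to zero and has the positive power `1 - 1/p`,
so it is enough that the `L^∞` factor stay bounded near `τ₀`. -/
theorem tendsto_eLpNorm_oseenFlow_sub (hp : 2 ≤ p) {τ₀ : ℝ} (hτ₀ : 0 < τ₀)
    {v : RSpace d → RSpace d} (hv : MemLp v p) :
    Tendsto (fun τ => eLpNorm (oseenFlow τ v - oseenFlow τ₀ v) p volume) (𝓝 τ₀) (𝓝 0) := by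
  have hF := fun j k => isTame_mul_apply hp hv hv j k
  have hc := oseenConst_pos d
  have hr : 0 < 1 - p.toReal⁻¹ := by
    by_cases hpt : p = ⊤
    · simp [hpt]
    have h1 : 2 ≤ p.toReal := by
      rw [← ENNReal.toReal_ofNat]
      exact ENNReal.toReal_mono hpt hp
    have := inv_le_of_inv_le₀ (by norm_num) (by simpa using h1 : (2⁻¹ : ℝ)⁻¹ ≤ p.toReal)
    linarith
  set D : ℝ := oseenConst d * (τ₀ / 2) ^ (-(1 / 2 + d / 2) : ℝ) + oseenConst d * τ₀ ^ (-(1 / 2 + d / 2) : ℝ)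
    with hD
  let A : ℝ → ℝ := fun τ => oseenConst d * |τ ^ (-(1 / 2) : ℝ) - τ₀ ^ (-(1 / 2) : ℝ)|
  have hA : Tendsto A (𝓝 τ₀) (𝓝 0) := by
    have h1 : ContinuousAt (fun τ : ℝ => τ ^ (-(1 / 2) : ℝ)) τ₀ :=
      Real.continuousAt_rpow_const _ _ (Or.inl hτ₀.ne')
    have h2 := ((h1.sub (continuousAt_const (y := τ₀ ^ (-(1 / 2) : ℝ)))).abs.const_mul
      (oseenConst d)).tendsto
    simpa [A] using h2
  have hlim : Tendsto (fun τ => (d : ℝ≥0∞) ^ 3 * (ENNReal.ofReal (A τ ^ (1 - p.toReal⁻¹) * D ^ p.toReal⁻¹)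
      * eLpNorm v p volume * eLpNorm v p volume)) (𝓝 τ₀) (𝓝 0) := by
    have h1 : Tendsto (fun τ => A τ ^ (1 - p.toReal⁻¹) * D ^ p.toReal⁻¹) (𝓝 τ₀) (𝓝 0) := by
      have := (hA.rpow_const (Or.inr hr.le)).mul_const (D ^ p.toReal⁻¹)
      rwa [Real.zero_rpow hr.ne', zero_mul] at this
    have h2 := (ENNReal.continuous_ofReal.tendsto 0).comp h1
    rw [ENNReal.ofReal_zero] at h2
    have h3 := ENNReal.Tendsto.mul_const (b := eLpNorm v p volume) h2 (Or.inr hv.2.ne)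
    have h4 := ENNReal.Tendsto.mul_const (b := eLpNorm v p volume) h3 (Or.inr hv.2.ne)
    have h5 := ENNReal.Tendsto.const_mul (a := (d : ℝ≥0∞) ^ 3) h4
      (Or.inr (ENNReal.pow_ne_top (ENNReal.natCast_ne_top d)))
    simpa using h5
  refine tendsto_of_tendsto_of_tendsto_of_le_of_le' tendsto_const_nhds hlim
    (Eventually.of_forall fun _ => zero_le) ?_
  filter_upwards [Ioi_mem_nhds (show τ₀ / 2 < τ₀ by linarith)] with τ hτ
  have hτ0 : 0 < τ := lt_trans (by positivity) hτ
  have hK := fun i j k => isConvKernel_oseenKernel (d := d) hτ0 i j k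
  have hK₀ := fun i j k => isConvKernel_oseenKernel (d := d) hτ₀ i j k
  rw [oseenFlow_eq_tensorConv, oseenFlow_eq_tensorConv, tensorConv_kernel_sub hK hK₀ hF]
  refine eLpNorm_tensorConv_le (fun i j k => (hK i j k).sub (hK₀ i j k)) hp
    (fun j k => (hF j k).1) hv.1 hv.1 (fun j k => Eventually.of_forall fun y => ?_)
    (integral_norm_oseenKernel_sub_le hτ0 hτ₀) (fun i j k x => ?_)
  · rw [norm_mul]
    gcongr
    · exact PiLp.norm_apply_le (v y) j
    · exact PiLp.norm_apply_le (v y) k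
  · refine (norm_sub_le _ _).trans (add_le_add ?_ (norm_oseenKernel_le hτ₀ i j k x))
    refine (norm_oseenKernel_le hτ0 i j k x).trans ?_
    have h0 : (0 : ℝ) ≤ d / 2 := by positivity
    exact mul_le_mul_of_nonneg_left
      (Real.rpow_le_rpow_of_nonpos (by positivity) (le_of_lt hτ) (by linarith)) hc.le

open Classical in
/-- The quadratic map `v ↦ e^{τΔ} ℙ ∇·(v ⊗ v)` on `L^p`. -/
def oseenLp (τ : ℝ) (v : LpField d p) : LpField d p :=
  if h : MemLp (oseenFlow τ v) p (volume : Measure (RSpace d)) then h.toLp _ else 0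

theorem oseenLp_eq (hp : 2 ≤ p) {τ : ℝ} (hτ : 0 < τ) (v : LpField d p) :
    oseenLp τ v = (memLp_oseenFlow_aux hp hτ (Lp.memLp v)).1.toLp _ :=
  dif_pos _

theorem coeFn_oseenLp (hp : 2 ≤ p) {τ : ℝ} (hτ : 0 < τ) (v : LpField d p) :
    oseenLp τ v =ᵐ[volume] oseenFlow τ v := by
  rw [oseenLp_eq hp hτ]
  exact MemLp.coeFn_toLp _

theorem singularQuadratic_oseenLp [Fact (1 ≤ p)] (hp : 2 ≤ p) (ha : singularOrder d p < 1) :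
    SingularQuadratic (oseenLp : ℝ → LpField d p → LpField d p) (d ^ 3 * oseenConst d)
      (singularOrder d p) where
  nonneg := by
    have := oseenConst_pos d
    positivity
  lt_one := ha
  zero := by
    intro r hr
    rw [oseenLp_eq hp hr, ← norm_le_zero_iff, Lp.norm_toLp]
    have h0 : eLpNorm ((0 : LpField d p) : RSpace d → RSpace d) p volume = 0 := by
      rw [eLpNorm_congr_ae (Lp.coeFn_zero _ _ _), eLpNorm_zero]
    have h1 := (memLp_oseenFlow_aux hp hr (Lp.memLp (0 : LpField d p))).2
    rw [h0, mul_zero] at h1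
    rw [le_zero_iff.1 h1, ENNReal.toReal_zero]
  lipschitz := by
    intro r hr v w
    have hc := oseenConst_pos d
    have h1 := eLpNorm_oseenFlow_sub_le hp hr (Lp.memLp v) (Lp.memLp w)
    rw [oseenLp_eq hp hr, oseenLp_eq hp hr, ← MemLp.toLp_sub, Lp.norm_toLp]
    have h2 := ENNReal.toReal_mono (ENNReal.mul_ne_top (ENNReal.mul_ne_top ENNReal.ofReal_ne_top
      ((Lp.memLp v).sub (Lp.memLp w)).2.ne) (ENNReal.add_ne_top.2 ⟨Lp.eLpNorm_ne_top v,
        Lp.eLpNorm_ne_top w⟩)) h1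
    refine h2.trans (le_of_eq ?_)
    rw [ENNReal.toReal_mul, ENNReal.toReal_mul, ENNReal.toReal_ofReal (by positivity),
      ENNReal.toReal_add (Lp.eLpNorm_ne_top v) (Lp.eLpNorm_ne_top w), ← Lp.norm_def, ← Lp.norm_def,
      ← eLpNorm_congr_ae (Lp.coeFn_sub v w), ← Lp.norm_def]
    ring
  continuousOn := by
    intro v r hr
    have hr : 0 < r := hr
    apply ContinuousAt.continuousWithinAt
    rw [ContinuousAt, tendsto_iff_norm_sub_tendsto_zero]
    have h1 := tendsto_eLpNorm_oseenFlow_sub hp hr (Lp.memLp v)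
    have h2 := (ENNReal.tendsto_toReal ENNReal.zero_ne_top).comp h1
    rw [ENNReal.toReal_zero] at h2
    refine h2.congr' ?_
    filter_upwards [Ioi_mem_nhds hr] with τ hτ
    rw [oseenLp_eq hp hτ, oseenLp_eq hp hr, ← MemLp.toLp_sub, Lp.norm_toLp, Function.comp_apply]

end OseenLp

/-! ### The heat semigroup on `L^p` -/

section HeatLp

variable {d : ℕ} {p : ℝ≥0∞} [hp1 : Fact (1 ≤ p)]

theorem memLp_heatFlow {t : ℝ} (ht : 0 < t) {v : RSpace d → RSpace d} (hv : MemLp v p) :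
    MemLp (heatFlow t v) p :=
  (isConvKernel_gaussKernel ht).memLp_conv hp1.out hv

open Classical in
/-- The heat semigroup on `L^p`. -/
def heatLp (v : LpField d p) (t : ℝ) : LpField d p :=
  if h : MemLp (heatFlow t v) p (volume : Measure (RSpace d)) then h.toLp _ else 0

theorem heatLp_eq {t : ℝ} (ht : 0 < t) (v : LpField d p) :
    heatLp v t = (memLp_heatFlow ht (Lp.memLp v)).toLp _ :=
  dif_pos _

theorem coeFn_heatLp {t : ℝ} (ht : 0 < t) (v : LpField d p) :
    heatLp v t =ᵐ[volume] heatFlow t v := by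
  rw [heatLp_eq ht]
  exact MemLp.coeFn_toLp _

theorem norm_heatLp_le {t : ℝ} (ht : 0 < t) (v : LpField d p) : ‖heatLp v t‖ ≤ ‖v‖ := by
  rw [heatLp_eq ht, Lp.norm_toLp, Lp.norm_def]
  exact ENNReal.toReal_mono (Lp.eLpNorm_ne_top v) (eLpNorm_heatFlow_le ht hp1.out (Lp.memLp v).1)

theorem norm_heatLp_le_of_sparse (χ : LPCutoff d) {t : ℝ} (ht : 0 < t) {v : LpField d p} {β J : ℝ}
    (hβ : 0 ≤ β) (hs : IsFreqSparse χ p β J v) :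
    ‖heatLp v t‖ ≤ (β + (t ^ (-(1 / 2) : ℝ) * 2 ^ ((d : ℝ) / 2))
      * (((2 : ℝ) ^ J)⁻¹ * lowFreqMoment χ)) * ‖v‖ := by
  have hm := lowFreqMoment_nonneg χ
  have h := eLpNorm_heatFlow_le_of_sparse χ ht hp1.out (Lp.memLp v) hs
  rw [← add_mul, ← ENNReal.ofReal_add hβ (by positivity)] at h
  rw [heatLp_eq ht, Lp.norm_toLp, Lp.norm_def]
  refine (ENNReal.toReal_mono (ENNReal.mul_ne_top ENNReal.ofReal_ne_top
    (Lp.eLpNorm_ne_top v)) h).trans (le_of_eq ?_)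
  rw [ENNReal.toReal_mul, ENNReal.toReal_ofReal (by positivity)]

/-- Away from `t = 0` this follows from continuity of the Gauss kernel in `L^1`, hence holds for `p
= ∞` too. -/
theorem continuousOn_heatLp (v : LpField d p) : ContinuousOn (heatLp v) (Ioi 0) := by
  intro t₀ ht₀
  have ht₀ : 0 < t₀ := ht₀
  apply ContinuousAt.continuousWithinAt
  rw [ContinuousAt, tendsto_iff_norm_sub_tendsto_zero]
  have h1 := (tendsto_integral_norm_gaussKernel_sub (d := d) ht₀).mul_const ‖v‖
  rw [zero_mul] at h1
  refine squeeze_zero' (Eventually.of_forall fun _ => norm_nonneg _) ?_ h1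
  filter_upwards [Ioi_mem_nhds ht₀] with t ht
  have ht : 0 < t := ht
  have hk := isConvKernel_gaussKernel (d := d) ht
  have hk₀ := isConvKernel_gaussKernel (d := d) ht₀
  have hv := (Lp.memLp v).isTame hp1.out
  have h2 := (hk.sub hk₀).eLpNorm_conv_le hp1.out (Lp.memLp v).1
  have h3 : (fun x => ∫ y, (gaussKernel t (x - y) - gaussKernel t₀ (x - y)) • (v : RSpace d → RSpace d) y)
      = heatFlow t v - heatFlow t₀ v := by
    ext1 x
    simp_rw [sub_smul]
    exact integral_sub (hk.integrable_smul hv x) (hk₀.integrable_smul hv x)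
  rw [h3] at h2
  rw [heatLp_eq ht, heatLp_eq ht₀, ← MemLp.toLp_sub, Lp.norm_toLp, Lp.norm_def]
  refine (ENNReal.toReal_mono (ENNReal.mul_ne_top ENNReal.ofReal_ne_top
    (Lp.eLpNorm_ne_top v)) h2).trans (le_of_eq ?_)
  rw [ENNReal.toReal_mul, ENNReal.toReal_ofReal (integral_nonneg fun _ => norm_nonneg _)]

theorem tendsto_heatLp (hpt : p ≠ ⊤) (v : LpField d p) : Tendsto (heatLp v) (𝓝[>] 0) (𝓝 v) := by
  rw [tendsto_iff_norm_sub_tendsto_zero]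
  have h := (ENNReal.tendsto_toReal ENNReal.zero_ne_top).comp (tendsto_eLpNorm_heatFlow_sub hpt v)
  rw [ENNReal.toReal_zero] at h
  refine h.congr' ?_
  filter_upwards [self_mem_nhdsWithin] with t ht
  rw [Lp.norm_def, Function.comp_apply]
  congr 1
  refine eLpNorm_congr_ae ?_
  filter_upwards [Lp.coeFn_sub (heatLp v t) v, coeFn_heatLp ht v] with x h1 h2
  rw [h1, Pi.sub_apply, h2]

end HeatLp

/-! ### Strong solutions and the Volterra equation -/

section Strong

variable {d : ℕ} {p : ℝ≥0∞} [hp1 : Fact (1 ≤ p)] {T : ℝ} {u₀ : LpField d p} {u : ℝ → LpField d p}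

/-- The integrand in Duhamel's formula is determined in `L^p` for every `s` in `(0,t)`, so every
strong solution falls under the abstract uniqueness theorem. -/
theorem IsStrongSolution.eq_heatLp_sub (hp : 2 ≤ p) (hu : IsStrongSolution T u₀ u) {t : ℝ}
    (ht : t ∈ Ioo 0 T) : u t = heatLp u₀ t - volterraTerm oseenLp u t := by
  obtain ⟨w, hw, -, hut⟩ := hu.duhamel t ht
  have h1 : volterraTerm oseenLp u t = ∫ s in (0 : ℝ)..t, w s := by
    rw [volterraTerm, intervalIntegral.integral_of_le ht.1.le,
      intervalIntegral.integral_of_le ht.1.le, integral_Ioc_eq_integral_Ioo,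
      integral_Ioc_eq_integral_Ioo]
    refine setIntegral_congr_fun measurableSet_Ioo fun s hs => Lp.ext ?_
    exact (coeFn_oseenLp hp (sub_pos.2 hs.2) (u s)).trans (hw s hs).symm
  rw [h1]
  refine Lp.ext ?_
  filter_upwards [hut, coeFn_heatLp ht.1 u₀,
    Lp.coeFn_sub (heatLp u₀ t) (∫ s in (0 : ℝ)..t, w s)] with x h1 h2 h3
  rw [h1, h3, Pi.sub_apply, h2]

theorem isStrongSolution_of_volterra (hp : 2 ≤ p) (ha : singularOrder d p < 1)
    (hdiv : IsDivFree u₀) {M : ℝ} (hc : ContinuousOn u (Ioo 0 T)) (hM : ∀ t ∈ Ioo 0 T, ‖u t‖ ≤ M)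
    (he : ∀ t ∈ Ioo 0 T, u t = heatLp u₀ t - volterraTerm oseenLp u t) (hT : 0 < T) :
    IsStrongSolution T u₀ u := by
  have hQ := singularQuadratic_oseenLp (d := d) hp ha
  have hM' : ∀ {t}, t ∈ Ioo 0 T → ∀ s ∈ Ioo 0 t, ‖u s‖ ≤ M := fun ht s hs =>
    hM s ⟨hs.1, hs.2.trans ht.2⟩
  have hi : ∀ t ∈ Ioo 0 T, IntervalIntegrable (fun s => oseenLp (t - s) (u s)) volume 0 t :=
    fun t ht => hQ.intervalIntegrable hc ht.1.le ht.2.le (hM' ht)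
  refine ⟨hc, fun t ht => ⟨M, fun s hs => hM s ⟨hs.1, hs.2.trans_lt ht.2⟩⟩, fun hpt => ?_,
    fun t ht => ?_, fun t ht => ⟨fun s => oseenLp (t - s) (u s), fun s hs =>
      coeFn_oseenLp hp (sub_pos.2 hs.2) (u s), hi t ht, ?_⟩⟩
  -- The Duhamel term is `O(t^{1-a})`, so the initial condition is inherited from the heat flow.
  · have h1 : Tendsto (fun t : ℝ => d ^ 3 * oseenConst d * M ^ 2
        * (t ^ (1 - singularOrder d p) / (1 - singularOrder d p))) (𝓝[>] 0) (𝓝 0) := by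
      have h := ((Real.continuousAt_rpow_const 0 (1 - singularOrder d p)
        (Or.inr (sub_pos.2 ha).le)).tendsto.mono_left
        (nhdsWithin_le_nhds (s := Ioi 0))).div_const (1 - singularOrder d p)
      have h' := h.const_mul (d ^ 3 * oseenConst d * M ^ 2)
      rwa [Real.zero_rpow (sub_pos.2 ha).ne', zero_div, mul_zero] at h'
    have hV : Tendsto (volterraTerm oseenLp u) (𝓝[>] 0) (𝓝 0) := by
      refine squeeze_zero_norm' ?_ h1
      filter_upwards [Ioo_mem_nhdsGT hT] with t ht
      exact hQ.norm_volterraTerm_le ht.1.le (hM' ht)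
    have h2 := (tendsto_heatLp hpt u₀).sub hV
    rw [sub_zero] at h2
    refine h2.congr' ?_
    filter_upwards [Ioo_mem_nhdsGT hT] with t ht
    exact (he t ht).symm
  · rw [he t ht]
    refine IsDivFree.sub (isDivFree_congr (coeFn_heatLp ht.1 u₀).symm
      (hdiv.heatFlow ht.1 ((Lp.memLp u₀).isTame hp1.out)))
      (isDivFree_intervalIntegral ht.1.le (hi t ht) fun s hs => ?_)
    have hs' : 0 < t - s := sub_pos.2 hs.2
    exact isDivFree_congr (coeFn_oseenLp hp hs' (u s)).symm
      (isDivFree_oseenFlow hp hs' (Lp.memLp (u s)))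
  · filter_upwards [Lp.coeFn_sub (heatLp u₀ t) (volterraTerm oseenLp u t),
      coeFn_heatLp ht.1 u₀] with x h1 h2
    rw [he t ht, h1, Pi.sub_apply, h2]
    rfl

end Strong

/-! ### Existence, uniqueness and decay -/

section Main

variable {d : ℕ} {p : ℝ≥0∞}

theorem one_sub_singularOrder (d : ℕ) (p : ℝ≥0∞) :
    1 - singularOrder d p = 1 / 2 * (1 - ((d : ℝ≥0∞) / p).toReal) := by
  rw [singularOrder, ENNReal.toReal_div, ENNReal.toReal_natCast]
  ring

theorem singularOrder_lt_one (h : (d : ℝ≥0∞) < p) : singularOrder d p < 1 := by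
  rw [singularOrder]
  by_cases hpt : p = ⊤
  · simp only [hpt, ENNReal.toReal_top, inv_zero, mul_zero]
    norm_num
  have h1 : (d : ℝ) < p.toReal := by
    rw [← ENNReal.toReal_natCast]
    exact (ENNReal.toReal_lt_toReal (ENNReal.natCast_ne_top d) hpt).2 h
  have h0 : 0 < p.toReal := (Nat.cast_nonneg d).trans_lt h1
  have h2 : (d : ℝ) * p.toReal⁻¹ < 1 := by
    rw [← div_eq_mul_inv, div_lt_one h0]
    exact h1
  linarith

/-- The constant in the existence time. -/
def existenceConst (d : ℕ) (p : ℝ≥0∞) : ℝ :=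
  if singularOrder d p < 1 then
    8 * ((d : ℝ) ^ 3 * oseenConst d + 1) / (1 - singularOrder d p)
  -- A default that makes positivity hold for every `p`; it is not reached when `d < p`.
  else 1

theorem existenceConst_pos (d : ℕ) (p : ℝ≥0∞) : 0 < existenceConst d p := by
  have := oseenConst_pos d
  rw [existenceConst]
  split_ifs with h
  · have := sub_pos.2 h
    positivity
  · exact one_pos

/-- The frequency threshold, in units of the inverse diffusion length. -/
def frequencyConst (χ : LPCutoff d) : ℝ := 4 * 2 ^ ((d : ℝ) / 2) * lowFreqMoment χ + 1

theorem frequencyConst_pos (χ : LPCutoff d) : 0 < frequencyConst χ := by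
  have := lowFreqMoment_nonneg χ
  rw [frequencyConst]
  positivity

/-- Above the frequency threshold the high frequencies are damped to a quarter of `γ`. -/
theorem frequencyConst_spec (χ : LPCutoff d) {γ t J : ℝ} (hγ : 0 < γ) (ht : 0 < t)
    (hJ : frequencyConst χ * γ⁻¹ * t ^ (-(1 / 2 : ℝ)) ≤ (2 : ℝ) ^ J) :
    (t ^ (-(1 / 2) : ℝ) * 2 ^ ((d : ℝ) / 2)) * (((2 : ℝ) ^ J)⁻¹ * lowFreqMoment χ) ≤ γ / 4 := by
  have hm := lowFreqMoment_nonneg χ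
  have h2 : (0 : ℝ) < 2 ^ J := by positivity
  have hτ : 0 < t ^ (-(1 / 2 : ℝ)) := by positivity
  have h1 : frequencyConst χ * t ^ (-(1 / 2 : ℝ)) ≤ γ * 2 ^ J := by
    have := mul_le_mul_of_nonneg_left hJ hγ.le
    rwa [mul_assoc (frequencyConst χ), mul_left_comm (frequencyConst χ), ← mul_assoc γ γ⁻¹,
      mul_inv_cancel₀ hγ.ne', one_mul] at this
  rw [show (t ^ (-(1 / 2) : ℝ) * 2 ^ ((d : ℝ) / 2)) * (((2 : ℝ) ^ J)⁻¹ * lowFreqMoment χ)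
    = (t ^ (-(1 / 2) : ℝ) * 2 ^ ((d : ℝ) / 2)) * lowFreqMoment χ / 2 ^ J by ring, div_le_iff₀ h2]
  rw [frequencyConst] at h1
  linarith

/-- The existence time of the solution. -/
theorem exists_existence_time {x γ : ℝ} (hx : 0 ≤ x) (hγ : 0 < γ) (ha : singularOrder d p < 1) :
    ∃ T : ℝ, 0 < T ∧ (x ≠ 0 → x * T ^ (1 - singularOrder d p) = γ / (2 * existenceConst d p)) ∧
      4 * (d ^ 3 * oseenConst d) * x * (T ^ (1 - singularOrder d p) / (1 - singularOrder d p))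
        ≤ γ / 4 := by
  have hs := sub_pos.2 ha
  have hC := existenceConst_pos d p
  have hc := oseenConst_pos d
  rcases hx.eq_or_lt with rfl | hx
  · refine ⟨1, one_pos, fun h => absurd rfl h, ?_⟩
    rw [mul_zero, zero_mul]
    positivity
  have hT : ((γ / (2 * existenceConst d p * x)) ^ (1 - singularOrder d p)⁻¹)
      ^ (1 - singularOrder d p) = γ / (2 * existenceConst d p * x) :=
    Real.rpow_inv_rpow (by positivity) hs.ne'
  refine ⟨(γ / (2 * existenceConst d p * x)) ^ (1 - singularOrder d p)⁻¹, by positivity,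
    fun _ => ?_, ?_⟩
  · rw [hT]
    field_simp
  · rw [hT, existenceConst, if_pos ha]
    have hκ : 0 < (d : ℝ) ^ 3 * oseenConst d + 1 := by positivity
    generalize (d : ℝ) ^ 3 * oseenConst d = κ at hκ ⊢
    generalize 1 - singularOrder d p = s at hs ⊢
    -- The factor `8` in the constant produces `γ/4`; `κ + 1` in place of `κ` keeps the constant
    -- positive without knowing `κ > 0`.
    rw [show 4 * κ * x * (γ / (2 * (8 * (κ + 1) / s) * x) / s) = γ / 4 * (κ / (κ + 1)) by
      field_simp; ring]
    refine mul_le_of_le_one_right (by positivity) ?_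
    rw [div_le_one hκ]
    linarith

end Main

/-- `C p` depends only on `d` and `p`, and `K χ` only on `d` and the Littlewood-Paley cut-off. -/
theorem proposition3p2 (d : ℕ) (hd : 2 ≤ d) :
    ∃ (C : ℝ≥0∞ → ℝ) (K : LPCutoff d → ℝ), (∀ p, 0 < C p) ∧ (∀ χ, 0 < K χ) ∧
      ∀ (p : ℝ≥0∞) [Fact (1 ≤ p)], (d : ℝ≥0∞) < p →
      ∀ u₀ : LpField d p, IsDivFree u₀ →
      ∀ γ : ℝ, 0 < γ → γ < 1 →
      ∃ T : ℝ, 0 < T ∧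
        (u₀ ≠ 0 → ‖u₀‖ * T ^ ((1 / 2 : ℝ) * (1 - ((d : ℝ≥0∞) / p).toReal)) = γ / (2 * C p)) ∧
        ∃ u : ℝ → LpField d p,
          IsStrongSolution T u₀ u ∧
          (∀ v : ℝ → LpField d p, IsStrongSolution T u₀ v → ∀ t ∈ Ioo 0 T, v t = u t) ∧
          ∀ χ : LPCutoff d, ∀ t ∈ Ioo 0 T, ∀ J : ℝ,
            K χ * γ⁻¹ * t ^ (-(1 / 2 : ℝ)) ≤ (2 : ℝ) ^ J →
            IsFreqSparse χ p (γ / 2) J u₀ →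
            ‖u t‖ ≤ γ * ‖u₀‖ := by
  refine ⟨existenceConst d, frequencyConst, existenceConst_pos d, frequencyConst_pos, ?_⟩
  intro p _ hp u₀ hdiv γ hγ hγ1
  -- The condition `d ≥ 2` enters here: with `p ≥ 2` the product `u ⊗ u` lies in `L^{p/2}` with `p/2
  -- ≥ 1`.
  have hp2 : 2 ≤ p := le_trans (by exact_mod_cast hd) hp.le
  have ha := singularOrder_lt_one hp
  have hQ := singularQuadratic_oseenLp hp2 ha
  obtain ⟨T, hT, hTeq, hθ⟩ := exists_existence_time (norm_nonneg u₀) hγ ha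
  obtain ⟨u, hc, hb, he, hsmall⟩ := hQ.exists_solution hT
    ((continuousOn_heatLp u₀).mono Ioo_subset_Ioi_self) (fun t ht => norm_heatLp_le ht.1 u₀) hθ
    (by linarith)
  have hu := isStrongSolution_of_volterra hp2 ha hdiv hc hb he hT
  refine ⟨T, hT, fun h => ?_, u, hu, fun v hv => ?_, ?_⟩
  · rw [← one_sub_singularOrder]
    exact hTeq (norm_ne_zero_iff.2 h)
  · exact hQ.unique hv.continuousOn hc hv.bounded hu.bounded
      (fun t ht => hv.eq_heatLp_sub hp2 ht) he
  · intro χ t ht J hJ hs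
    rw [he t ht]
    have h1 := norm_heatLp_le_of_sparse χ ht.1 (by positivity) hs
    -- The budget: `γ/2` for the low frequencies and `γ/4` for the high ones; the Duhamel term takes
    -- the remaining `γ/4`.
    have h2 := mul_le_mul_of_nonneg_right
      (add_le_add_right (frequencyConst_spec χ hγ ht.1 hJ) (γ / 2)) (norm_nonneg u₀)
    refine (norm_sub_le _ _).trans ((add_le_add (h1.trans h2) (hsmall t ht)).trans (le_of_eq ?_))
    ring

end
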